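/- Let $\Omega\subset\mathbb R^N$ be a bounded domain (nonempty, open, connected) with smooth ($C^\infty$) boundary, let $\mathcal O\subset\mathbb R^N$ be open with $\overline\Omega\subset\mathcal O$, let $\mathcal S_N$ be the space of real symmetric $N\times N$ matrices with its usual order, and let $F:\mathcal O\times\mathbb R\times\mathbb R^N\times\mathcal S_N\to\mathbb R$ be continuous. Assume: (H1) $F(x,r,p,X+Y)\le F(x,r,p,X)$ for all $(x,r,p,X)$ and all $Y\ge0$ in $\mathcal S_N$; (H2) for some $\alpha>0$, $F(x,\tau r,\tau p,\tau X)=\tau^\alpha F(x,r,p,X)$ for all $(x,r,p,X)$ and all $\tau\ge0$; (H3) $r\mapsto F(x,r,p,X)$ is continuous, uniformly with respect to $(x,p,X)\in\mathcal O\times\mathbb R^N\times\mathcal S_N$; (H4) for all $R>0$ there is $\omega\in C([0,+\infty))$ with $\omega(0)=0$ such that, whenever $X,Y\in\mathcal S_N$ and $\sigma>0$ satisfy $$-3\sigma\begin{pmatrix}I&0\\0&I\end{pmatrix}\le\begin{pmatrix}X&0\\0&-Y\end{pmatrix}\le3\sigma\begin{pmatrix}I&-I\\-I&I\end{pmatrix},$$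 one has $F(y,r,\sigma(x-y),Y)-F(x,r,\sigma(x-y),X)\le\omega(\sigma|x-y|^2+|x-y|)$ for all $x,y\in\mathcal O$, $|r|\le R$; and, for some open neighbourhood $V$ of $\partial\Omega$: (H5) for all $R>0$, $(r,p,X)\mapsto F(x,r,p,X)$ is uniformly continuous in $[0,R]\times\mathbb R^N\times\mathcal S_N$, uniformly with respect to $x\in\overline\Omega\cap V$; (H6) for all $R>0$ there is $K>0$ such that, whenever $X,Y\in\mathcal S_N$ and $\sigma>0$ satisfy $$-\sigma\begin{pmatrix}I&0\\0&I\end{pmatrix}\le\begin{pmatrix}X&0\\0&-Y\end{pmatrix}\le\sigma\begin{pmatrix}I&-I\\-I&I\end{pmatrix},$$ one has $F(y,r,p,Y)-F(x,r,p,X)\le K(1+|x-y||p|+\sigma|x-y|^2)$ for all $x,y\in\overline\Omega\cap V$, $|r|\le R$, $p\in\mathbb R^N$. Write $F[\phi]=F(x,\phi,D\phi,D^2\phi)$; differential inequalities are understood in the viscosity sense. Assume finally that every $\xi\in\partial\Omega$ admits a barrier: there are an open ball $B$ centred at $\xi$ and a nonnegative $w\in C(\overline{\Omega\cap B})$ with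 $w(\xi)=0$ and $F[w]\ge1$ in $\Omega\cap B$. Define, in $[-\infty,+\infty]$, $$\overline\lambda_1(F,\Omega)=\sup\{\lambda\in\mathbb R:\ \exists\,\phi\in LSC(\Omega),\ \inf_\Omega\phi>0,\ F[\phi]-\lambda\phi^\alpha\ge0\text{ in }\Omega\},$$ $$\mu_1(F,\Omega)=\sup\{\lambda\in\mathbb R:\ \exists\,\Omega'\text{ open},\ \overline\Omega\subset\Omega'\subset\mathcal O,\ \exists\,\phi\in LSC(\Omega'),\ \phi>0\text{ and }F[\phi]-\lambda\phi^\alpha\ge0\text{ in }\Omega'\}.$$ Then $$\mu_1(F,\Omega)=\overline\lambda_1(F,\Omega).$$ Consequently, $F$ satisfies the Maximum Principle in $\Omega$ if and only if $\overline\lambda_1(F,\Omega)>0$. Here the Maximum Principle means that $u\le0$ in $\overline\Omega$ for every $u\in USC(\overline\Omega)$ that is a viscosity subsolution of $F[u]=0$ in $\Omega$, $u=0$ on $\partial\Omega$, that is, such that whenever $\varphi\in C^2$ and $u-\varphi$ attains its maximum over $\overline\Omega$ at $\xi$, one has $F(\xi,u(\xi),D\varphi(\xi),D^2\varphi(\xi))\le0$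 if $\xi\in\Omega$, and $\min\big[u(\xi),F(\xi,u(\xi),D\varphi(\xi),D^2\varphi(\xi))\big]\le0$ if $\xi\in\partial\Omega$. -/

import Mathlib

open scoped ContDiff

noncomputable section

namespace DegElliptic

/-- Euclidean space `ℝ^N`. -/
abbrev Eu (N : ℕ) := EuclideanSpace ℝ (Fin N)

/-- Real `N × N` matrices. Operators are only ever constrained at, and evaluated on, symmetric
ones. -/
abbrev Mat (N : ℕ) := Matrix (Fin N) (Fin N) ℝ

/-- A fully nonlinear second order operator `F(x, r, p, X)`. It is a total function; every
hypothesis below concerns only `x` in a given set and symmetric `X`. -/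
abbrev Operator (N : ℕ) := Eu N → ℝ → Eu N → Mat N → ℝ

/-- The Hessian matrix `D²ψ(x)`. -/
def hess {N : ℕ} (ψ : Eu N → ℝ) (x : Eu N) : Mat N :=
  Matrix.of fun i j =>
    fderiv ℝ (fderiv ℝ ψ) x (EuclideanSpace.single i 1) (EuclideanSpace.single j 1)

/-- Joint continuity of `F` on `O × ℝ × ℝ^N × S_N`. -/
def IsContinuousOperator {N : ℕ} (F : Operator N) (O : Set (Eu N)) : Prop :=
  ContinuousOn (fun q : Eu N × ℝ × Eu N × Mat N => F q.1 q.2.1 q.2.2.1 q.2.2.2)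
    {q | q.1 ∈ O ∧ q.2.2.2.IsSymm}

/-- Degenerate ellipticity: `F` is non-increasing in the matrix variable. -/
def IsDegenerateElliptic {N : ℕ} (F : Operator N) (O : Set (Eu N)) : Prop :=
  ∀ x ∈ O, ∀ (r : ℝ) (p : Eu N) (X Y : Mat N), X.IsSymm → Y.IsSymm → Y.PosSemidef →
    F x r p (X + Y) - F x r p X ≤ 0

/-- Positive homogeneity of degree `α` in `(r, p, X)`. -/
def IsHomogeneous {N : ℕ} (F : Operator N) (O : Set (Eu N)) (α : ℝ) : Prop :=
  ∀ x ∈ O, ∀ (r : ℝ) (p : Eu N) (X : Mat N), X.IsSymm → ∀ τ : ℝ, 0 ≤ τ →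
    F x (τ * r) (τ • p) (τ • X) = τ ^ α * F x r p X

/-- `r ↦ F(x, r, p, X)` is continuous, uniformly with respect to `(x, p, X)`. -/
def IsUniformlyContinuousInValue {N : ℕ} (F : Operator N) (O : Set (Eu N)) : Prop :=
  ∀ r : ℝ, ∀ ε > 0, ∃ δ > 0, ∀ s : ℝ, |s - r| < δ →
    ∀ x ∈ O, ∀ (p : Eu N) (X : Mat N), X.IsSymm → |F x s p X - F x r p X| < ε

/-- The two-sided block matrix inequality
`-c (I 0; 0 I) ≤ (X 0; 0 -Y) ≤ c (I -I; -I I)`. -/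
def BlockIneq {N : ℕ} (c : ℝ) (X Y : Mat N) : Prop :=
  (Matrix.fromBlocks X 0 0 (-Y)
      - (-c) • (Matrix.fromBlocks 1 0 0 1 : Matrix (Fin N ⊕ Fin N) (Fin N ⊕ Fin N) ℝ)).PosSemidef ∧
  (c • (Matrix.fromBlocks 1 (-1) (-1) 1 : Matrix (Fin N ⊕ Fin N) (Fin N ⊕ Fin N) ℝ)
      - Matrix.fromBlocks X 0 0 (-Y)).PosSemidef

/-- The structure condition of the comparison theory of viscosity solutions. -/
def StructureCondition {N : ℕ} (F : Operator N) (O : Set (Eu N)) : Prop :=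
  ∀ R > 0, ∃ m : ℝ → ℝ, ContinuousOn m (Set.Ici 0) ∧ m 0 = 0 ∧
    ∀ X Y : Mat N, X.IsSymm → Y.IsSymm → ∀ σ > 0, BlockIneq (3 * σ) X Y →
      ∀ x ∈ O, ∀ y ∈ O, ∀ r : ℝ, |r| ≤ R →
        F y r (σ • (x - y)) Y - F x r (σ • (x - y)) X ≤ m (σ * ‖x - y‖ ^ 2 + ‖x - y‖)

/-- For all `R > 0`, `(r, p, X) ↦ F(x, r, p, X)` is uniformly continuous on
`[0, R] × ℝ^N × S_N`, uniformly with respect to `x ∈ A`. -/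
def IsUniformlyContinuousNear {N : ℕ} (F : Operator N) (A : Set (Eu N)) : Prop :=
  ∀ R > 0, ∀ ε > 0, ∃ δ > 0, ∀ x ∈ A,
    ∀ r ∈ Set.Icc (0 : ℝ) R, ∀ s ∈ Set.Icc (0 : ℝ) R, ∀ p q : Eu N,
    ∀ X Y : Mat N, X.IsSymm → Y.IsSymm →
      |r - s| < δ → ‖p - q‖ < δ → (∀ i j, |X i j - Y i j| < δ) →
        |F x r p X - F x s q Y| < ε

/-- The structure condition required near the boundary, for `x, y ∈ A`. -/
def BoundaryStructureCondition {N : ℕ} (F : Operator N) (A : Set (Eu N)) : Prop :=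
  ∀ R > 0, ∃ K > 0,
    ∀ X Y : Mat N, X.IsSymm → Y.IsSymm → ∀ σ > 0, BlockIneq σ X Y →
      ∀ x ∈ A, ∀ y ∈ A, ∀ r : ℝ, |r| ≤ R → ∀ p : Eu N,
        F y r p Y - F x r p X ≤ K * (1 + ‖x - y‖ * ‖p‖ + σ * ‖x - y‖ ^ 2)

/-- `φ` satisfies `G(x, φ, Dφ, D²φ) ≥ 0` in the open set `U` in the viscosity sense (the
semicontinuity of `φ` is required separately). -/
def IsViscositySupersolution {N : ℕ} (G : Operator N) (U : Set (Eu N)) (φ : Eu N → ℝ) : Prop :=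
  ∀ x ∈ U, ∀ ψ : Eu N → ℝ, ContDiffAt ℝ 2 ψ x →
    IsLocalMinOn (fun y => φ y - ψ y) U x → 0 ≤ G x (φ x) (gradient ψ x) (hess ψ x)

/-- The operator `F[u] - l u^α`, to be used on positive functions `u`. -/
def shifted {N : ℕ} (F : Operator N) (α l : ℝ) : Operator N :=
  fun x r p X => F x r p X - l * r ^ α

/-- `λ̄₁(F, Ω)`: the supremum (in `[-∞, +∞]`) of the real `l` for which there is a lower
semicontinuous `φ` on `Ω` with `inf_Ω φ > 0` and `F[φ] - l φ^α ≥ 0` in `Ω`. -/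
def lambdaBar {N : ℕ} (F : Operator N) (α : ℝ) (Ω : Set (Eu N)) : EReal :=
  sSup ((fun l : ℝ => (l : EReal)) '' {l : ℝ | ∃ φ : Eu N → ℝ,
    LowerSemicontinuousOn φ Ω ∧ (∃ c > 0, ∀ x ∈ Ω, c ≤ φ x) ∧
    IsViscositySupersolution (shifted F α l) Ω φ})

/-- `μ₁(F, Ω)` for an operator defined in `O`: the supremum (in `[-∞, +∞]`) of the real `l` for
which there are an open `Ω'` with `closure Ω ⊆ Ω' ⊆ O` and a positive lower semicontinuous `φ`
on `Ω'` with `F[φ] - l φ^α ≥ 0` in `Ω'`. -/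
def mu {N : ℕ} (F : Operator N) (α : ℝ) (O Ω : Set (Eu N)) : EReal :=
  sSup ((fun l : ℝ => (l : EReal)) '' {l : ℝ | ∃ Ω' : Set (Eu N),
    IsOpen Ω' ∧ closure Ω ⊆ Ω' ∧ Ω' ⊆ O ∧ ∃ φ : Eu N → ℝ,
      LowerSemicontinuousOn φ Ω' ∧ (∀ x ∈ Ω', 0 < φ x) ∧
      IsViscositySupersolution (shifted F α l) Ω' φ})

/-- `u` is a viscosity subsolution of the Dirichlet problem `F[u] = 0` in `Ω`, `u = 0` on `∂Ω`,
the boundary condition being understood in the (relaxed) viscosity sense as well. -/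
def IsDirichletSubsolution {N : ℕ} (F : Operator N) (Ω : Set (Eu N)) (u : Eu N → ℝ) : Prop :=
  ∀ ψ : Eu N → ℝ, ContDiff ℝ 2 ψ → ∀ ξ ∈ closure Ω,
    IsMaxOn (fun y => u y - ψ y) (closure Ω) ξ →
      (ξ ∈ Ω → F ξ (u ξ) (gradient ψ ξ) (hess ψ ξ) ≤ 0) ∧
      (ξ ∈ frontier Ω → min (u ξ) (F ξ (u ξ) (gradient ψ ξ) (hess ψ ξ)) ≤ 0)

/-- The Maximum Principle for `F` in `Ω`. -/
def MaximumPrinciple {N : ℕ} (F : Operator N) (Ω : Set (Eu N)) : Prop :=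
  ∀ u : Eu N → ℝ, UpperSemicontinuousOn u (closure Ω) → IsDirichletSubsolution F Ω u →
    ∀ x ∈ closure Ω, u x ≤ 0

/-- The boundary point `ξ` admits a continuous barrier. -/
def AdmitsBarrier {N : ℕ} (F : Operator N) (Ω : Set (Eu N)) (ξ : Eu N) : Prop :=
  ∃ ρ > 0, ∃ w : Eu N → ℝ,
    ContinuousOn w (closure (Ω ∩ Metric.ball ξ ρ)) ∧
    (∀ x ∈ closure (Ω ∩ Metric.ball ξ ρ), 0 ≤ w x) ∧ w ξ = 0 ∧
    IsViscositySupersolution (fun x r p X => F x r p X - 1) (Ω ∩ Metric.ball ξ ρ) w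

/-- The boundary of the open set `Ω` is smooth: near each of its boundary points, `Ω` is the
positivity set of a smooth function with nonvanishing differential. -/
def HasSmoothBoundary {N : ℕ} (Ω : Set (Eu N)) : Prop :=
  ∀ ξ ∈ frontier Ω, ∃ W : Set (Eu N), IsOpen W ∧ ξ ∈ W ∧ ∃ g : Eu N → ℝ,
    ContDiffOn ℝ ∞ g W ∧ (∀ x ∈ W, fderiv ℝ g x ≠ 0) ∧ Ω ∩ W = {x ∈ W | 0 < g x}

end DegElliptic

end

noncomputable section

open scoped RealInnerProductSpace Topology
open Filter MeasureTheory

namespace DegElliptic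

/-! Two implications carry the theorem. (A) `maximumPrinciple_of_supersolution`: a φ with inf φ > 0
and F[φ] ≥ lφ^α, l > 0, together with barriers, forces the Maximum Principle. (B)
`exists_supersolution_of_maximumPrinciple`: the Maximum Principle produces a positive solution of
F[φ] ≥ εφ^α, for some ε > 0, in a whole neighbourhood of the closure of Ω. Restriction gives μ₁ ≤
λ̄₁. If l is admissible for λ̄₁ and μ₁ < l' < l, the operator F − l'|r|^α inherits the hypotheses of
F; (A) applies to it with the constant l − l', and (B) then gives μ₁ ≥ l' + ε, a contradiction. The
characterization of the Maximum Principle is (A) and (B) for F itself.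

For (A), a subsolution is first shown to be nonpositive on ∂Ω
(`IsDirichletSubsolution.nonpos_of_barrier`). The variables are doubled with a penalty shifted along
an inward direction, so that the point seen by the barrier falls inside Ω; the other point may lie
on ∂Ω, where the relaxed condition still gives the differential inequality because u > 0. The error
terms do not depend on the multiple k of the barrier, while its right-hand side grows like k^α, so a
large k is contradictory. In the interior (`posExt_nonpos_of_frontier`) F is not monotone in r. By
homogeneity the least multiple kφ lying above u⁺ is again a strict supersolution, and it touches u⁺;
hence the two values produced by doubling have a common limit, and uniform continuity in r replaces
monotonicity.

For (B), consider all upper semicontinuous v with 0 ≤ v ≤ 1 that vanish off a small closed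
neighbourhood of the closure of Ω and satisfy F[v] ≤ ε where v > 0. As the neighbourhoods and ε
shrink, the half-relaxed limit of these families is a Dirichlet subsolution, hence zero. So for
small parameters every such v is at most 1/2, the upper bound 1 is never active, and Perron's method
turns the largest v into a solution of F ≥ ε. It is positive because F vanishes at (x, 0, 0, 0).

The theorem on sums is proved by convex duality. A sup-convolution plus a quadratic is strongly
convex, the gradient of its conjugate is a 1-Lipschitz resolvent, and Rademacher's theorem for the
resolvent supplies the second order expansions. -/

/-! ### Second order expansions of strongly convex functions by duality. -/

/-- Second order Taylor expansion at a point where the derivative is differentiable. -/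
theorem taylor_two {E : Type*} [NormedAddCommGroup E] [NormedSpace ℝ E] {f : E → ℝ}
    {f' : E → E →L[ℝ] ℝ} {f'' : E →L[ℝ] E →L[ℝ] ℝ} {x : E}
    (hf : ∀ᶠ y in 𝓝 x, HasFDerivAt f (f' y) y) (hx : HasFDerivAt f' f'' x) {ε : ℝ} (hε : 0 < ε) :
    ∀ᶠ h in 𝓝 (0 : E), |f (x + h) - f x - f' x h - f'' h h / 2| ≤ ε * ‖h‖ ^ 2 := by
  have h1 : ∀ᶠ h in 𝓝 (0 : E), ‖f' (x + h) - f' x - f'' h‖ ≤ ε * ‖h‖ := by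
    have := (hasFDerivAt_iff_isLittleO_nhds_zero.1 hx).def hε
    simpa using this
  have h2 : ∀ᶠ h in 𝓝 (0 : E), HasFDerivAt f (f' (x + h)) (x + h) := by
    have : Tendsto (fun h : E => x + h) (𝓝 0) (𝓝 x) := by
      have : Continuous fun h : E => x + h := by fun_prop
      simpa using this.tendsto 0
    exact this.eventually hf
  obtain ⟨r, hr, hball⟩ := Metric.eventually_nhds_iff_ball.1 (h1.and h2)
  filter_upwards [Metric.ball_mem_nhds (0 : E) hr] with h hh
  have hmem : ∀ t ∈ Set.Icc (0 : ℝ) 1, t • h ∈ Metric.ball (0 : E) r := by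
    intro t ht
    rw [mem_ball_zero_iff, norm_smul, Real.norm_of_nonneg ht.1]
    rw [mem_ball_zero_iff] at hh
    nlinarith [ht.2, norm_nonneg h]
  -- Mean value inequality for the Taylor remainder along the segment from x to x + h; its
  -- derivative is the first order error of f', tested on h.
  have key := norm_image_sub_le_of_norm_deriv_le_segment_01'
    (f := fun t : ℝ => f (x + t • h) - t * f' x h - t ^ 2 / 2 * f'' h h)
    (f' := fun t => (f' (x + t • h) - f' x - f'' (t • h)) h) (C := ε * ‖h‖ ^ 2) ?_ ?_
  · simp only [Real.norm_eq_abs, one_smul, zero_smul, add_zero] at key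
    convert key using 2
    ring
  · intro t ht
    have hd := (hball _ (hmem t ht)).2
    have hl : HasDerivAt (fun t : ℝ => x + t • h) h t := by
      simpa using ((hasDerivAt_id t).smul_const h).const_add x
    have h3 := hd.comp_hasDerivAt t hl
    have h4 := (h3.sub ((hasDerivAt_id t).mul_const (f' x h))).sub
      (((hasDerivAt_pow 2 t).div_const 2).mul_const (f'' h h))
    refine (h4.congr_deriv ?_).hasDerivWithinAt
    simp
  · intro t ht
    have htm : t ∈ Set.Icc (0 : ℝ) 1 := ⟨ht.1, ht.2.le⟩
    have hb := (hball _ (hmem t htm)).1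
    refine ((f' (x + t • h) - f' x - f'' (t • h)).le_opNorm h).trans ?_
    rw [norm_smul, Real.norm_of_nonneg ht.1] at hb
    calc _ ≤ ε * (t * ‖h‖) * ‖h‖ := by gcongr
      _ = t * (ε * ‖h‖ ^ 2) := by ring
      _ ≤ 1 * (ε * ‖h‖ ^ 2) := by gcongr; exact ht.2.le
      _ = _ := one_mul _

section StronglyConvex

variable {E : Type*} [NormedAddCommGroup E] [InnerProductSpace ℝ E]

/-- `H` lies above a paraboloid of opening `1` touching its graph at each point. -/
def StronglyConvex (H : E → ℝ) : Prop :=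
  ∀ x, ∃ s : E, ∀ z, H x + ⟪s, z - x⟫ + ‖z - x‖ ^ 2 / 2 ≤ H z

/-- `s` is a subgradient of `H` at `x`. -/
def IsSubgradient (H : E → ℝ) (x s : E) : Prop :=
  ∀ x', H x + ⟪s, x' - x⟫ ≤ H x'

theorem StronglyConvex.exists_isSubgradient {H : E → ℝ} (hH : StronglyConvex H) (x : E) :
    ∃ s, IsSubgradient H x s := by
  obtain ⟨s, hs⟩ := hH x
  exact ⟨s, fun x' => by nlinarith [hs x', sq_nonneg ‖x' - x‖]⟩

/-- The paraboloid inequalities from the intermediate point to both ends are averaged with weights 1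
− t and t, which cancels the linear terms. -/
theorem StronglyConvex.le_segment {H : E → ℝ} (hH : StronglyConvex H) (x y : E) {t : ℝ}
    (ht : 0 ≤ t) (ht1 : t ≤ 1) :
    H (x + t • (y - x)) ≤ (1 - t) * H x + t * H y - t * (1 - t) / 2 * ‖y - x‖ ^ 2 := by
  obtain ⟨s, hs⟩ := hH (x + t • (y - x))
  have h1 := hs x
  have h2 := hs y
  have e1 : x - (x + t • (y - x)) = (-t) • (y - x) := by module
  have e2 : y - (x + t • (y - x)) = (1 - t) • (y - x) := by module
  rw [e1, inner_smul_right, norm_smul, mul_pow, Real.norm_eq_abs, sq_abs] at h1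
  rw [e2, inner_smul_right, norm_smul, mul_pow, Real.norm_eq_abs, sq_abs] at h2
  nlinarith [mul_le_mul_of_nonneg_left h1 (sub_nonneg.2 ht1), mul_le_mul_of_nonneg_left h2 ht]

theorem StronglyConvex.convexOn {H : E → ℝ} (hH : StronglyConvex H) :
    ConvexOn ℝ Set.univ H := by
  refine ⟨convex_univ, fun x _ y _ a b ha hb hab => ?_⟩
  have h := hH.le_segment x y hb (by linarith)
  have e : x + b • (y - x) = a • x + b • y := by
    rw [← eq_sub_iff_add_eq] at hab; subst hab; module
  have ea : 1 - b = a := by linarith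
  rw [e, ea] at h
  simp only [smul_eq_mul]
  have : 0 ≤ b * a / 2 * ‖y - x‖ ^ 2 := by positivity
  linarith

/-- The quadratic gain holds for every subgradient, not only for the one supplied by
`StronglyConvex`: compare with `le_segment` at distance t, divide by t and let t tend to 0. -/
theorem StronglyConvex.isSubgradient_strong {H : E → ℝ} (hH : StronglyConvex H) {x s : E}
    (hs : IsSubgradient H x s) (x' : E) :
    H x + ⟪s, x' - x⟫ + ‖x' - x‖ ^ 2 / 2 ≤ H x' := by
  have key : ∀ t ∈ Set.Ioo (0 : ℝ) 1,
      H x + ⟪s, x' - x⟫ + (1 - t) * (‖x' - x‖ ^ 2 / 2) ≤ H x' := by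
    intro t ht
    have h1 := hs (x + t • (x' - x))
    have h2 := hH.le_segment x x' ht.1.le ht.2.le
    rw [add_sub_cancel_left, inner_smul_right] at h1
    have : t * (H x + ⟪s, x' - x⟫ + (1 - t) * (‖x' - x‖ ^ 2 / 2)) ≤ t * H x' := by linarith
    exact le_of_mul_le_mul_left this ht.1
  have hlim : Tendsto (fun t : ℝ => H x + ⟪s, x' - x⟫ + (1 - t) * (‖x' - x‖ ^ 2 / 2)) (𝓝[>] 0)
      (𝓝 (H x + ⟪s, x' - x⟫ + (1 - 0) * (‖x' - x‖ ^ 2 / 2))) := by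
    apply Tendsto.mono_left _ nhdsWithin_le_nhds
    apply Continuous.tendsto
    fun_prop
  rw [sub_zero, one_mul] at hlim
  refine le_of_tendsto hlim ?_
  filter_upwards [Ioo_mem_nhdsGT (zero_lt_one (α := ℝ))] with t ht using key t ht

/-- Strong monotonicity of the subdifferential (add the two strong inequalities) and Cauchy–Schwarz.
It makes the inverse of the subdifferential single valued and 1-Lipschitz. -/
theorem StronglyConvex.norm_sub_le {H : E → ℝ} (hH : StronglyConvex H) {x s x' s' : E}
    (hs : IsSubgradient H x s) (hs' : IsSubgradient H x' s') : ‖x - x'‖ ≤ ‖s - s'‖ := by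
  have h1 := hH.isSubgradient_strong hs x'
  have h2 := hH.isSubgradient_strong hs' x
  have e : ⟪s, x' - x⟫ = - ⟪s, x - x'⟫ := by rw [← inner_neg_right, neg_sub]
  rw [e, norm_sub_rev] at h1
  have h3 : ‖x - x'‖ ^ 2 ≤ ⟪s - s', x - x'⟫ := by rw [inner_sub_left]; linarith
  have h4 := h3.trans (real_inner_le_norm _ _)
  by_contra! hlt
  nlinarith [norm_nonneg (s - s')]

variable [FiniteDimensional ℝ E]

theorem StronglyConvex.continuous {H : E → ℝ} (hH : StronglyConvex H) : Continuous H :=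
  hH.convexOn.locallyLipschitz.continuous

/-- Quadratic growth makes H − ⟪y, ·⟫ coercive, and y is a subgradient at any minimum point. -/
theorem StronglyConvex.exists_isSubgradient_inv {H : E → ℝ} (hH : StronglyConvex H) (y : E) :
    ∃ x, IsSubgradient H x y := by
  obtain ⟨s, hs⟩ := hH 0
  have hc : Continuous fun x => H x - ⟪y, x⟫ := by
    have := hH.continuous
    fun_prop
  obtain ⟨x, hx⟩ := hc.exists_forall_le' 0 (by
    rw [← Metric.cobounded_eq_cocompact]
    have : ∀ᶠ x : E in Bornology.cobounded E, 2 * ‖s - y‖ ≤ ‖x‖ :=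
      tendsto_norm_cobounded_atTop.eventually_ge_atTop _
    filter_upwards [this] with x hx
    have h1 := hs x
    simp only [sub_zero, inner_zero_right] at h1 ⊢
    have h2 : ⟪s, x⟫ - ⟪y, x⟫ ≥ - (‖s - y‖ * ‖x‖) := by
      rw [← inner_sub_left]
      exact neg_le_of_abs_le (abs_real_inner_le_norm _ _)
    nlinarith [norm_nonneg x])
  refine ⟨x, fun x' => ?_⟩
  have := hx x'
  rw [inner_sub_right]
  linarith

/-- The resolvent of the subdifferential: `prox hH y` is the point where `y` is a subgradient. -/
def prox {H : E → ℝ} (hH : StronglyConvex H) (y : E) : E := (hH.exists_isSubgradient_inv y).choose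

theorem isSubgradient_prox {H : E → ℝ} (hH : StronglyConvex H) (y : E) :
    IsSubgradient H (prox hH y) y := (hH.exists_isSubgradient_inv y).choose_spec

theorem lipschitzWith_prox {H : E → ℝ} (hH : StronglyConvex H) : LipschitzWith 1 (prox hH) := by
  refine LipschitzWith.of_dist_le_mul fun y y' => ?_
  simpa [dist_eq_norm] using hH.norm_sub_le (isSubgradient_prox hH y) (isSubgradient_prox hH y')

theorem IsSubgradient.prox_eq {H : E → ℝ} {x s : E} (hs : IsSubgradient H x s)
    (hH : StronglyConvex H) : prox hH s = x := by
  have := hH.norm_sub_le (isSubgradient_prox hH s) hs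
  rw [sub_self, norm_zero] at this
  exact sub_eq_zero.1 (norm_le_zero_iff.1 this)

/-- The convex conjugate. -/
def conj {H : E → ℝ} (hH : StronglyConvex H) (y : E) : ℝ := ⟪y, prox hH y⟫ - H (prox hH y)

theorem fenchel {H : E → ℝ} (hH : StronglyConvex H) (x y : E) : ⟪y, x⟫ - H x ≤ conj hH y := by
  have := isSubgradient_prox hH y x
  rw [inner_sub_right] at this
  rw [conj]
  linarith

/-- Thus `prox` selects subgradients of the conjugate. -/
theorem conj_add_ge {H : E → ℝ} (hH : StronglyConvex H) (y k : E) :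
    conj hH y + ⟪prox hH y, k⟫ ≤ conj hH (y + k) := by
  have := fenchel hH (prox hH y) (y + k)
  rw [inner_add_left, real_inner_comm (prox hH y) k] at this
  rw [conj]
  linarith

theorem conj_add_le {H : E → ℝ} (hH : StronglyConvex H) (y k : E) :
    conj hH (y + k) ≤ conj hH y + ⟪prox hH (y + k), k⟫ := by
  have := conj_add_ge hH (y + k) (-k)
  rw [add_neg_cancel_right, inner_neg_right] at this
  linarith

/-- The increment of the conjugate lies between ⟪prox y, k⟫ and ⟪prox (y + k), k⟫, and these differ
by at most ‖k‖² since `prox` is 1-Lipschitz. -/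
theorem hasFDerivAt_conj {H : E → ℝ} (hH : StronglyConvex H) (y : E) :
    HasFDerivAt (conj hH) (innerSL ℝ (prox hH y)) y := by
  rw [hasFDerivAt_iff_isLittleO_nhds_zero]
  refine Asymptotics.IsBigO.trans_isLittleO (g := fun h : E => ‖h‖ ^ 2) ?_ ?_
  · refine Asymptotics.IsBigO.of_bound 1 (Eventually.of_forall fun k => ?_)
    have h1 := conj_add_ge hH y k
    have h2 := conj_add_le hH y k
    have h3 : ⟪prox hH (y + k) - prox hH y, k⟫ ≤ ‖k‖ ^ 2 := by
      refine (real_inner_le_norm _ _).trans ?_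
      have := (lipschitzWith_prox hH).dist_le_mul (y + k) y
      rw [dist_eq_norm, dist_eq_norm, add_sub_cancel_left] at this
      simp only [NNReal.coe_one, one_mul] at this
      nlinarith [norm_nonneg k]
    rw [inner_sub_left] at h3
    simp only [innerSL_apply_apply, norm_pow, norm_norm, one_mul]
    rw [Real.norm_eq_abs, abs_le]
    constructor <;> nlinarith [sq_nonneg ‖k‖]
  · have := (Asymptotics.isLittleO_norm_pow_id (E' := E) (n := 2) (by norm_num))
    exact this

/-- A strongly convex function has a second order expansion at a point where it is touched from
above by a paraboloid and its resolvent is differentiable. -/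
theorem StronglyConvex.exists_second_order {H : E → ℝ} (hH : StronglyConvex H) {x y : E} {C : ℝ}
    (hC : 0 < C) (hy : IsSubgradient H x y)
    (htouch : ∀ h, H (x + h) ≤ H x + ⟪y, h⟫ + C / 2 * ‖h‖ ^ 2)
    (hd : DifferentiableAt ℝ (prox hH) y) :
    ∃ S : E →ₗ[ℝ] E, S.IsSymmetric ∧ ∀ ε > 0, ∀ᶠ h in 𝓝 (0 : E),
      |H (x + h) - H x - ⟪y, h⟫ - ⟪S h, h⟫ / 2| ≤ ε * ‖h‖ ^ 2 := by
  have hpx : prox hH y = x := hy.prox_eq hH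
  set T : E →L[ℝ] E := fderiv ℝ (prox hH) y with hT
  have hD : HasFDerivAt (fun z => innerSL ℝ (prox hH z)) ((innerSL ℝ).comp T) y :=
    (innerSL ℝ : E →L[ℝ] E →L[ℝ] ℝ).hasFDerivAt.comp y hd.hasFDerivAt
  -- T is the second derivative of the conjugate, hence symmetric.
  have hsymm : ∀ h k, ⟪T h, k⟫ = ⟪T k, h⟫ := by
    intro h k
    have := second_derivative_symmetric_of_eventually (𝕜 := ℝ)
      (Eventually.of_forall (hasFDerivAt_conj hH)) hD h k
    simpa using this
  have htay : ∀ ε > 0, ∀ᶠ k in 𝓝 (0 : E),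
      |conj hH (y + k) - conj hH y - ⟪x, k⟫ - ⟪T k, k⟫ / 2| ≤ ε * ‖k‖ ^ 2 := by
    intro ε hε
    have := taylor_two (Eventually.of_forall (hasFDerivAt_conj hH)) hD hε
    simpa [hpx] using this
  have hHx : H x = ⟪y, x⟫ - conj hH y := by rw [conj, hpx]; ring
  -- Duality turns an upper paraboloid of opening C for H into a lower one of opening 1/C for the
  -- conjugate; C⁻¹ k is the optimal point in Fenchel's inequality.
  have hlow : ∀ k, conj hH y + ⟪x, k⟫ + ‖k‖ ^ 2 / (2 * C) ≤ conj hH (y + k) := by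
    intro k
    have h1 := fenchel hH (x + C⁻¹ • k) (y + k)
    have h2 := htouch (C⁻¹ • k)
    rw [norm_smul, mul_pow, Real.norm_eq_abs, sq_abs, inner_smul_right] at h2
    simp only [inner_add_left, inner_add_right, inner_smul_right, real_inner_self_eq_norm_sq,
      real_inner_comm x k] at h1
    have h3 : C / 2 * (C⁻¹ ^ 2 * ‖k‖ ^ 2) = C⁻¹ * ‖k‖ ^ 2 - ‖k‖ ^ 2 / (2 * C) := by
      field_simp; ring
    linarith
  -- Consequently T ≥ 1/C. It is therefore invertible, and its inverse S is the Hessian of H at x.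
  have hTpos : ∀ k, ‖k‖ ^ 2 / C ≤ ⟪T k, k⟫ := by
    intro k
    refine le_of_forall_pos_le_add fun δ hδ => ?_
    have hk : 0 < 1 + ‖k‖ ^ 2 := by positivity
    have hev := htay (δ / (2 * (1 + ‖k‖ ^ 2))) (by positivity)
    have hcont : Tendsto (fun t : ℝ => t • k) (𝓝[>] 0) (𝓝 0) := by
      have : Continuous fun t : ℝ => t • k := by fun_prop
      simpa using (this.tendsto 0).mono_left nhdsWithin_le_nhds
    obtain ⟨t, ht, ht0⟩ := ((hcont.eventually hev).and self_mem_nhdsWithin).exists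
    have ht0 : 0 < t := ht0
    have h1 := hlow (t • k)
    have h2 := (abs_le.1 ht).2
    rw [norm_smul, mul_pow, Real.norm_eq_abs, sq_abs] at h1 h2
    simp only [map_smul, inner_smul_left, inner_smul_right] at h1 h2
    simp only [conj_trivial] at h2
    have h3 : t ^ 2 * (‖k‖ ^ 2 / C) ≤ t ^ 2 * (⟪T k, k⟫ + δ) := by
      have h4 : δ / (2 * (1 + ‖k‖ ^ 2)) * (t ^ 2 * ‖k‖ ^ 2) ≤ t ^ 2 * (δ / 2) := by
        rw [div_mul_eq_mul_div, div_le_iff₀ (by positivity)]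
        nlinarith [mul_pos (pow_pos ht0 2) hδ]
      have h5 : t ^ 2 * ‖k‖ ^ 2 / (2 * C) = t ^ 2 * (‖k‖ ^ 2 / C) / 2 := by
        field_simp
      rw [h5] at h1
      nlinarith
    exact le_of_mul_le_mul_left h3 (by positivity)
  have hinj : Function.Injective (T : E →ₗ[ℝ] E) := by
    rw [← LinearMap.ker_eq_bot, LinearMap.ker_eq_bot']
    intro k hk
    have := hTpos k
    have hk' : T k = 0 := hk
    rw [hk', inner_zero_left, div_le_iff₀ hC, zero_mul] at this
    exact norm_eq_zero.1 (pow_eq_zero_iff (two_ne_zero)|>.1 (le_antisymm this (by positivity)))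
  let e := LinearEquiv.ofInjectiveEndo (T : E →ₗ[ℝ] E) hinj
  let S : E →ₗ[ℝ] E := e.symm
  have hTS : ∀ h, T (S h) = h := fun h => e.apply_symm_apply h
  have hSsymm : ∀ h k, ⟪S h, k⟫ = ⟪h, S k⟫ := by
    intro h k
    have := hsymm (S h) (S k)
    rw [hTS, hTS] at this
    rw [this, real_inner_comm]
  refine ⟨S, hSsymm, fun ε hε => ?_⟩
  have hlower : ∀ᶠ h in 𝓝 (0 : E),
      H x + ⟪y, h⟫ + ⟪S h, h⟫ / 2 - ε * ‖h‖ ^ 2 ≤ H (x + h) := by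
    let Sc := LinearMap.toContinuousLinearMap S
    have hcont : Tendsto (fun h => S h) (𝓝 0) (𝓝 0) := by
      have h0 := Sc.continuous.tendsto 0
      rw [map_zero] at h0
      exact h0
    have hK : 0 < ‖Sc‖ ^ 2 + 1 := by positivity
    filter_upwards [hcont.eventually (htay (ε / (‖Sc‖ ^ 2 + 1)) (by positivity))] with h hh
    have h1 := (abs_le.1 hh).2
    rw [hTS] at h1
    -- The slope y + S h is the one predicted by the expansion to be optimal at x + h.
    have h2 := fenchel hH (x + h) (y + S h)
    simp only [inner_add_left, inner_add_right] at h2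
    have h3 : ‖S h‖ ^ 2 ≤ ‖Sc‖ ^ 2 * ‖h‖ ^ 2 := by
      rw [← mul_pow]
      exact pow_le_pow_left₀ (norm_nonneg _) (Sc.le_opNorm h) 2
    have h4 : ε / (‖Sc‖ ^ 2 + 1) * ‖S h‖ ^ 2 ≤ ε * ‖h‖ ^ 2 := by
      rw [div_mul_eq_mul_div, div_le_iff₀ hK]
      nlinarith [sq_nonneg ‖h‖, mul_le_mul_of_nonneg_left h3 hε.le, mul_nonneg hε.le (sq_nonneg ‖h‖)]
    linarith [real_inner_comm x (S h), real_inner_comm (S h) h]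
  have hupper : ∀ᶠ h in 𝓝 (0 : E),
      H (x + h) ≤ H x + ⟪y, h⟫ + ⟪S h, h⟫ / 2 + ε * ‖h‖ ^ 2 := by
    obtain ⟨r, hr, hball⟩ := Metric.eventually_nhds_iff_ball.1
      (htay (ε / (2 * C) ^ 2) (by positivity))
    filter_upwards [Metric.ball_mem_nhds (0 : E) (show 0 < r / (2 * C) by positivity)] with h hh
    rw [mem_ball_zero_iff, lt_div_iff₀ (by positivity)] at hh
    -- At an actual subgradient y + k of H at x + h, Fenchel's inequality is an equality, so a lower
    -- expansion of the conjugate bounds H from above.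
    obtain ⟨y', hy'⟩ := hH.exists_isSubgradient (x + h)
    obtain ⟨k, rfl⟩ : ∃ k, y' = y + k := ⟨y' - y, by abel⟩
    have hp := hy'.prox_eq hH
    have hHxh : H (x + h) = ⟪y + k, x + h⟫ - conj hH (y + k) := by rw [conj, hp]; ring
    have h1 := conj_add_le hH y k
    have h2 := hlow k
    rw [hp, inner_add_left] at h1
    -- The quadratic lower bound on the conjugate controls k by h, so errors o(‖k‖²) are o(‖h‖²).
    have hk : ‖k‖ ≤ 2 * C * ‖h‖ := by
      have h3 : ‖k‖ ^ 2 / (2 * C) ≤ ‖h‖ * ‖k‖ := by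
        linarith [real_inner_le_norm h k]
      rw [div_le_iff₀ (by positivity)] at h3
      rcases (norm_nonneg k).eq_or_lt with h0 | h0
      · rw [← h0]; positivity
      · nlinarith
    have h3 := (abs_le.1 (hball k (by rw [mem_ball_zero_iff]; nlinarith))).1
    -- Completing the square: ⟪h, k⟫ − ⟪T k, k⟫/2 ≤ ⟪S h, h⟫/2.
    have h4 : 0 ≤ ⟪T (k - S h), k - S h⟫ :=
      le_trans (by positivity) (hTpos (k - S h))
    simp only [map_sub, hTS, inner_sub_left, inner_sub_right] at h4
    have h5 : ⟪T k, S h⟫ = ⟪h, k⟫ := by rw [hsymm, hTS]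
    rw [h5, real_inner_comm (S h) h] at h4
    have h6 : ε / (2 * C) ^ 2 * ‖k‖ ^ 2 ≤ ε * ‖h‖ ^ 2 := by
      rw [div_mul_eq_mul_div, div_le_iff₀ (by positivity)]
      have : ‖k‖ ^ 2 ≤ (2 * C * ‖h‖) ^ 2 := pow_le_pow_left₀ (norm_nonneg _) hk 2
      nlinarith [mul_le_mul_of_nonneg_left this hε.le]
    rw [hHxh, hHx]
    simp only [inner_add_left, inner_add_right]
    linarith [real_inner_comm x k, real_inner_comm h k]
  filter_upwards [hlower, hupper] with h h1 h2
  rw [abs_le]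
  constructor <;> linarith

end StronglyConvex

/-! ### Contact points where both resolvents are differentiable. -/

/-- Lipschitz maps do not increase top-dimensional Hausdorff measure beyond a constant factor, and
that measure is a Haar measure; so the image of a null set is null and cannot contain a ball. -/
theorem exists_mem_ball_notMem_image {G : Type*} [NormedAddCommGroup G] [NormedSpace ℝ G]
    [FiniteDimensional ℝ G] [MeasurableSpace G] [BorelSpace G] (μ : Measure G) [μ.IsAddHaarMeasure]
    {Ψ : G → G} {K : NNReal} (hΨ : LipschitzWith K Ψ) {A : Set G} (hA : μ A = 0) {δ : ℝ}
    (hδ : 0 < δ) : ∃ q ∈ Metric.ball (0 : G) δ, q ∉ Ψ '' A := by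
  by_contra! hcon
  let ν : Measure G := Measure.hausdorffMeasure (Module.finrank ℝ G)
  have hac : ν ≪ μ := Measure.absolutelyContinuous_isAddHaarMeasure ν μ
  have h0 : ν (Ψ '' A) = 0 := by
    have := hΨ.hausdorffMeasure_image_le (d := Module.finrank ℝ G) (by positivity) A
    rw [show Measure.hausdorffMeasure (Module.finrank ℝ G : ℝ) A = 0 from hac hA, mul_zero] at this
    exact le_antisymm this (zero_le)
  have h1 : ν (Metric.ball 0 δ) = 0 := measure_mono_null hcon h0
  exact (Metric.measure_ball_pos ν (0 : G) hδ).ne' h1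

section Contact

variable {E : Type*} [NormedAddCommGroup E] [InnerProductSpace ℝ E]

theorem eq_of_forall_inner_le {s y : E} {C : ℝ} (hC : 0 < C)
    (h : ∀ k, ⟪s, k⟫ ≤ ⟪y, k⟫ + C / 2 * ‖k‖ ^ 2) : s = y := by
  have h1 := h (C⁻¹ • (s - y))
  rw [norm_smul, mul_pow, Real.norm_eq_abs, sq_abs, inner_smul_right, inner_smul_right] at h1
  have h2 : ‖s - y‖ ^ 2 = ⟪s, s - y⟫ - ⟪y, s - y⟫ := by
    rw [← inner_sub_left, real_inner_self_eq_norm_sq]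
  have h3 : C / 2 * (C⁻¹ ^ 2 * ‖s - y‖ ^ 2) = C⁻¹ * ‖s - y‖ ^ 2 / 2 := by field_simp
  have h6 : C⁻¹ * ‖s - y‖ ^ 2 = C⁻¹ * ⟪s, s - y⟫ - C⁻¹ * ⟪y, s - y⟫ := by rw [h2]; ring
  have h4 : C⁻¹ * ‖s - y‖ ^ 2 ≤ C⁻¹ * 0 := by rw [h3] at h1; linarith
  have h5 := le_of_mul_le_mul_left h4 (inv_pos.2 hC)
  exact sub_eq_zero.1 (norm_eq_zero.1 (pow_eq_zero_iff two_ne_zero |>.1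
    (le_antisymm h5 (by positivity))))

/-- A paraboloid touching a convex function from above forces differentiability, so its slope is the
only possible subgradient. -/
theorem StronglyConvex.isSubgradient_of_touch {H : E → ℝ} (hH : StronglyConvex H) {x y : E} {C : ℝ}
    (hC : 0 < C) (ht : ∀ h, H (x + h) ≤ H x + ⟪y, h⟫ + C / 2 * ‖h‖ ^ 2) : IsSubgradient H x y := by
  obtain ⟨s, hs⟩ := hH.exists_isSubgradient x
  have : s = y := eq_of_forall_inner_le hC fun k => by
    have h1 := hs (x + k)
    rw [add_sub_cancel_left] at h1
    linarith [ht k]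
  exact this ▸ hs

theorem abs_le_of_quadratic_le {a b δ η : ℝ} (hη : 0 < η) (ha : 0 ≤ a) (hb : 0 ≤ b)
    (h : η / 2 * (a ^ 2 + b ^ 2) ≤ δ * (a + b)) (hδ : 0 ≤ δ) : a ≤ 4 * δ / η := by
  rw [le_div_iff₀ hη]
  by_contra! hlt
  have h1 : δ * (a + b) ≤ η / 4 * a * (a + b) := by
    have : δ ≤ η / 4 * a := by linarith
    exact mul_le_mul_of_nonneg_right this (by positivity)
  rcases ha.eq_or_lt with h0 | h0
  · rw [← h0] at hlt; linarith
  · nlinarith [sq_nonneg (a - b), mul_pos hη h0, mul_pos (mul_pos hη h0) h0, sq_nonneg (a - 2 * b),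
      mul_nonneg hη.le (sq_nonneg (a - b)), mul_nonneg hη.le (sq_nonneg (a - 2 * b)),
      mul_nonneg hη.le (sq_nonneg b)]

variable [FiniteDimensional ℝ E]

/-- The extra η makes the origin a strict maximum with quadratic gap, so a linear tilt of size δ
moves the maximum by at most 4δ/η. The conclusion is maximality of the tilted function, expanded
about its maximum point. -/
theorem exists_perturbed_max {H₁ H₂ : E → ℝ} (h₁ : StronglyConvex H₁) (h₂ : StronglyConvex H₂)
    {c τ η δ : ℝ} (hη : 0 < η)
    (hW : ∀ x y, H₁ x + H₂ y ≤
      H₁ 0 + H₂ 0 + c / 2 * (‖x‖ ^ 2 + ‖y‖ ^ 2) + τ / 2 * ‖x - y‖ ^ 2) {q₁ q₂ : E} (hq₁ : ‖q₁‖ ≤ δ)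
    (hq₂ : ‖q₂‖ ≤ δ) :
    ∃ x y : E, ‖x‖ ≤ 4 * δ / η ∧ ‖y‖ ≤ 4 * δ / η ∧ ∀ h k,
      H₁ (x + h) + H₂ (y + k) ≤ H₁ x + H₂ y + ⟪(c + η) • x + τ • (x - y) + q₁, h⟫
        + ⟪(c + η) • y + τ • (y - x) + q₂, k⟫ + (c + η) / 2 * (‖h‖ ^ 2 + ‖k‖ ^ 2)
        + τ / 2 * ‖h - k‖ ^ 2 := by
  have hδ : 0 ≤ δ := (norm_nonneg _).trans hq₁
  let W : E × E → ℝ := fun z => -(H₁ z.1 + H₂ z.2 - (c + η) / 2 * (‖z.1‖ ^ 2 + ‖z.2‖ ^ 2)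
    - τ / 2 * ‖z.1 - z.2‖ ^ 2 - ⟪q₁, z.1⟫ - ⟪q₂, z.2⟫)
  have hWc : Continuous W := by
    have := h₁.continuous
    have := h₂.continuous
    fun_prop
  have hW0 : W 0 = -(H₁ 0 + H₂ 0) := by simp [W]
  have hlow : ∀ z : E × E, W 0 + η / 2 * (‖z.1‖ ^ 2 + ‖z.2‖ ^ 2) - δ * (‖z.1‖ + ‖z.2‖) ≤ W z := by
    intro z
    have e1 := real_inner_le_norm (-q₁) z.1
    have e2 := real_inner_le_norm (-q₂) z.2
    rw [inner_neg_left, norm_neg] at e1 e2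
    have e3 := mul_le_mul_of_nonneg_right hq₁ (norm_nonneg z.1)
    have e4 := mul_le_mul_of_nonneg_right hq₂ (norm_nonneg z.2)
    have e5 := hW z.1 z.2
    rw [hW0]
    simp only [W]
    linarith
  obtain ⟨z, hz⟩ := hWc.exists_forall_le' 0 (by
    rw [← Metric.cobounded_eq_cocompact]
    have : ∀ᶠ z : E × E in Bornology.cobounded (E × E), 4 * δ / η + 1 ≤ ‖z‖ :=
      tendsto_norm_cobounded_atTop.eventually_ge_atTop _
    filter_upwards [this] with z hz
    by_contra! hlt
    have h3 := hlow z
    have h4 : η / 2 * (‖z.1‖ ^ 2 + ‖z.2‖ ^ 2) ≤ δ * (‖z.1‖ + ‖z.2‖) := by linarith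
    have h5 := abs_le_of_quadratic_le hη (norm_nonneg z.1) (norm_nonneg z.2) h4 hδ
    have h6 := abs_le_of_quadratic_le hη (norm_nonneg z.2) (norm_nonneg z.1) (by linarith) hδ
    have h7 : ‖z‖ ≤ 4 * δ / η := max_le h5 h6
    linarith)
  have h3 := hlow z
  have h3' := hz 0
  have h4 : η / 2 * (‖z.1‖ ^ 2 + ‖z.2‖ ^ 2) ≤ δ * (‖z.1‖ + ‖z.2‖) := by linarith
  refine ⟨z.1, z.2, abs_le_of_quadratic_le hη (norm_nonneg z.1) (norm_nonneg z.2) h4 hδ,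
    abs_le_of_quadratic_le hη (norm_nonneg z.2) (norm_nonneg z.1) (by linarith) hδ, fun h k => ?_⟩
  have h5 := hz (z.1 + h, z.2 + k)
  simp only [W] at h5
  have e : z.1 + h - (z.2 + k) = (z.1 - z.2) + (h - k) := by abel
  rw [e, norm_add_sq_real, norm_add_sq_real, norm_add_sq_real] at h5
  simp only [inner_add_left, inner_add_right, inner_smul_left, inner_sub_left, inner_sub_right,
    conj_trivial] at h5 ⊢
  linarith

variable [MeasurableSpace E] [BorelSpace E]

/-- A substitute for Jensen's lemma. The tilt is recovered from the contact slopes by a Lipschitz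
map, so the tilts whose contact slopes are points of non-differentiability of a resolvent form a
null set. -/
theorem exists_contact {H₁ H₂ : E → ℝ} (h₁ : StronglyConvex H₁) (h₂ : StronglyConvex H₂)
    {c τ η δ : ℝ} (hc : 0 < c) (hτ : 0 < τ) (hη : 0 < η) (hδ : 0 < δ)
    (hW : ∀ x y, H₁ x + H₂ y ≤
      H₁ 0 + H₂ 0 + c / 2 * (‖x‖ ^ 2 + ‖y‖ ^ 2) + τ / 2 * ‖x - y‖ ^ 2) :
    ∃ x₁ x₂ y₁ y₂ : E, ‖x₁‖ ≤ δ ∧ ‖x₂‖ ≤ δ ∧ ‖y₁‖ ≤ δ ∧ ‖y₂‖ ≤ δ ∧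
      DifferentiableAt ℝ (prox h₁) y₁ ∧ DifferentiableAt ℝ (prox h₂) y₂ ∧ ∀ h k,
      H₁ (x₁ + h) + H₂ (x₂ + k) ≤ H₁ x₁ + H₂ x₂ + ⟪y₁, h⟫ + ⟪y₂, k⟫
        + (c + η) / 2 * (‖h‖ ^ 2 + ‖k‖ ^ 2) + τ / 2 * ‖h - k‖ ^ 2 := by
  let μ : Measure E := Measure.addHaar
  let A : E × E →L[ℝ] E × E :=
    (((c + η) • ContinuousLinearMap.fst ℝ E E + τ •
      (ContinuousLinearMap.fst ℝ E E - ContinuousLinearMap.snd ℝ E E)).prod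
    ((c + η) • ContinuousLinearMap.snd ℝ E E + τ •
      (ContinuousLinearMap.snd ℝ E E - ContinuousLinearMap.fst ℝ E E)))
  have hA : ∀ x y, A (x, y) = ((c + η) • x + τ • (x - y), (c + η) • y + τ • (y - x)) :=
    fun x y => rfl
  -- At a maximum point for the tilt q the slopes are A(x, y) + q, while x and y are the resolvents
  -- of the slopes; hence Ψ of the slopes equals q.
  let Ψ : E × E → E × E := fun z => z - A (prox h₁ z.1, prox h₂ z.2)
  have hΨ : ∃ K, LipschitzWith K Ψ :=
    ⟨_, LipschitzWith.id.sub (A.lipschitz.comp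
      (((lipschitzWith_prox h₁).comp LipschitzWith.prod_fst).prodMk
        ((lipschitzWith_prox h₂).comp LipschitzWith.prod_snd)))⟩
  obtain ⟨K, hΨ⟩ := hΨ
  have hnull : ∀ᵐ z ∂(μ.prod μ), DifferentiableAt ℝ (prox h₁) z.1 ∧
      DifferentiableAt ℝ (prox h₂) z.2 := by
    have a1 : ∀ᵐ y ∂μ, DifferentiableAt ℝ (prox h₁) y := (lipschitzWith_prox h₁).ae_differentiableAt
    have a2 : ∀ᵐ y ∂μ, DifferentiableAt ℝ (prox h₂) y := (lipschitzWith_prox h₂).ae_differentiableAt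
    exact (Measure.quasiMeasurePreserving_fst.ae a1).and (Measure.quasiMeasurePreserving_snd.ae a2)
  set B : ℝ := 4 / η with hB
  have hBpos : 0 < B := by positivity
  -- A tilt of size δ/D gives contact points of norm at most Bδ/D; D adds up every coefficient in
  -- the bound for the slopes, so that all four norms stay below δ.
  set D : ℝ := 1 + B + (c + η) * B + τ * (2 * B) with hD
  have hDpos : 0 < D := by positivity
  obtain ⟨q, hq, hqn⟩ := exists_mem_ball_notMem_image (μ.prod μ) hΨ (ae_iff.1 hnull)
    (δ := δ / D) (by positivity)
  rw [mem_ball_zero_iff] at hq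
  have hq₁ : ‖q.1‖ ≤ δ / D := (norm_fst_le q).trans hq.le
  have hq₂ : ‖q.2‖ ≤ δ / D := (norm_snd_le q).trans hq.le
  obtain ⟨x, y, hx, hy, hmax⟩ := exists_perturbed_max h₁ h₂ hη hW hq₁ hq₂
  rw [mul_div_right_comm, ← hB] at hx hy
  set y₁ := (c + η) • x + τ • (x - y) + q.1 with hy₁
  set y₂ := (c + η) • y + τ • (y - x) + q.2 with hy₂
  have hs₁ : IsSubgradient H₁ x y₁ := h₁.isSubgradient_of_touch (C := c + η + τ) (by positivity)
    fun h => by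
      have := hmax h 0
      simp only [add_zero, inner_zero_right, norm_zero, sub_zero] at this
      linarith
  have hs₂ : IsSubgradient H₂ y y₂ := h₂.isSubgradient_of_touch (C := c + η + τ) (by positivity)
    fun h => by
      have := hmax 0 h
      simp only [add_zero, inner_zero_right, norm_zero, zero_sub, norm_neg] at this
      linarith
  have hmem : (y₁, y₂) ∉ {z : E × E | ¬ (DifferentiableAt ℝ (prox h₁) z.1 ∧
      DifferentiableAt ℝ (prox h₂) z.2)} := by
    intro hmem
    refine hqn ⟨(y₁, y₂), hmem, ?_⟩
    simp only [Ψ, hs₁.prox_eq h₁, hs₂.prox_eq h₂, hA]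
    ext <;> simp [hy₁, hy₂]
  rw [Set.mem_ofPred_eq, not_not] at hmem
  have hδD : δ / D * D = δ := div_mul_cancel₀ _ hDpos.ne'
  have hε : 0 < δ / D := by positivity
  have hsmall : B * (δ / D) ≤ δ := by
    calc B * (δ / D) ≤ D * (δ / D) := by
          gcongr
          have : 0 < (c + η) * B := by positivity
          have : 0 < τ * (2 * B) := by positivity
          linarith
      _ = δ := by rw [mul_comm, hδD]
  have hbound : ∀ a b q : E, ‖a‖ ≤ B * (δ / D) → ‖b‖ ≤ B * (δ / D) → ‖q‖ ≤ δ / D →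
      ‖(c + η) • a + τ • (a - b) + q‖ ≤ δ := by
    intro a b q ha hb hq
    have hab : ‖a - b‖ ≤ 2 * (B * (δ / D)) := (norm_sub_le a b).trans (by linarith)
    calc ‖(c + η) • a + τ • (a - b) + q‖ ≤ ‖(c + η) • a‖ + ‖τ • (a - b)‖ + ‖q‖ := norm_add₃_le
      _ = (c + η) * ‖a‖ + τ * ‖a - b‖ + ‖q‖ := by
        rw [norm_smul, norm_smul, Real.norm_of_nonneg hτ.le, Real.norm_of_nonneg (by positivity)]
      _ ≤ (c + η) * (B * (δ / D)) + τ * (2 * (B * (δ / D))) + δ / D := by gcongr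
      _ ≤ D * (δ / D) := by
        have : 0 < B * (δ / D) := by positivity
        rw [hD]; linarith
      _ = δ := by rw [mul_comm, hδD]
  exact ⟨x, y, y₁, y₂, hx.trans hsmall, hy.trans hsmall, hbound _ _ _ hx hy hq₁,
    hbound _ _ _ hy hx hq₂, hmem.1, hmem.2, hmax⟩

end Contact

/-! ### Quadratic forms of matrices and block inequalities. -/

variable {N : ℕ}

/-- The quadratic form of a matrix. -/
def qf (X : Mat N) (h : Eu N) : ℝ := ⟪X.toEuclideanLin h, h⟫

theorem qf_eq_dotProduct (X : Mat N) (h : Eu N) :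
    qf X h = dotProduct h.ofLp (X.mulVec h.ofLp) := by
  rw [qf, EuclideanSpace.inner_eq_star_dotProduct]
  rfl

theorem qf_add (X Y : Mat N) (h : Eu N) : qf (X + Y) h = qf X h + qf Y h := by
  simp [qf, inner_add_left]

theorem qf_sub (X Y : Mat N) (h : Eu N) : qf (X - Y) h = qf X h - qf Y h := by
  simp [qf, inner_sub_left]

theorem qf_neg (X : Mat N) (h : Eu N) : qf (-X) h = -qf X h := by
  simp [qf]

theorem qf_smul (c : ℝ) (X : Mat N) (h : Eu N) : qf (c • X) h = c * qf X h := by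
  simp [qf, inner_smul_left]

theorem qf_one (h : Eu N) : qf (1 : Mat N) h = ‖h‖ ^ 2 := by
  simp [qf]

theorem qf_smul_vec (X : Mat N) (t : ℝ) (h : Eu N) : qf X (t • h) = t ^ 2 * qf X h := by
  simp [qf, inner_smul_left, inner_smul_right]; ring

theorem isHermitian_iff_isSymm {X : Mat N} : X.IsHermitian ↔ X.IsSymm := by
  rw [Matrix.IsHermitian, Matrix.conjTranspose_eq_transpose_of_trivial, Matrix.IsSymm]

theorem isSymmetric_toEuclideanLin {X : Mat N} (hX : X.IsSymm) : X.toEuclideanLin.IsSymmetric := by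
  rwa [Matrix.isSymmetric_toEuclideanLin_iff, isHermitian_iff_isSymm]

theorem qf_add_vec {X : Mat N} (hX : X.IsSymm) (h k : Eu N) :
    qf X (h + k) = qf X h + 2 * ⟪X.toEuclideanLin h, k⟫ + qf X k := by
  have := isSymmetric_toEuclideanLin hX h k
  simp only [qf, map_add, inner_add_left, inner_add_right]
  linarith [real_inner_comm (X.toEuclideanLin k) h]

theorem posSemidef_of_qf {X : Mat N} (hX : X.IsSymm) (h : ∀ v, 0 ≤ qf X v) : X.PosSemidef := by
  refine Matrix.PosSemidef.of_dotProduct_mulVec_nonneg ?_ fun x => ?_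
  · exact isHermitian_iff_isSymm.2 hX
  · have := h (WithLp.toLp 2 x)
    rw [qf_eq_dotProduct] at this
    simpa using this

theorem continuous_qf_left (v : Eu N) : Continuous fun X : Mat N => qf X v := by
  simp only [qf_eq_dotProduct]
  exact Continuous.dotProduct continuous_const
    (Continuous.matrix_mulVec continuous_id continuous_const)

theorem exists_matrix_of_isSymmetric {S : Eu N →ₗ[ℝ] Eu N} (hS : S.IsSymmetric) :
    ∃ X : Mat N, X.IsSymm ∧ ∀ h, qf X h = ⟪S h, h⟫ := by
  refine ⟨Matrix.toEuclideanLin.symm S, ?_, fun h => by simp [qf]⟩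
  have := (Matrix.isSymmetric_toEuclideanLin_iff (A := Matrix.toEuclideanLin.symm S)).1 (by simpa)
  exact isHermitian_iff_isSymm.1 this

theorem toEuclideanLin_single_inner (X : Mat N) (i j : Fin N) :
    ⟪X.toEuclideanLin (EuclideanSpace.single j 1), EuclideanSpace.single i 1⟫ = X i j := by
  rw [real_inner_comm, EuclideanSpace.inner_single_left]
  simp [Matrix.toLpLin_apply]

/-- Polarization: 2 X i j is the form at e_i + e_j minus the forms at e_i and e_j, hence at most 4C
+ C + C in absolute value. -/
theorem abs_entry_le {X : Mat N} (hX : X.IsSymm) {C : ℝ} (h : ∀ v, |qf X v| ≤ C * ‖v‖ ^ 2)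
    (i j : Fin N) : |X i j| ≤ 3 * C := by
  have e := qf_add_vec hX (EuclideanSpace.single j 1) (EuclideanSpace.single i (1 : ℝ))
  rw [toEuclideanLin_single_inner] at e
  have h1 := h (EuclideanSpace.single j 1)
  have h2 := h (EuclideanSpace.single i 1)
  have h3 := h (EuclideanSpace.single j 1 + EuclideanSpace.single i (1 : ℝ))
  have hn : ‖EuclideanSpace.single j 1 + EuclideanSpace.single i (1 : ℝ)‖ ^ 2 ≤ 4 := by
    have := norm_add_le (EuclideanSpace.single j (1 : ℝ)) (EuclideanSpace.single i (1 : ℝ))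
    simp only [PiLp.norm_single, norm_one] at this
    nlinarith [norm_nonneg (EuclideanSpace.single j 1 + EuclideanSpace.single i (1 : ℝ))]
  simp only [PiLp.norm_single, norm_one, one_pow, mul_one] at h1 h2
  have hC : 0 ≤ C := (abs_nonneg _).trans h1
  have h4 := h3.trans (mul_le_mul_of_nonneg_left hn hC)
  rw [abs_le] at *
  constructor <;> linarith

theorem blockIneq_of_qf {c : ℝ} {X Y : Mat N} (hX : X.IsSymm) (hY : Y.IsSymm)
    (h1 : ∀ h k, -(c * (‖h‖ ^ 2 + ‖k‖ ^ 2)) ≤ qf X h - qf Y k)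
    (h2 : ∀ h k, qf X h - qf Y k ≤ c * ‖h - k‖ ^ 2) : BlockIneq c X Y := by
  have hX' : X.IsHermitian := isHermitian_iff_isSymm.2 hX
  have hY' : Y.IsHermitian := isHermitian_iff_isSymm.2 hY
  have hs : ∀ a : ℝ, (a • (1 : Mat N)).IsHermitian := fun a => by
    simp [Matrix.IsHermitian]
  constructor
  · have e : Matrix.fromBlocks X 0 0 (-Y) - (-c) •
        (Matrix.fromBlocks 1 0 0 1 : Matrix (Fin N ⊕ Fin N) (Fin N ⊕ Fin N) ℝ)
        = Matrix.fromBlocks (X + c • 1) 0 0 (-Y + c • 1) := by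
      rw [Matrix.fromBlocks_smul, sub_eq_add_neg, Matrix.fromBlocks_neg, Matrix.fromBlocks_add]
      simp
    rw [e]
    refine Matrix.PosSemidef.of_dotProduct_mulVec_nonneg
      (Matrix.IsHermitian.fromBlocks (hX'.add (hs c)) (by simp) (hY'.neg.add (hs c))) fun x => ?_
    have h3 := h1 (WithLp.toLp 2 (x ∘ Sum.inl)) (WithLp.toLp 2 (x ∘ Sum.inr))
    rw [← qf_one, ← qf_one] at h3
    simp only [qf_eq_dotProduct, Matrix.one_mulVec] at h3
    rw [Matrix.fromBlocks_mulVec, star_trivial]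
    conv_rhs => rw [← Sum.elim_comp_inl_inr x, sumElim_dotProduct_sumElim]
    simp only [Matrix.zero_mulVec, add_zero, zero_add, Matrix.add_mulVec, Matrix.neg_mulVec,
      Matrix.smul_mulVec, Matrix.one_mulVec, dotProduct_add, dotProduct_neg, dotProduct_smul,
      smul_eq_mul, Sum.elim_comp_inl, Sum.elim_comp_inr]
    linarith
  · have e : c • (Matrix.fromBlocks 1 (-1) (-1) 1 : Matrix (Fin N ⊕ Fin N) (Fin N ⊕ Fin N) ℝ)
        - Matrix.fromBlocks X 0 0 (-Y)
        = Matrix.fromBlocks (c • 1 - X) (-(c • 1)) (-(c • 1)) (c • 1 + Y) := by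
      rw [Matrix.fromBlocks_smul, sub_eq_add_neg, Matrix.fromBlocks_neg, Matrix.fromBlocks_add]
      simp [sub_eq_add_neg]
    rw [e]
    refine Matrix.PosSemidef.of_dotProduct_mulVec_nonneg
      (Matrix.IsHermitian.fromBlocks ((hs c).sub hX') (hs c).neg ((hs c).add hY')) fun x => ?_
    have h3 := h2 (WithLp.toLp 2 (x ∘ Sum.inl)) (WithLp.toLp 2 (x ∘ Sum.inr))
    rw [← qf_one] at h3
    simp only [qf_eq_dotProduct, Matrix.one_mulVec, WithLp.ofLp_sub, dotProduct_sub,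
      sub_dotProduct] at h3
    rw [Matrix.fromBlocks_mulVec, star_trivial]
    conv_rhs => rw [← Sum.elim_comp_inl_inr x, sumElim_dotProduct_sumElim]
    simp only [Matrix.sub_mulVec, Matrix.add_mulVec, Matrix.neg_mulVec,
      Matrix.smul_mulVec, Matrix.one_mulVec, dotProduct_add, dotProduct_neg, dotProduct_smul,
      smul_eq_mul, Sum.elim_comp_inl, Sum.elim_comp_inr, dotProduct_sub]
    linarith [dotProduct_comm (x ∘ Sum.inl) (x ∘ Sum.inr)]

/-! ### Superjets, sup-convolutions and the theorem on sums. -/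

/-- `(p, X)` belongs to the second order superjet of `u` at `x`. -/
def SuperJet (u : Eu N → ℝ) (x p : Eu N) (X : Mat N) : Prop :=
  X.IsSymm ∧ ∀ ε > 0, ∀ᶠ h in 𝓝 (0 : Eu N),
    u (x + h) ≤ u x + ⟪p, h⟫ + qf X h / 2 + ε * ‖h‖ ^ 2

/-- `(p, X)` belongs to the closed second order superjet of `u` at `x`. -/
def ClosedSuperJet (u : Eu N → ℝ) (x p : Eu N) (X : Mat N) : Prop :=
  ∃ (xs ps : ℕ → Eu N) (Xs : ℕ → Mat N), (∀ n, SuperJet u (xs n) (ps n) (Xs n)) ∧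
    Tendsto xs atTop (𝓝 x) ∧ Tendsto (fun n => u (xs n)) atTop (𝓝 (u x)) ∧
    Tendsto ps atTop (𝓝 p) ∧ Tendsto Xs atTop (𝓝 X)

section SupConvolution

variable {E : Type*} [NormedAddCommGroup E] [InnerProductSpace ℝ E] [FiniteDimensional ℝ E]

theorem exists_forall_sub_sq_le {U : E → ℝ} (hU : UpperSemicontinuous U) {A B τ : ℝ} (hB : 0 ≤ B)
    (hτ : 0 < τ) (hb : ∀ z, U z ≤ A + B * ‖z‖) (x : E) :
    ∃ z, ∀ z', U z' - τ / 2 * ‖x - z'‖ ^ 2 ≤ U z - τ / 2 * ‖x - z‖ ^ 2 := by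
  set m := U 0 - τ / 2 * ‖x - 0‖ ^ 2 with hm
  -- Beyond R the quadratic penalty outweighs the linear growth of U and pushes the value below the
  -- one at z = 0.
  set R := 1 + 2 / τ * (B + τ * ‖x‖ + |A - m|) with hR
  have hR1 : 1 ≤ R := by
    have : 0 ≤ 2 / τ * (B + τ * ‖x‖ + |A - m|) := by positivity
    linarith
  have husc : UpperSemicontinuous fun z => U z + -(τ / 2 * ‖x - z‖ ^ 2) :=
    hU.add (Continuous.upperSemicontinuous (by fun_prop))
  obtain ⟨z, hz, hmax⟩ := (husc.upperSemicontinuousOn (Metric.closedBall 0 R)).exists_isMaxOn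
    ⟨0, by simp; linarith⟩ (isCompact_closedBall 0 R)
  refine ⟨z, fun z' => ?_⟩
  simp only [← sub_eq_add_neg] at hmax
  rcases le_or_gt ‖z'‖ R with h | h
  · exact hmax (by simpa using h)
  · have h0 : m ≤ U z - τ / 2 * ‖x - z‖ ^ 2 := hmax (by simp; linarith)
    refine le_trans ?_ h0
    have h1 := hb z'
    have h2 : ‖x - z'‖ ^ 2 ≥ ‖z'‖ ^ 2 - 2 * ‖x‖ * ‖z'‖ := by
      rw [norm_sub_sq_real]
      nlinarith [real_inner_le_norm x z', sq_nonneg ‖x‖]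
    have h3 : B + τ * ‖x‖ + |A - m| ≤ τ / 2 * ‖z'‖ := by
      have : 2 / τ * (B + τ * ‖x‖ + |A - m|) ≤ ‖z'‖ := by linarith
      rw [div_mul_eq_mul_div, div_le_iff₀ hτ] at this
      linarith
    have h4 : 1 ≤ ‖z'‖ := hR1.trans h.le
    have h5 := mul_le_mul_of_nonneg_right h3 (norm_nonneg z')
    have h6 : |A - m| ≤ |A - m| * ‖z'‖ := le_mul_of_one_le_right (abs_nonneg _) h4
    have h7 := le_abs_self (A - m)
    nlinarith [mul_le_mul_of_nonneg_left h2 hτ.le]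

/-- The sup-convolution of a semicontinuous function, with a maximizing map `Z`. -/
theorem exists_supConvolution {U : E → ℝ} (hU : UpperSemicontinuous U) {A B τ : ℝ} (hB : 0 ≤ B)
    (hτ : 0 < τ) (hb : ∀ z, U z ≤ A + B * ‖z‖) :
    ∃ (W : E → ℝ) (Z : E → E), (∀ x z, U z - τ / 2 * ‖x - z‖ ^ 2 ≤ W x) ∧
      (∀ x, W x = U (Z x) - τ / 2 * ‖x - Z x‖ ^ 2) ∧
      StronglyConvex (fun x => W x + (τ + 1) / 2 * ‖x‖ ^ 2) ∧
      ∀ x, IsSubgradient (fun x => W x + (τ + 1) / 2 * ‖x‖ ^ 2) x (τ • Z x + x) := by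
  choose Z hZ using exists_forall_sub_sq_le hU hB hτ hb
  -- Z x is used as a competitor at x'. After adding (τ + 1)/2 ‖·‖², the competing value is exactly
  -- affine in x' − x plus ‖x' − x‖²/2.
  have key : ∀ x x', U (Z x) - τ / 2 * ‖x - Z x‖ ^ 2 + (τ + 1) / 2 * ‖x‖ ^ 2
      + ⟪τ • Z x + x, x' - x⟫ + ‖x' - x‖ ^ 2 / 2
      ≤ U (Z x') - τ / 2 * ‖x' - Z x'‖ ^ 2 + (τ + 1) / 2 * ‖x'‖ ^ 2 := by
    intro x x'
    have h := hZ x' (Z x)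
    have e : U (Z x) - τ / 2 * ‖x - Z x‖ ^ 2 + (τ + 1) / 2 * ‖x‖ ^ 2
      + ⟪τ • Z x + x, x' - x⟫ + ‖x' - x‖ ^ 2 / 2
      = U (Z x) - τ / 2 * ‖x' - Z x‖ ^ 2 + (τ + 1) / 2 * ‖x'‖ ^ 2 := by
      rw [norm_sub_sq_real, norm_sub_sq_real, norm_sub_sq_real]
      simp only [inner_add_left, inner_sub_right, inner_smul_left, conj_trivial,
        real_inner_self_eq_norm_sq]
      rw [real_inner_comm x (Z x), real_inner_comm x' (Z x), real_inner_comm x x']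
      ring
    linarith
  refine ⟨fun x => U (Z x) - τ / 2 * ‖x - Z x‖ ^ 2, Z, fun x z => hZ x z, fun x => rfl,
    fun x => ⟨_, key x⟩, fun x x' => ?_⟩
  have := key x x'
  have : 0 ≤ ‖x' - x‖ ^ 2 / 2 := by positivity
  simp only
  linarith

end SupConvolution

theorem eventually_smul_of_eventually {E : Type*} [NormedAddCommGroup E] [NormedSpace ℝ E]
    {P : E → Prop} (hP : ∀ᶠ h in 𝓝 (0 : E), P h) (v : E) : ∀ᶠ t in 𝓝[>] (0 : ℝ), P (t • v) := by
  have hcont : Tendsto (fun t : ℝ => t • v) (𝓝[>] 0) (𝓝 0) := by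
    have : Continuous fun t : ℝ => t • v := by fun_prop
    simpa using (this.tendsto 0).mono_left nhdsWithin_le_nhds
  exact hcont.eventually hP

/-- A superjet of the sup-convolution at `ξ` is a superjet of the function at the point where the
supremum is attained. -/
theorem superJet_of_supConvolution {U W : Eu N → ℝ} {τ c : ℝ} {ξ z y : Eu N}
    {S : Eu N →ₗ[ℝ] Eu N} (hS : S.IsSymmetric)
    (hW : ∀ x z, U z - τ / 2 * ‖x - z‖ ^ 2 ≤ W x) (hz : W ξ = U z - τ / 2 * ‖ξ - z‖ ^ 2)
    (hexp : ∀ ε > 0, ∀ᶠ h in 𝓝 (0 : Eu N),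
      |W (ξ + h) + c / 2 * ‖ξ + h‖ ^ 2 - (W ξ + c / 2 * ‖ξ‖ ^ 2) - ⟪y, h⟫ - ⟪S h, h⟫ / 2|
        ≤ ε * ‖h‖ ^ 2) :
    ∃ X : Mat N, (∀ h, qf X h = ⟪S h, h⟫ - c * ‖h‖ ^ 2) ∧ SuperJet U z (y - c • ξ) X := by
  obtain ⟨X, hX, hXS⟩ := exists_matrix_of_isSymmetric hS
  have hq : ∀ h, qf (X - c • 1) h = ⟪S h, h⟫ - c * ‖h‖ ^ 2 := fun h => by
    rw [qf_sub, qf_smul, qf_one, hXS]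
  refine ⟨X - c • 1, hq, hX.sub (Matrix.isSymm_one.smul c), fun ε hε => ?_⟩
  filter_upwards [hexp ε hε] with h hh
  -- Moving both points by h leaves the penalty unchanged, so U near z inherits the upper expansion
  -- of W near ξ.
  have h1 := hW (ξ + h) (z + h)
  rw [add_sub_add_right_eq_sub] at h1
  have h2 := (abs_le.1 hh).2
  rw [norm_add_sq_real] at h2
  rw [hq, inner_sub_left, inner_smul_left, conj_trivial]
  linarith

theorem StronglyConvex.sq_norm_le_of_expansion {H : Eu N → ℝ} {x y : Eu N}
    {S : Eu N →ₗ[ℝ] Eu N} (hH : StronglyConvex H) (hs : IsSubgradient H x y)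
    (he : ∀ ε > 0, ∀ᶠ h in 𝓝 (0 : Eu N),
      |H (x + h) - H x - ⟪y, h⟫ - ⟪S h, h⟫ / 2| ≤ ε * ‖h‖ ^ 2) (h : Eu N) :
    ‖h‖ ^ 2 ≤ ⟪S h, h⟫ := by
  refine le_of_forall_pos_le_add fun ε hε => ?_
  have hM : 0 < 2 * (1 + ‖h‖ ^ 2) := by positivity
  obtain ⟨t, ht, ht0⟩ := ((eventually_smul_of_eventually
    (he (ε / (2 * (1 + ‖h‖ ^ 2))) (by positivity)) h).and self_mem_nhdsWithin).exists
  have ht0 : 0 < t := ht0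
  have h1 := (abs_le.1 ht).2
  have h2 := hH.isSubgradient_strong hs (x + t • h)
  rw [add_sub_cancel_left] at h2
  simp only [map_smul, inner_smul_left, inner_smul_right, norm_smul, conj_trivial, mul_pow,
    Real.norm_eq_abs, sq_abs] at h1 h2
  have h3 : ε / (2 * (1 + ‖h‖ ^ 2)) * (t ^ 2 * ‖h‖ ^ 2) ≤ t ^ 2 * ε / 2 := by
    rw [div_mul_eq_mul_div, div_le_iff₀ hM]
    have : 0 < t ^ 2 * ε := by positivity
    linarith
  have h4 : t ^ 2 * ‖h‖ ^ 2 ≤ t ^ 2 * (⟪S h, h⟫ + ε) := by linarith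
  exact le_of_mul_le_mul_left h4 (by positivity)

/-- Second order condition at the contact point: the slopes cancel, and the inequality is divided by
t² along the ray through (h, k). -/
theorem inner_add_inner_le_of_expansion {H₁ H₂ : Eu N → ℝ} {x₁ x₂ y₁ y₂ : Eu N}
    {S₁ S₂ : Eu N →ₗ[ℝ] Eu N} {c τ : ℝ}
    (he₁ : ∀ ε > 0, ∀ᶠ h in 𝓝 (0 : Eu N),
      |H₁ (x₁ + h) - H₁ x₁ - ⟪y₁, h⟫ - ⟪S₁ h, h⟫ / 2| ≤ ε * ‖h‖ ^ 2)
    (he₂ : ∀ ε > 0, ∀ᶠ h in 𝓝 (0 : Eu N),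
      |H₂ (x₂ + h) - H₂ x₂ - ⟪y₂, h⟫ - ⟪S₂ h, h⟫ / 2| ≤ ε * ‖h‖ ^ 2)
    (htouch : ∀ h k, H₁ (x₁ + h) + H₂ (x₂ + k) ≤ H₁ x₁ + H₂ x₂ + ⟪y₁, h⟫ + ⟪y₂, k⟫
        + c / 2 * (‖h‖ ^ 2 + ‖k‖ ^ 2) + τ / 2 * ‖h - k‖ ^ 2) (h k : Eu N) :
    ⟪S₁ h, h⟫ + ⟪S₂ k, k⟫ ≤ c * (‖h‖ ^ 2 + ‖k‖ ^ 2) + τ * ‖h - k‖ ^ 2 := by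
  refine le_of_forall_pos_le_add fun ε hε => ?_
  have hM : 0 < 2 * (1 + ‖h‖ ^ 2 + ‖k‖ ^ 2) := by positivity
  set ε' := ε / (2 * (1 + ‖h‖ ^ 2 + ‖k‖ ^ 2)) with hε'
  have hε'pos : 0 < ε' := by positivity
  obtain ⟨t, ⟨ht₁, ht₂⟩, ht0⟩ := (((eventually_smul_of_eventually (he₁ ε' hε'pos) h).and
    (eventually_smul_of_eventually (he₂ ε' hε'pos) k)).and self_mem_nhdsWithin).exists
  have ht0 : 0 < t := ht0
  have h1 := (abs_le.1 ht₁).1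
  have h2 := (abs_le.1 ht₂).1
  have h3 := htouch (t • h) (t • k)
  rw [← smul_sub] at h3
  simp only [map_smul, inner_smul_left, inner_smul_right, norm_smul, conj_trivial, mul_pow,
    Real.norm_eq_abs, sq_abs] at h1 h2 h3
  have h5 : ε' * (t ^ 2 * ‖h‖ ^ 2) + ε' * (t ^ 2 * ‖k‖ ^ 2) ≤ t ^ 2 * ε / 2 := by
    rw [← mul_add, hε', div_mul_eq_mul_div, div_le_iff₀ hM]
    have : 0 < t ^ 2 * ε := by positivity
    linarith
  have h4 : t ^ 2 * (⟪S₁ h, h⟫ + ⟪S₂ k, k⟫) ≤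
      t ^ 2 * (c * (‖h‖ ^ 2 + ‖k‖ ^ 2) + τ * ‖h - k‖ ^ 2 + ε) := by linarith
  exact le_of_mul_le_mul_left h4 (by positivity)

/-- z − w = (x − y) − (x − z) + (y − w) is a sum of three vectors. This is the source of the factor
3 in the block inequality. -/
theorem sq_norm_sub_le_of_shift {E : Type*} [NormedAddCommGroup E] [InnerProductSpace ℝ E]
    (x y z w : E) :
    ‖z - w‖ ^ 2 ≤ 3 * ‖x - y‖ ^ 2 + 3 * ‖x - z‖ ^ 2 + 3 * ‖y - w‖ ^ 2 := by
  obtain ⟨a, rfl⟩ : ∃ a, z = x - a := ⟨x - z, by abel⟩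
  obtain ⟨b, rfl⟩ : ∃ b, w = y - b := ⟨y - w, by abel⟩
  obtain ⟨d, rfl⟩ : ∃ d, x = y + d := ⟨x - y, by abel⟩
  have e : y + d - a - (y - b) = d - (a - b) := by abel
  rw [e, sub_sub_cancel, sub_sub_cancel, add_sub_cancel_left]
  have h3 : 0 ≤ ‖(2 : ℝ) • d + (a - b)‖ ^ 2 := by positivity
  have h4 : 0 ≤ ‖a + b‖ ^ 2 := by positivity
  rw [norm_add_sq_real, norm_smul, inner_smul_left, mul_pow] at h3
  rw [norm_add_sq_real] at h4
  simp only [conj_trivial, Real.norm_ofNat] at h3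
  rw [norm_sub_sq_real d]
  rw [norm_sub_sq_real] at h3 ⊢
  linarith

/-- Approximate form of the theorem on sums at the origin. -/
theorem exists_superJet_pair {U₁ U₂ : Eu N → ℝ} (hU₁ : UpperSemicontinuous U₁)
    (hU₂ : UpperSemicontinuous U₂) {A B σ δ : ℝ} (hB : 0 ≤ B) (hσ : 0 < σ) (hδ : 0 < δ)
    (hb₁ : ∀ z, U₁ z ≤ A + B * ‖z‖) (hb₂ : ∀ z, U₂ z ≤ A + B * ‖z‖)
    (hmax : ∀ h k, U₁ h + U₂ k ≤ U₁ 0 + U₂ 0 + σ / 2 * ‖h - k‖ ^ 2) :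
    ∃ (z₁ z₂ p₁ p₂ : Eu N) (X₁ X₂ : Mat N), SuperJet U₁ z₁ p₁ X₁ ∧ SuperJet U₂ z₂ p₂ X₂ ∧
      ‖z₁‖ ≤ δ ∧ ‖z₂‖ ≤ δ ∧ ‖p₁‖ ≤ δ ∧ ‖p₂‖ ≤ δ ∧ U₁ 0 - δ ≤ U₁ z₁ ∧ U₂ 0 - δ ≤ U₂ z₂ ∧
      (∀ h k, qf X₁ h + qf X₂ k ≤ δ * (‖h‖ ^ 2 + ‖k‖ ^ 2) + 3 * σ * ‖h - k‖ ^ 2) ∧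
      (∀ h, -(3 * σ * ‖h‖ ^ 2) ≤ qf X₁ h) ∧ (∀ h, -(3 * σ * ‖h‖ ^ 2) ≤ qf X₂ h) := by
  set τ := 3 * σ with hτdef
  have hτ : 0 < τ := by positivity
  obtain ⟨W₁, Z₁, hW₁, hZ₁, hs₁, hg₁⟩ := exists_supConvolution hU₁ hB hτ hb₁
  obtain ⟨W₂, Z₂, hW₂, hZ₂, hs₂, hg₂⟩ := exists_supConvolution hU₂ hB hτ hb₂
  set c := τ + 1 with hc
  have hcpos : 0 < c := by positivity
  -- With τ = 3σ the terms ‖x − Z₁ x‖² and ‖y − Z₂ y‖² are absorbed by the sup-convolutions, and the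
  -- maximum property survives with σ replaced by 3σ.
  have hsum : ∀ x y, W₁ x + W₂ y ≤ U₁ 0 + U₂ 0 + τ / 2 * ‖x - y‖ ^ 2 := by
    intro x y
    rw [hZ₁, hZ₂]
    have h1 := hmax (Z₁ x) (Z₂ y)
    have h2 := mul_le_mul_of_nonneg_left (sq_norm_sub_le_of_shift x y (Z₁ x) (Z₂ y)) hσ.le
    rw [hτdef]
    linarith
  have h10 : U₁ 0 ≤ W₁ 0 := by simpa using hW₁ 0 0
  have h20 : U₂ 0 ≤ W₂ 0 := by simpa using hW₂ 0 0
  have h00 : W₁ 0 + W₂ 0 ≤ U₁ 0 + U₂ 0 := by simpa using hsum 0 0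
  set H₁ : Eu N → ℝ := fun x => W₁ x + c / 2 * ‖x‖ ^ 2 with hH₁
  set H₂ : Eu N → ℝ := fun x => W₂ x + c / 2 * ‖x‖ ^ 2 with hH₂
  have hWc : ∀ {W : Eu N → ℝ}, StronglyConvex (fun x => W x + c / 2 * ‖x‖ ^ 2) → Continuous W := by
    intro W h
    have h1 : Continuous fun x => W x + c / 2 * ‖x‖ ^ 2 - c / 2 * ‖x‖ ^ 2 :=
      h.continuous.sub (by fun_prop)
    simpa using h1
  have hnear : ∀ᶠ x in 𝓝 (0 : Eu N), W₁ 0 - δ < W₁ x ∧ W₂ 0 - δ < W₂ x :=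
    (((hWc hs₁).tendsto 0).eventually_const_lt (by linarith)).and
      (((hWc hs₂).tendsto 0).eventually_const_lt (by linarith))
  obtain ⟨r, hr, hball⟩ := Metric.eventually_nhds_iff_ball.1 hnear
  set D := 1 + c + 2 / τ with hD
  have hDpos : 0 < D := by positivity
  -- The first bound keeps the contact points where W₁ and W₂ are close to their values at 0; the
  -- second keeps the jet base points and slopes below δ.
  set δ' := min (r / 2) (δ / D) with hδ'
  have hδ'pos : 0 < δ' := by positivity
  obtain ⟨x₁, x₂, y₁, y₂, hx₁, hx₂, hy₁, hy₂, hd₁, hd₂, htouch⟩ :=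
    exists_contact hs₁ hs₂ hcpos hτ hδ hδ'pos (fun x y => by
      have := hsum x y
      simp only [hH₁, hH₂, norm_zero]
      linarith)
  have ht₁ : ∀ h, H₁ (x₁ + h) ≤ H₁ x₁ + ⟪y₁, h⟫ + (c + δ + τ) / 2 * ‖h‖ ^ 2 := fun h => by
    have := htouch h 0
    simp only [add_zero, inner_zero_right, norm_zero, sub_zero] at this
    linarith
  have ht₂ : ∀ h, H₂ (x₂ + h) ≤ H₂ x₂ + ⟪y₂, h⟫ + (c + δ + τ) / 2 * ‖h‖ ^ 2 := fun h => by
    have := htouch 0 h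
    simp only [add_zero, inner_zero_right, norm_zero, zero_sub, norm_neg] at this
    linarith
  have hsub₁ := hs₁.isSubgradient_of_touch (by positivity) ht₁
  have hsub₂ := hs₂.isSubgradient_of_touch (by positivity) ht₂
  -- The subgradient τ z + x furnished by the sup-convolution must be the contact slope; as x and
  -- the slope are small, so is z.
  have hyZ : ∀ {H : Eu N → ℝ} {x y z : Eu N} (_ : IsSubgradient H x (τ • z + x))
      (_ : ∀ h, H (x + h) ≤ H x + ⟪y, h⟫ + (c + δ + τ) / 2 * ‖h‖ ^ 2), τ • z + x = y := by
    intro H x y z h1 h2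
    refine eq_of_forall_inner_le (show 0 < c + δ + τ by positivity) fun k => ?_
    have := h1 (x + k)
    rw [add_sub_cancel_left] at this
    linarith [h2 k]
  obtain ⟨S₁, hS₁, he₁⟩ := hs₁.exists_second_order (by positivity) hsub₁ ht₁ hd₁
  obtain ⟨S₂, hS₂, he₂⟩ := hs₂.exists_second_order (by positivity) hsub₂ ht₂ hd₂
  obtain ⟨X₁, hX₁, hj₁⟩ := superJet_of_supConvolution hS₁ hW₁ (hZ₁ x₁) he₁
  obtain ⟨X₂, hX₂, hj₂⟩ := superJet_of_supConvolution hS₂ hW₂ (hZ₂ x₂) he₂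
  have hzle : ∀ {x y z : Eu N}, ‖x‖ ≤ δ' → ‖y‖ ≤ δ' → τ • z + x = y → ‖z‖ ≤ δ := by
    intro x y z hx hy h
    have h1 : τ • z = y - x := by rw [← h]; abel
    have h2 : τ * ‖z‖ = ‖y - x‖ := by rw [← h1, norm_smul, Real.norm_of_nonneg hτ.le]
    have h3 : τ * ‖z‖ ≤ 2 * δ' := by rw [h2]; exact (norm_sub_le _ _).trans (by linarith)
    have h4 : D * δ' ≤ δ := by
      have := min_le_right (r / 2) (δ / D)
      rw [← hδ', le_div_iff₀ hDpos] at this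
      linarith
    have h5 : ‖z‖ ≤ 2 / τ * δ' := by
      rw [div_mul_eq_mul_div, le_div_iff₀ hτ]; linarith
    have : 0 ≤ (1 + c) * δ' := by positivity
    rw [hD] at h4
    linarith
  have hple : ∀ {x y : Eu N}, ‖x‖ ≤ δ' → ‖y‖ ≤ δ' → ‖y - c • x‖ ≤ δ := by
    intro x y hx hy
    have h3 : ‖y - c • x‖ ≤ δ' + c * δ' := by
      refine (norm_sub_le _ _).trans ?_
      rw [norm_smul, Real.norm_of_nonneg hcpos.le]
      gcongr
    have h4 : D * δ' ≤ δ := by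
      have := min_le_right (r / 2) (δ / D)
      rw [← hδ', le_div_iff₀ hDpos] at this
      linarith
    have : 0 ≤ 2 / τ * δ' := by positivity
    rw [hD] at h4
    linarith
  have hin : ∀ {x : Eu N}, ‖x‖ ≤ δ' → x ∈ Metric.ball (0 : Eu N) r := by
    intro x hx
    rw [mem_ball_zero_iff]
    have := min_le_left (r / 2) (δ / D)
    rw [← hδ'] at this
    linarith
  refine ⟨Z₁ x₁, Z₂ x₂, y₁ - c • x₁, y₂ - c • x₂, X₁, X₂, hj₁, hj₂,
    hzle hx₁ hy₁ (hyZ (hg₁ x₁) ht₁), hzle hx₂ hy₂ (hyZ (hg₂ x₂) ht₂), hple hx₁ hy₁, hple hx₂ hy₂,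
    ?_, ?_, ?_, ?_, ?_⟩
  · have h1 := (hball x₁ (hin hx₁)).1
    have h2 := hZ₁ x₁
    have : 0 ≤ τ / 2 * ‖x₁ - Z₁ x₁‖ ^ 2 := by positivity
    linarith
  · have h1 := (hball x₂ (hin hx₂)).2
    have h2 := hZ₂ x₂
    have : 0 ≤ τ / 2 * ‖x₂ - Z₂ x₂‖ ^ 2 := by positivity
    linarith
  · intro h k
    have key := inner_add_inner_le_of_expansion he₁ he₂ htouch h k
    rw [hX₁, hX₂]
    linarith
  · intro h
    have := hs₁.sq_norm_le_of_expansion hsub₁ he₁ h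
    rw [hX₁, hc]
    linarith
  · intro h
    have := hs₂.sq_norm_le_of_expansion hsub₂ he₂ h
    rw [hX₂, hc]
    linarith

theorem tendsto_of_upperSemicontinuousAt {E : Type*} [TopologicalSpace E] {U : E → ℝ} {x : E}
    (hU : UpperSemicontinuousAt U x) {z : ℕ → E} {b : ℕ → ℝ} (hz : Tendsto z atTop (𝓝 x))
    (hb : Tendsto b atTop (𝓝 (U x))) (h : ∀ n, b n ≤ U (z n)) :
    Tendsto (fun n => U (z n)) atTop (𝓝 (U x)) := by
  rw [tendsto_order]
  constructor
  · intro a ha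
    filter_upwards [hb.eventually_const_lt ha] with n hn using hn.trans_le (h n)
  · intro a ha
    exact hz.eventually (hU a ha)

theorem exists_subseq_tendsto_matrix {X : ℕ → Mat N} {C : ℝ} (h : ∀ n i j, |X n i j| ≤ C) :
    ∃ (Y : Mat N) (φ : ℕ → ℕ), StrictMono φ ∧ Tendsto (fun n => X (φ n)) atTop (𝓝 Y) := by
  have hc : IsCompact (Set.univ.pi fun _ : Fin N => Set.univ.pi fun _ : Fin N => Set.Icc (-C) C) :=
    isCompact_univ_pi fun _ => isCompact_univ_pi fun _ => isCompact_Icc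
  obtain ⟨Y, -, φ, hφ, hlim⟩ := IsCompact.tendsto_subseq (X := Fin N → Fin N → ℝ) hc (x := X)
    (fun n i _ j _ => abs_le.1 (h n i j))
  exact ⟨Y, φ, hφ, hlim⟩

theorem tendsto_qf {X : ℕ → Mat N} {Y : Mat N} (h : Tendsto X atTop (𝓝 Y)) (v : Eu N) :
    Tendsto (fun n => qf (X n) v) atTop (𝓝 (qf Y v)) :=
  ((continuous_qf_left v).tendsto Y).comp h

theorem isSymm_of_tendsto {X : ℕ → Mat N} {Y : Mat N} (h : Tendsto X atTop (𝓝 Y))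
    (hX : ∀ n, (X n).IsSymm) : Y.IsSymm := by
  have hcl : IsClosed {Z : Mat N | Z.transpose = Z} :=
    isClosed_eq (Continuous.matrix_transpose continuous_id) continuous_id
  exact hcl.mem_of_tendsto h (Eventually.of_forall hX)

/-- The theorem on sums at the origin. -/
theorem exists_closedSuperJet_pair {U₁ U₂ : Eu N → ℝ} (hU₁ : UpperSemicontinuous U₁)
    (hU₂ : UpperSemicontinuous U₂) {A B σ : ℝ} (hB : 0 ≤ B) (hσ : 0 < σ)
    (hb₁ : ∀ z, U₁ z ≤ A + B * ‖z‖) (hb₂ : ∀ z, U₂ z ≤ A + B * ‖z‖)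
    (hmax : ∀ h k, U₁ h + U₂ k ≤ U₁ 0 + U₂ 0 + σ / 2 * ‖h - k‖ ^ 2) :
    ∃ X₁ X₂ : Mat N, X₁.IsSymm ∧ X₂.IsSymm ∧ ClosedSuperJet U₁ 0 0 X₁ ∧ ClosedSuperJet U₂ 0 0 X₂ ∧
      BlockIneq (3 * σ) X₁ (-X₂) := by
  have hδ : ∀ n : ℕ, (0 : ℝ) < 1 / (n + 1) := fun n => by positivity
  choose z₁ z₂ p₁ p₂ X₁ X₂ hj₁ hj₂ hz₁ hz₂ hp₁ hp₂ hu₁ hu₂ hq hl₁ hl₂ using fun n : ℕ =>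
    exists_superJet_pair hU₁ hU₂ hB hσ (hδ n) hb₁ hb₂ hmax
  have hδ0 : Tendsto (fun n : ℕ => (1 : ℝ) / (n + 1)) atTop (𝓝 0) :=
    tendsto_one_div_add_atTop_nhds_zero_nat
  have hδ1 : ∀ n : ℕ, (1 : ℝ) / (n + 1) ≤ 1 := fun n => by
    rw [div_le_one (by positivity)]
    have : (0 : ℝ) ≤ n := by positivity
    linarith
  -- The two form inequalities place each matrix between −3σ and 1 + 3σ, uniformly in n, which gives
  -- a convergent subsequence.
  have hbd₁ : ∀ n i j, |X₁ n i j| ≤ 3 * (1 + 3 * σ) := fun n i j =>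
    abs_entry_le (hj₁ n).1 (fun v => by
      have h1 := hq n v 0
      have h2 := hl₁ n v
      have h3 := mul_le_mul_of_nonneg_right (hδ1 n) (sq_nonneg ‖v‖)
      have h0 : qf (X₂ n) 0 = 0 := by simp [qf]
      simp only [h0, norm_zero, sub_zero] at h1
      rw [abs_le]
      constructor <;> linarith [sq_nonneg ‖v‖]) i j
  have hbd₂ : ∀ n i j, |X₂ n i j| ≤ 3 * (1 + 3 * σ) := fun n i j =>
    abs_entry_le (hj₂ n).1 (fun v => by
      have h1 := hq n 0 v
      have h2 := hl₂ n v
      have h3 := mul_le_mul_of_nonneg_right (hδ1 n) (sq_nonneg ‖v‖)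
      have h0 : qf (X₁ n) 0 = 0 := by simp [qf]
      simp only [h0, norm_zero, zero_sub, norm_neg] at h1
      rw [abs_le]
      constructor <;> linarith [sq_nonneg ‖v‖]) i j
  obtain ⟨Y₁, φ, hφ, hY₁⟩ := exists_subseq_tendsto_matrix hbd₁
  obtain ⟨Y₂, ψ, hψ, hY₂⟩ := exists_subseq_tendsto_matrix (fun n => hbd₂ (φ n))
  have hθ : Tendsto (fun n => φ (ψ n)) atTop atTop :=
    hφ.tendsto_atTop.comp hψ.tendsto_atTop
  have hY₁' : Tendsto (fun n => X₁ (φ (ψ n))) atTop (𝓝 Y₁) := hY₁.comp hψ.tendsto_atTop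
  have hz : ∀ {z : ℕ → Eu N}, (∀ n, ‖z n‖ ≤ 1 / ((n : ℝ) + 1)) →
      Tendsto (fun n => z (φ (ψ n))) atTop (𝓝 0) := fun h =>
    (squeeze_zero_norm h hδ0).comp hθ
  have hb : ∀ u : ℝ, Tendsto (fun n => u - 1 / (((φ (ψ n) : ℕ) : ℝ) + 1)) atTop (𝓝 u) := fun u => by
    simpa using (tendsto_const_nhds (x := u)).sub (hδ0.comp hθ)
  have hs₁ := isSymm_of_tendsto hY₁' fun n => (hj₁ _).1
  have hs₂ := isSymm_of_tendsto hY₂ fun n => (hj₂ _).1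
  refine ⟨Y₁, Y₂, hs₁, hs₂,
    ⟨_, _, _, fun n => hj₁ (φ (ψ n)), hz hz₁, tendsto_of_upperSemicontinuousAt (hU₁.upperSemicontinuousAt 0) (hz hz₁) (hb _)
      fun n => hu₁ _, hz hp₁, hY₁'⟩,
    ⟨_, _, _, fun n => hj₂ (φ (ψ n)), hz hz₂, tendsto_of_upperSemicontinuousAt (hU₂.upperSemicontinuousAt 0) (hz hz₂) (hb _)
      fun n => hu₂ _, hz hp₂, hY₂⟩, blockIneq_of_qf hs₁ hs₂.neg (fun h k => ?_) fun h k => ?_⟩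
  · rw [qf_neg]
    have h1 := ge_of_tendsto' (tendsto_qf hY₁' h) fun n => hl₁ _ h
    have h2 := ge_of_tendsto' (tendsto_qf hY₂ k) fun n => hl₂ _ k
    linarith
  · rw [qf_neg]
    have h1 := (tendsto_qf hY₁' h).add (tendsto_qf hY₂ k)
    have h2 : Tendsto (fun n => 1 / (((φ (ψ n) : ℕ) : ℝ) + 1) * (‖h‖ ^ 2 + ‖k‖ ^ 2)
        + 3 * σ * ‖h - k‖ ^ 2) atTop (𝓝 (0 * (‖h‖ ^ 2 + ‖k‖ ^ 2) + 3 * σ * ‖h - k‖ ^ 2)) :=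
      ((hδ0.comp hθ).mul_const _).add_const _
    have h3 := le_of_tendsto_of_tendsto' h1 h2 fun n => hq _ h k
    linarith

theorem SuperJet.of_translate {u : Eu N → ℝ} {a p z q : Eu N} {X : Mat N}
    (h : SuperJet (fun z => u (a + z) - ⟪p, z⟫) z q X) : SuperJet u (a + z) (q + p) X := by
  refine ⟨h.1, fun ε hε => ?_⟩
  filter_upwards [h.2 ε hε] with k hk
  rw [add_assoc, inner_add_left]
  rw [inner_add_right] at hk
  linarith

theorem ClosedSuperJet.of_translate {u : Eu N → ℝ} {a p : Eu N} {X : Mat N}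
    (h : ClosedSuperJet (fun z => u (a + z) - ⟪p, z⟫) 0 0 X) : ClosedSuperJet u a p X := by
  obtain ⟨xs, ps, Xs, hj, hx, hu, hp, hX⟩ := h
  refine ⟨fun n => a + xs n, fun n => ps n + p, Xs, fun n => (hj n).of_translate, ?_, ?_, ?_, hX⟩
  · simpa using hx.const_add a
  · have h1 : Tendsto (fun n => ⟪p, xs n⟫) atTop (𝓝 ⟪p, (0 : Eu N)⟫) :=
      Tendsto.inner tendsto_const_nhds hx
    have h2 := hu.add h1
    simpa using h2
  · simpa using hp.add_const p

/-- The theorem on sums for a quadratic penalization. -/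
theorem theorem_on_sums {U V : Eu N → ℝ} (hU : UpperSemicontinuous U)
    (hV : LowerSemicontinuous V) {M σ : ℝ} (hσ : 0 < σ) (hbU : ∀ x, U x ≤ M) (hbV : ∀ y, -M ≤ V y)
    {e x₀ y₀ : Eu N}
    (hmax : ∀ x y, U x - V y - σ / 2 * ‖x - y + e‖ ^ 2
      ≤ U x₀ - V y₀ - σ / 2 * ‖x₀ - y₀ + e‖ ^ 2) :
    ∃ X Y : Mat N, X.IsSymm ∧ Y.IsSymm ∧ BlockIneq (3 * σ) X Y ∧
      ClosedSuperJet U x₀ (σ • (x₀ - y₀ + e)) X ∧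
      ClosedSuperJet (fun y => -V y) y₀ (-(σ • (x₀ - y₀ + e))) (-Y) := by
  -- p is the gradient of the penalty in x. Subtracting the linear terms with slopes p and −p leaves
  -- σ/2 ‖h − k‖² and moves the maximum to the origin; the shift e enters only through p.
  set p := σ • (x₀ - y₀ + e) with hp
  have hcont : ∀ q : Eu N, Continuous fun z : Eu N => -⟪q, z⟫ := fun q => by fun_prop
  have hsh : ∀ a : Eu N, Continuous fun z => a + z := fun a => by fun_prop
  have hV' : UpperSemicontinuous fun y => -V y := fun x c hc => by
    filter_upwards [hV x (-c) (by linarith)] with y hy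
    linarith
  have husc : ∀ {W : Eu N → ℝ} (a q : Eu N), UpperSemicontinuous W →
      UpperSemicontinuous fun z => W (a + z) - ⟪q, z⟫ := fun {W} a q hW => by
    have h1 : UpperSemicontinuous fun z => W (a + z) := hW.comp (hsh a)
    simpa [sub_eq_add_neg] using h1.add (hcont q).upperSemicontinuous
  have hbd : ∀ {W : Eu N → ℝ} (a q : Eu N), (∀ x, W x ≤ M) → ‖q‖ = ‖p‖ →
      ∀ z, W (a + z) - ⟪q, z⟫ ≤ M + ‖p‖ * ‖z‖ := fun a q hW hq z => by
    have h1 := real_inner_le_norm (-q) z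
    rw [inner_neg_left, norm_neg, hq] at h1
    linarith [hW (a + z)]
  obtain ⟨X₁, X₂, hs₁, hs₂, hj₁, hj₂, hblock⟩ := exists_closedSuperJet_pair
    (husc x₀ p hU) (husc y₀ (-p) hV') (norm_nonneg p) hσ (hbd x₀ p hbU rfl)
    (hbd (W := fun y => -V y) y₀ (-p) (fun y => by linarith [hbV y]) (norm_neg p)) (fun h k => by
      have h1 := hmax (x₀ + h) (y₀ + k)
      have e1 : x₀ + h - (y₀ + k) + e = (x₀ - y₀ + e) + (h - k) := by abel
      rw [e1, norm_add_sq_real (x₀ - y₀ + e)] at h1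
      have e2 : ⟪p, h⟫ - ⟪p, k⟫ = σ * ⟪x₀ - y₀ + e, h - k⟫ := by
        rw [← inner_sub_right, hp, inner_smul_left, conj_trivial]
      simp only [inner_neg_left, inner_zero_right, add_zero]
      linarith)
  refine ⟨X₁, -X₂, hs₁, hs₂.neg, hblock, hj₁.of_translate, ?_⟩
  rw [neg_neg]
  exact hj₂.of_translate

/-! ### Jets of C² functions and explicit test functions. -/

theorem qf_matrix_of_bilin (B : Eu N →L[ℝ] Eu N →L[ℝ] ℝ) (h : Eu N) :
    qf (Matrix.of fun i j => B (EuclideanSpace.single i 1) (EuclideanSpace.single j 1)) h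
      = B h h := by
  have hh : h = ∑ i, h i • EuclideanSpace.single i (1 : ℝ) := by
    have := (EuclideanSpace.basisFun (Fin N) ℝ).sum_repr h
    simpa using this.symm
  conv_rhs => rw [hh]
  rw [qf_eq_dotProduct]
  simp only [dotProduct, Matrix.mulVec, Matrix.of_apply, map_sum, map_smul, smul_eq_mul,
    sum_apply, smul_apply, Finset.mul_sum]
  rw [Finset.sum_comm]
  refine Finset.sum_congr rfl fun i _ => Finset.sum_congr rfl fun j _ => ?_
  ring

theorem exists_abs_qf_le (X : Mat N) : ∃ C, 0 ≤ C ∧ ∀ h, |qf X h| ≤ C * ‖h‖ ^ 2 := by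
  let T := LinearMap.toContinuousLinearMap X.toEuclideanLin
  refine ⟨‖T‖, norm_nonneg _, fun h => ?_⟩
  have h1 := abs_real_inner_le_norm (X.toEuclideanLin h) h
  have h2 : ‖X.toEuclideanLin h‖ ≤ ‖T‖ * ‖h‖ := T.le_opNorm h
  rw [qf]
  nlinarith [norm_nonneg h]

theorem eq_of_qf_eq {X Y : Mat N} (hX : X.IsSymm) (hY : Y.IsSymm) (h : ∀ v, qf X v = qf Y v) :
    X = Y := by
  have h0 : ∀ v, |qf (X - Y) v| ≤ 0 * ‖v‖ ^ 2 := fun v => by simp [qf_sub, h v]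
  ext i j
  have := abs_entry_le (hX.sub hY) h0 i j
  rw [mul_zero] at this
  have := abs_nonpos_iff.1 this
  simpa [sub_eq_zero] using this

/-- `ψ` has the second order expansion `ψ x + ⟪p, h⟫ + qf X h / 2` at `x`. -/
def HasJet (ψ : Eu N → ℝ) (x p : Eu N) (X : Mat N) : Prop :=
  X.IsSymm ∧ ∀ ε > 0, ∀ᶠ h in 𝓝 (0 : Eu N),
    |ψ (x + h) - ψ x - ⟪p, h⟫ - qf X h / 2| ≤ ε * ‖h‖ ^ 2

/-- Along the ray through q − p, dividing by t compares the slopes; once they agree, dividing by t²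
compares the forms. -/
theorem eq_and_qf_le_of_jets_le {p q : Eu N} {X Y : Mat N}
    (h : ∀ ε > 0, ∀ᶠ k in 𝓝 (0 : Eu N),
      ⟪q, k⟫ + qf Y k / 2 ≤ ⟪p, k⟫ + qf X k / 2 + ε * ‖k‖ ^ 2) :
    q = p ∧ ∀ k, qf Y k ≤ qf X k := by
  have hpq : q = p := by
    set v := q - p with hv
    have key : ∀ᶠ t in 𝓝[>] (0 : ℝ), ⟪v, v⟫ ≤ t * (qf X v / 2 - qf Y v / 2 + ‖v‖ ^ 2) := by
      filter_upwards [eventually_smul_of_eventually (h 1 one_pos) v, self_mem_nhdsWithin]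
        with t ht ht0
      have ht0 : 0 < t := ht0
      simp only [inner_smul_right, qf_smul_vec, norm_smul, mul_pow, Real.norm_eq_abs, sq_abs] at ht
      have h1 : t * ⟪v, v⟫ ≤ t * (t * (qf X v / 2 - qf Y v / 2 + ‖v‖ ^ 2)) := by
        nth_rewrite 1 [hv]
        rw [inner_sub_left]
        linarith
      exact le_of_mul_le_mul_left h1 ht0
    have hlim : Tendsto (fun t : ℝ => t * (qf X v / 2 - qf Y v / 2 + ‖v‖ ^ 2)) (𝓝[>] 0)
        (𝓝 (0 * (qf X v / 2 - qf Y v / 2 + ‖v‖ ^ 2))) :=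
      Tendsto.mono_left (Continuous.tendsto (by fun_prop) 0) nhdsWithin_le_nhds
    have h2 := ge_of_tendsto hlim key
    rw [zero_mul, real_inner_self_eq_norm_sq] at h2
    exact sub_eq_zero.1 (norm_eq_zero.1 (pow_eq_zero_iff two_ne_zero |>.1
      (le_antisymm h2 (by positivity))))
  refine ⟨hpq, fun k => ?_⟩
  subst hpq
  refine le_of_forall_pos_le_add fun ε hε => ?_
  have hM : 0 < 2 * (1 + ‖k‖ ^ 2) := by positivity
  obtain ⟨t, ht, ht0⟩ := ((eventually_smul_of_eventually
    (h (ε / (2 * (1 + ‖k‖ ^ 2))) (by positivity)) k).and self_mem_nhdsWithin).exists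
  have ht0 : 0 < t := ht0
  simp only [inner_smul_right, qf_smul_vec, norm_smul, mul_pow, Real.norm_eq_abs, sq_abs] at ht
  have h3 : ε / (2 * (1 + ‖k‖ ^ 2)) * (t ^ 2 * ‖k‖ ^ 2) ≤ t ^ 2 * ε / 2 := by
    rw [div_mul_eq_mul_div, div_le_iff₀ hM]
    have : 0 < t ^ 2 * ε := by positivity
    linarith
  have h4 : t ^ 2 * qf Y k ≤ t ^ 2 * (qf X k + ε) := by linarith
  exact le_of_mul_le_mul_left h4 (by positivity)

theorem HasJet.unique {ψ : Eu N → ℝ} {x p q : Eu N} {X Y : Mat N} (h : HasJet ψ x p X)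
    (h' : HasJet ψ x q Y) : p = q ∧ X = Y := by
  have key : ∀ {p q : Eu N} {X Y : Mat N}, HasJet ψ x p X → HasJet ψ x q Y →
      q = p ∧ ∀ k, qf Y k ≤ qf X k := fun h h' =>
    eq_and_qf_le_of_jets_le fun ε hε => by
      filter_upwards [h.2 (ε / 2) (by positivity), h'.2 (ε / 2) (by positivity)] with k h1 h2
      have h3 := (abs_le.1 h1).2
      have h4 := (abs_le.1 h2).1
      linarith
  exact ⟨(key h' h).1, eq_of_qf_eq h.1 h'.1 fun v => le_antisymm ((key h' h).2 v) ((key h h').2 v)⟩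

/-- A `C²` function has the expansion given by its gradient and Hessian. -/
theorem hasJet_of_contDiffAt {ψ : Eu N → ℝ} {x : Eu N} (h : ContDiffAt ℝ 2 ψ x) :
    HasJet ψ x (gradient ψ x) (hess ψ x) := by
  have h1 : ∀ᶠ y in 𝓝 x, HasFDerivAt ψ (fderiv ℝ ψ y) y := by
    filter_upwards [h.eventually (by simp)] with y hy
    exact (hy.differentiableAt (by simp)).hasFDerivAt
  have h2 : HasFDerivAt (fderiv ℝ ψ) (fderiv ℝ (fderiv ℝ ψ) x) x :=
    ((h.fderiv_right (m := 1) (by norm_num)).differentiableAt (by simp)).hasFDerivAt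
  refine ⟨?_, fun ε hε => ?_⟩
  · ext i j
    simp only [hess, Matrix.transpose_apply, Matrix.of_apply]
    exact second_derivative_symmetric_of_eventually (𝕜 := ℝ) h1 h2 _ _
  · filter_upwards [taylor_two h1 h2 hε] with k hk
    have e1 : ⟪gradient ψ x, k⟫ = fderiv ℝ ψ x k := by
      rw [gradient]; simp
    have e2 : qf (hess ψ x) k = fderiv ℝ (fderiv ℝ ψ) x k k := qf_matrix_of_bilin _ k
    rw [e1, e2]
    exact hk

theorem HasJet.gradient_hess_eq {ψ : Eu N → ℝ} {x p : Eu N} {X : Mat N} (hj : HasJet ψ x p X)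
    (h : ContDiffAt ℝ 2 ψ x) : gradient ψ x = p ∧ hess ψ x = X :=
  (hasJet_of_contDiffAt h).unique hj

theorem SuperJet.of_touch {u ψ : Eu N → ℝ} {x p : Eu N} {X : Mat N} (hψ : HasJet ψ x p X)
    (h : ∀ᶠ y in 𝓝 x, u y - ψ y ≤ u x - ψ x) : SuperJet u x p X := by
  refine ⟨hψ.1, fun ε hε => ?_⟩
  have ht : Tendsto (fun k : Eu N => x + k) (𝓝 0) (𝓝 x) := by
    have : Continuous fun k : Eu N => x + k := by fun_prop
    simpa using this.tendsto 0
  filter_upwards [hψ.2 ε hε, ht.eventually h] with k h1 h2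
  linarith [(abs_le.1 h1).2]

theorem SuperJet.mono {u v : Eu N → ℝ} {x p : Eu N} {X : Mat N} (h : SuperJet v x p X)
    (hle : ∀ᶠ y in 𝓝 x, u y ≤ v y) (hx : u x = v x) : SuperJet u x p X := by
  refine ⟨h.1, fun ε hε => ?_⟩
  have ht : Tendsto (fun k : Eu N => x + k) (𝓝 0) (𝓝 x) := by
    have : Continuous fun k : Eu N => x + k := by fun_prop
    simpa using this.tendsto 0
  filter_upwards [h.2 ε hε, ht.eventually hle] with k h1 h2
  linarith

/-- Superjets of a function lying above a twice differentiable one with the same value. -/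
theorem SuperJet.compare {u ψ : Eu N → ℝ} {x p q : Eu N} {X Y : Mat N} (h : SuperJet u x p X)
    (hψ : HasJet ψ x q Y) (hle : ∀ᶠ y in 𝓝 x, ψ y ≤ u y) (hx : ψ x = u x) :
    q = p ∧ ∀ k, qf Y k ≤ qf X k := by
  have ht : Tendsto (fun k : Eu N => x + k) (𝓝 0) (𝓝 x) := by
    have : Continuous fun k : Eu N => x + k := by fun_prop
    simpa using this.tendsto 0
  refine eq_and_qf_le_of_jets_le fun ε hε => ?_
  filter_upwards [h.2 (ε / 2) (by positivity), hψ.2 (ε / 2) (by positivity), ht.eventually hle]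
    with k h1 h2 h3
  linarith [(abs_le.1 h2).1]

/-- The quadratic-quartic test function centred at `x`. -/
def testFun (x p : Eu N) (X : Mat N) (K : ℝ) (y : Eu N) : ℝ :=
  ⟪p, y - x⟫ + qf X (y - x) / 2 + K * (‖y - x‖ ^ 2) ^ 2

theorem contDiff_qf (X : Mat N) : ContDiff ℝ 2 fun v : Eu N => qf X v := by
  let T := LinearMap.toContinuousLinearMap X.toEuclideanLin
  have : ContDiff ℝ 2 fun v : Eu N => ⟪T v, v⟫ := T.contDiff.inner ℝ contDiff_id
  exact this

theorem contDiff_testFun (x p : Eu N) (X : Mat N) (K : ℝ) : ContDiff ℝ 2 (testFun x p X K) := by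
  have h1 : ContDiff ℝ 2 fun y : Eu N => y - x := contDiff_id.sub contDiff_const
  have h2 : ContDiff ℝ 2 fun y : Eu N => ‖y - x‖ ^ 2 := h1.norm_sq ℝ
  exact ((contDiff_const.inner ℝ h1).add (((contDiff_qf X).comp h1).div_const 2)).add
    (contDiff_const.mul (h2.pow 2))

theorem hasJet_testFun (x p : Eu N) {X : Mat N} (hX : X.IsSymm) (K : ℝ) :
    HasJet (testFun x p X K) x p X := by
  refine ⟨hX, fun ε hε => ?_⟩
  have hcont : Tendsto (fun h : Eu N => |K| * ‖h‖ ^ 2) (𝓝 0) (𝓝 0) := by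
    have : Continuous fun h : Eu N => |K| * ‖h‖ ^ 2 := by fun_prop
    simpa using this.tendsto 0
  filter_upwards [hcont.eventually_lt_const hε] with h hh
  have e : testFun x p X K (x + h) - testFun x p X K x - ⟪p, h⟫ - qf X h / 2
      = K * ‖h‖ ^ 2 * ‖h‖ ^ 2 := by
    have h0 : qf X 0 = 0 := by simp [qf]
    simp [testFun, h0]
    ring
  rw [e, abs_mul, abs_mul, abs_of_nonneg (sq_nonneg ‖h‖)]
  exact mul_le_mul_of_nonneg_right hh.le (sq_nonneg _)

theorem testFun_self (x p : Eu N) (X : Mat N) (K : ℝ) : testFun x p X K x = 0 := by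
  simp [testFun, qf]

theorem gradient_testFun (x p : Eu N) {X : Mat N} (hX : X.IsSymm) (K : ℝ) :
    gradient (testFun x p X K) x = p :=
  ((hasJet_testFun x p hX K).gradient_hess_eq (contDiff_testFun x p X K).contDiffAt).1

theorem hess_testFun (x p : Eu N) {X : Mat N} (hX : X.IsSymm) (K : ℝ) :
    hess (testFun x p X K) x = X :=
  ((hasJet_testFun x p hX K).gradient_hess_eq (contDiff_testFun x p X K).contDiffAt).2

/-! ### Differential inequalities on jets, positive parts and truncations. -/

theorem IsContinuousOperator.tendsto {F : Operator N} {O : Set (Eu N)}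
    (hF : IsContinuousOperator F O) {ι : Type*} {l : Filter ι} {xs ps : ι → Eu N} {rs : ι → ℝ}
    {Xs : ι → Mat N} {x p : Eu N} {r : ℝ} {X : Mat N} (hx : Tendsto xs l (𝓝 x))
    (hr : Tendsto rs l (𝓝 r)) (hp : Tendsto ps l (𝓝 p)) (hX : Tendsto Xs l (𝓝 X))
    (hxO : x ∈ O) (hXs : X.IsSymm) (hO : ∀ᶠ n in l, xs n ∈ O) (hs : ∀ᶠ n in l, (Xs n).IsSymm) :
    Tendsto (fun n => F (xs n) (rs n) (ps n) (Xs n)) l (𝓝 (F x r p X)) := by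
  have h1 := hF (x, r, p, X) ⟨hxO, hXs⟩
  have h2 : Tendsto (fun n => (xs n, rs n, ps n, Xs n)) l (𝓝 (x, r, p, X)) :=
    hx.prodMk_nhds (hr.prodMk_nhds (hp.prodMk_nhds hX))
  have h3 : Tendsto (fun n => (xs n, rs n, ps n, Xs n)) l
      (𝓝[{q | q.1 ∈ O ∧ q.2.2.2.IsSymm}] (x, r, p, X)) :=
    tendsto_nhdsWithin_iff.2 ⟨h2, hO.and hs⟩
  exact h1.tendsto.comp h3

theorem IsContinuousOperator.tendsto_add_smul_one {F : Operator N} {O : Set (Eu N)}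
    (hF : IsContinuousOperator F O) {x : Eu N} (hx : x ∈ O) (r : ℝ) (p : Eu N) {X : Mat N}
    (hX : X.IsSymm) :
    Tendsto (fun ε : ℝ => F x r p (X + ε • 1)) (𝓝 0) (𝓝 (F x r p X)) := by
  have hc : Continuous fun ε : ℝ => X + ε • (1 : Mat N) := by fun_prop
  have h := hc.tendsto 0
  rw [zero_smul, add_zero] at h
  exact hF.tendsto tendsto_const_nhds tendsto_const_nhds tendsto_const_nhds h hx hX
    (Eventually.of_forall fun _ => hx)
    (Eventually.of_forall fun _ => hX.add (Matrix.isSymm_one.smul _))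

/-- Supersolutions satisfy the differential inequality on subjets. -/
theorem IsViscositySupersolution.le_of_subJet {F : Operator N} {O U : Set (Eu N)}
    (hF : IsContinuousOperator F O) (hUO : U ⊆ O) {g : Eu N → ℝ → ℝ}
    {φ : Eu N → ℝ} (hφ : IsViscositySupersolution (fun x r p X => F x r p X - g x r) U φ)
    {x p : Eu N} {Y : Mat N} (hx : x ∈ U) (hj : SuperJet (fun y => -φ y) x (-p) (-Y)) :
    g x (φ x) ≤ F x (φ x) p Y := by
  have hY : Y.IsSymm := by simpa using hj.1.neg
  -- Lowering the Hessian by ε absorbs the o(‖h‖²) term, so a genuine quadratic touches φ from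
  -- below; continuity of F then lets ε tend to 0.
  have key : ∀ ε : ℝ, 0 < ε → g x (φ x) ≤ F x (φ x) p (Y + (-ε) • 1) := by
    intro ε hε
    have hs : (Y + (-ε) • (1 : Mat N)).IsSymm := hY.add (Matrix.isSymm_one.smul _)
    have h1 := hφ x hx (testFun x p (Y + (-ε) • 1) 0) (contDiff_testFun _ _ _ _).contDiffAt (by
      refine IsLocalMin.on ?_ U
      have ht : Tendsto (fun y : Eu N => y - x) (𝓝 x) (𝓝 0) := by
        have : Continuous fun y : Eu N => y - x := by fun_prop
        simpa using this.tendsto x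
      filter_upwards [ht.eventually (hj.2 (ε / 2) (by positivity))] with y hy
      rw [testFun_self]
      rw [add_sub_cancel] at hy
      simp only [testFun, inner_neg_left, qf_neg, qf_add, qf_smul, qf_one] at hy ⊢
      linarith)
    rw [gradient_testFun _ _ hs, hess_testFun _ _ hs] at h1
    linarith
  have hlim : Tendsto (fun ε : ℝ => F x (φ x) p (Y + (-ε) • 1)) (𝓝[>] 0) (𝓝 (F x (φ x) p Y)) := by
    have h0 : Tendsto (fun ε : ℝ => -ε) (𝓝[>] 0) (𝓝 0) := by
      have : Continuous fun ε : ℝ => -ε := by fun_prop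
      simpa using (this.tendsto 0).mono_left nhdsWithin_le_nhds
    exact (hF.tendsto_add_smul_one (hUO hx) (φ x) p hY).comp h0
  exact ge_of_tendsto hlim (by filter_upwards [self_mem_nhdsWithin] with ε hε using key ε hε)

/-- The positive part of `u` on `closure Ω`, extended by zero. -/
def posExt (Ω : Set (Eu N)) (u : Eu N → ℝ) : Eu N → ℝ :=
  (closure Ω).indicator fun x => max (u x) 0

theorem posExt_nonneg (Ω : Set (Eu N)) (u : Eu N → ℝ) (x : Eu N) : 0 ≤ posExt Ω u x :=
  Set.indicator_nonneg (fun _ _ => le_max_right _ _) x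

theorem posExt_of_mem {Ω : Set (Eu N)} {u : Eu N → ℝ} {x : Eu N} (hx : x ∈ closure Ω) :
    posExt Ω u x = max (u x) 0 := Set.indicator_of_mem hx _

theorem mem_closure_of_posExt_pos {Ω : Set (Eu N)} {u : Eu N → ℝ} {x : Eu N}
    (hx : 0 < posExt Ω u x) : x ∈ closure Ω := by
  by_contra h
  rw [posExt, Set.indicator_of_notMem h] at hx
  exact lt_irrefl _ hx

theorem posExt_eq_of_pos {Ω : Set (Eu N)} {u : Eu N → ℝ} {x : Eu N}
    (hx : 0 < posExt Ω u x) : posExt Ω u x = u x := by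
  have h := posExt_of_mem (u := u) (mem_closure_of_posExt_pos hx)
  rw [h] at hx ⊢
  exact max_eq_left (by
    by_contra! hlt
    rw [max_eq_right hlt.le] at hx
    exact lt_irrefl _ hx)

theorem upperSemicontinuous_posExt {Ω : Set (Eu N)} {u : Eu N → ℝ}
    (hu : UpperSemicontinuousOn u (closure Ω)) : UpperSemicontinuous (posExt Ω u) := by
  intro x c hc
  have hc : posExt Ω u x < c := hc
  have hc0 : 0 < c := (posExt_nonneg Ω u x).trans_lt hc
  change ∀ᶠ y in 𝓝 x, posExt Ω u y < c
  by_cases hx : x ∈ closure Ω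
  · rw [posExt_of_mem hx] at hc
    have h1 : ∀ᶠ y in 𝓝[closure Ω] x, u y < c := hu x hx c ((le_max_left _ _).trans_lt hc)
    rw [eventually_nhdsWithin_iff] at h1
    filter_upwards [h1] with y hy
    by_cases hyΩ : y ∈ closure Ω
    · rw [posExt_of_mem hyΩ]
      exact max_lt (hy hyΩ) hc0
    · rwa [posExt, Set.indicator_of_notMem hyΩ]
  · filter_upwards [isClosed_closure.isOpen_compl.mem_nhds hx] with y hy
    rwa [posExt, Set.indicator_of_notMem hy]

theorem exists_posExt_le {Ω : Set (Eu N)} (hΩ : Bornology.IsBounded Ω) {u : Eu N → ℝ}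
    (hu : UpperSemicontinuousOn u (closure Ω)) : ∃ M > 0, ∀ x, posExt Ω u x ≤ M := by
  obtain ⟨M, hM⟩ := ((upperSemicontinuous_posExt hu).upperSemicontinuousOn
    (closure Ω)).bddAbove_of_isCompact hΩ.isCompact_closure
  refine ⟨max M 1, by positivity, fun x => ?_⟩
  by_cases hx : x ∈ closure Ω
  · exact (hM ⟨x, hx, rfl⟩).trans (le_max_left _ _)
  · rw [posExt, Set.indicator_of_notMem hx]
    positivity

/-- The quartic term converts a local contact into a maximum over the whole compact closure, as the
definition of a Dirichlet subsolution requires. -/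
theorem exists_testFun_ge {x p : Eu N} {X : Mat N} {r M : ℝ} (hr : 0 < r) (hM : 0 ≤ M) :
    ∃ K, 0 ≤ K ∧ ∀ y, r ≤ ‖y - x‖ → M ≤ testFun x p X K y := by
  obtain ⟨C, hC, hq⟩ := exists_abs_qf_le X
  refine ⟨M / r ^ 4 + ‖p‖ / r ^ 3 + C / r ^ 2, by positivity, fun y hy => ?_⟩
  set a := ‖y - x‖ with ha
  have ha0 : 0 < a := hr.trans_le hy
  have h1 := real_inner_le_norm (-p) (y - x)
  rw [inner_neg_left, norm_neg] at h1
  have h2 := (abs_le.1 (hq (y - x))).1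
  have h3 : M ≤ M / r ^ 4 * a ^ 4 := by
    rw [div_mul_eq_mul_div, le_div_iff₀ (by positivity)]
    gcongr
  have h4 : ‖p‖ * a ≤ ‖p‖ / r ^ 3 * a ^ 4 := by
    rw [div_mul_eq_mul_div, le_div_iff₀ (by positivity)]
    have : r ^ 3 ≤ a ^ 3 := by gcongr
    have := mul_le_mul_of_nonneg_left this (mul_nonneg (norm_nonneg p) ha0.le)
    linarith
  have h5 : C * a ^ 2 ≤ C / r ^ 2 * a ^ 4 := by
    rw [div_mul_eq_mul_div, le_div_iff₀ (by positivity)]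
    have : r ^ 2 ≤ a ^ 2 := by gcongr
    have := mul_le_mul_of_nonneg_left this (mul_nonneg hC (sq_nonneg a))
    linarith
  have h6 : 0 ≤ C * a ^ 2 := by positivity
  rw [testFun, ← ha]
  have e : (a ^ 2) ^ 2 = a ^ 4 := by ring
  rw [e]
  linarith

/-- Subsolutions of the Dirichlet problem satisfy the differential inequality on the superjets of
the extended positive part. -/
theorem IsDirichletSubsolution.le_of_superJet {F : Operator N} {O Ω : Set (Eu N)}
    (hF : IsContinuousOperator F O) (hΩO : closure Ω ⊆ O) (hΩ : Bornology.IsBounded Ω)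
    {u : Eu N → ℝ} (hu : UpperSemicontinuousOn u (closure Ω)) (hsub : IsDirichletSubsolution F Ω u)
    {x p : Eu N} {X : Mat N} (hx : 0 < posExt Ω u x) (hj : SuperJet (posExt Ω u) x p X) :
    F x (posExt Ω u x) p X ≤ 0 := by
  obtain ⟨M, hM, hle⟩ := exists_posExt_le hΩ hu
  have hxm := mem_closure_of_posExt_pos hx
  have hux := posExt_eq_of_pos hx
  have key : ∀ ε : ℝ, 0 < ε → F x (posExt Ω u x) p (X + ε • 1) ≤ 0 := by
    intro ε hε
    have hs : (X + ε • (1 : Mat N)).IsSymm := hj.1.add (Matrix.isSymm_one.smul _)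
    obtain ⟨r, hr, hball⟩ := Metric.eventually_nhds_iff_ball.1 (hj.2 (ε / 2) (by positivity))
    obtain ⟨K, hK, hbig⟩ := exists_testFun_ge (x := x) (p := p) (X := X + ε • 1) hr hM.le
    have hmax : IsMaxOn (fun y => u y - testFun x p (X + ε • 1) K y) (closure Ω) x := by
      intro y hy
      have huy : u y ≤ posExt Ω u y := by rw [posExt_of_mem hy]; exact le_max_left _ _
      change u y - testFun x p (X + ε • 1) K y ≤ u x - testFun x p (X + ε • 1) K x
      rw [testFun_self, ← hux]
      rcases lt_or_ge ‖y - x‖ r with h | h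
      · have h1 := hball (y - x) (by rwa [mem_ball_zero_iff])
        rw [add_sub_cancel] at h1
        have h2 : 0 ≤ K * (‖y - x‖ ^ 2) ^ 2 := by positivity
        simp only [testFun, qf_add, qf_smul, qf_one]
        linarith
      · linarith [hbig y h, hle y]
    have h1 := hsub _ (contDiff_testFun x p (X + ε • 1) K) x hxm hmax
    rw [gradient_testFun _ _ hs, hess_testFun _ _ hs, ← hux] at h1
    -- On the boundary the alternative u ≤ 0 is excluded by positivity, so the same differential
    -- inequality holds there.
    by_cases hxΩ : x ∈ Ω
    · exact h1.1 hxΩ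
    · have hfr : x ∈ frontier Ω := ⟨hxm, fun h => hxΩ (interior_subset h)⟩
      rcases min_le_iff.1 (h1.2 hfr) with h | h
      · exact absurd h (not_le.2 hx)
      · exact h
  have hlim : Tendsto (fun ε : ℝ => F x (posExt Ω u x) p (X + ε • 1)) (𝓝[>] 0)
      (𝓝 (F x (posExt Ω u x) p X)) :=
    (hF.tendsto_add_smul_one (hΩO hxm) _ p hj.1).mono_left nhdsWithin_le_nhds
  exact le_of_tendsto hlim (by filter_upwards [self_mem_nhdsWithin] with ε hε using key ε hε)

/-- The same on closed superjets. -/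
theorem IsDirichletSubsolution.le_of_closedSuperJet {F : Operator N} {O Ω : Set (Eu N)}
    (hF : IsContinuousOperator F O) (hΩO : closure Ω ⊆ O) (hΩ : Bornology.IsBounded Ω)
    {u : Eu N → ℝ} (hu : UpperSemicontinuousOn u (closure Ω)) (hsub : IsDirichletSubsolution F Ω u)
    {x p : Eu N} {X : Mat N} (hx : 0 < posExt Ω u x) (hj : ClosedSuperJet (posExt Ω u) x p X) :
    F x (posExt Ω u x) p X ≤ 0 := by
  obtain ⟨xs, ps, Xs, hjs, hxs, hus, hps, hXs⟩ := hj
  have hpos : ∀ᶠ n in atTop, 0 < posExt Ω u (xs n) := hus.eventually_const_lt hx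
  have hlim := hF.tendsto hxs hus hps hXs (hΩO (mem_closure_of_posExt_pos hx))
    (isSymm_of_tendsto hXs fun n => (hjs n).1)
    (hpos.mono fun n hn => hΩO (mem_closure_of_posExt_pos hn))
    (Eventually.of_forall fun n => (hjs n).1)
  refine le_of_tendsto hlim ?_
  filter_upwards [hpos] with n hn
  exact hsub.le_of_superJet hF hΩO hΩ hu hn (hjs n)

open Classical in
/-- The function equal to `min f M` on `K` and to `M` elsewhere. -/
def trunc (K : Set (Eu N)) (f : Eu N → ℝ) (M : ℝ) (y : Eu N) : ℝ :=
  if y ∈ K then min (f y) M else M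

theorem trunc_of_mem {K : Set (Eu N)} {f : Eu N → ℝ} {M : ℝ} {y : Eu N} (hy : y ∈ K) :
    trunc K f M y = min (f y) M := if_pos hy

theorem trunc_of_notMem {K : Set (Eu N)} {f : Eu N → ℝ} {M : ℝ} {y : Eu N} (hy : y ∉ K) :
    trunc K f M y = M := if_neg hy

theorem mem_of_trunc_lt {K : Set (Eu N)} {f : Eu N → ℝ} {M : ℝ} {y : Eu N}
    (h : trunc K f M y < M) : y ∈ K ∧ trunc K f M y = f y := by
  by_cases hy : y ∈ K
  · rw [trunc_of_mem hy] at h ⊢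
    refine ⟨hy, min_eq_left ?_⟩
    by_contra! hlt
    rw [min_eq_right hlt.le] at h
    exact lt_irrefl _ h
  · rw [trunc_of_notMem hy] at h
    exact absurd h (lt_irrefl _)

theorem le_trunc {K : Set (Eu N)} {f : Eu N → ℝ} {M c : ℝ} (hM : c ≤ M) (hf : ∀ y ∈ K, c ≤ f y)
    (y : Eu N) : c ≤ trunc K f M y := by
  by_cases hy : y ∈ K
  · rw [trunc_of_mem hy]
    exact le_min (hf y hy) hM
  · rwa [trunc_of_notMem hy]

/-- The value off the closed set K is the maximum M, so crossing the edge of K can only produce an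
upward jump. -/
theorem lowerSemicontinuous_trunc {K : Set (Eu N)} (hK : IsClosed K) {f : Eu N → ℝ} {M : ℝ}
    (hf : LowerSemicontinuousOn f K) : LowerSemicontinuous (trunc K f M) := by
  intro x c hc
  have hc : c < trunc K f M x := hc
  change ∀ᶠ y in 𝓝 x, c < trunc K f M y
  by_cases hx : x ∈ K
  · rw [trunc_of_mem hx, lt_min_iff] at hc
    have h1 : ∀ᶠ y in 𝓝[K] x, c < f y := hf x hx c hc.1
    rw [eventually_nhdsWithin_iff] at h1
    filter_upwards [h1] with y hy
    by_cases hyK : y ∈ K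
    · rw [trunc_of_mem hyK]
      exact lt_min (hy hyK) hc.2
    · rw [trunc_of_notMem hyK]
      exact hc.2
  · rw [trunc_of_notMem hx] at hc
    filter_upwards [hK.isOpen_compl.mem_nhds hx] with y hy
    rwa [trunc_of_notMem hy]

theorem SuperJet.inv_smul {φ : Eu N → ℝ} {k : ℝ} (hk : 0 < k) {x p : Eu N} {Y : Mat N}
    (h : SuperJet (fun y => -(k * φ y)) x (-p) (-Y)) :
    SuperJet (fun y => -φ y) x (-(k⁻¹ • p)) (-(k⁻¹ • Y)) := by
  have hY : Y.IsSymm := by simpa using h.1.neg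
  refine ⟨(hY.smul _).neg, fun ε hε => ?_⟩
  filter_upwards [h.2 (k * ε) (by positivity)] with v hv
  rw [qf_neg, inner_neg_left] at hv ⊢
  rw [qf_smul, inner_smul_left, conj_trivial]
  have h1 := mul_le_mul_of_nonneg_left hv (inv_pos.2 hk).le
  have e : ∀ a : ℝ, k⁻¹ * (k * a) = a := fun a => inv_mul_cancel_left₀ hk.ne' a
  have h2 : k⁻¹ * -(k * φ (x + v)) = -φ (x + v) := by rw [mul_neg, e]
  have h3 : k⁻¹ * (-(k * φ x) + -⟪p, v⟫ + -qf Y v / 2 + k * ε * ‖v‖ ^ 2)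
      = -φ x + -(k⁻¹ * ⟪p, v⟫) + -(k⁻¹ * qf Y v) / 2 + ε * ‖v‖ ^ 2 := by
    field_simp
  rw [h2, h3] at h1
  exact h1

/-- Scaled and truncated supersolutions satisfy the differential inequality on closed subjets. -/
theorem IsViscositySupersolution.le_of_closedSubJet {F : Operator N} {O U K : Set (Eu N)} {α : ℝ}
    (hF : IsContinuousOperator F O) (h_hom : IsHomogeneous F O α) (hU : IsOpen U) (hUO : U ⊆ O)
    {β k M : ℝ} {φ : Eu N → ℝ} (hφ : IsViscositySupersolution (fun x r p X => F x r p X - β) U φ)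
    (hk : 0 < k) {y p : Eu N} {Y : Mat N} (hy : y ∈ U) (hyK : K ∈ 𝓝 y)
    (hyM : trunc K (fun z => k * φ z) M y < M)
    (hj : ClosedSuperJet (fun z => -trunc K (fun z => k * φ z) M z) y (-p) (-Y)) :
    k ^ α * β ≤ F y (trunc K (fun z => k * φ z) M y) p Y := by
  obtain ⟨ys, ps, Ys, hjs, hys, hus, hps, hYs⟩ := hj
  set V := trunc K (fun z => k * φ z) M with hV
  have hVs : Tendsto (fun n => V (ys n)) atTop (𝓝 (V y)) := by simpa using hus.neg
  have hps' : Tendsto (fun n => -ps n) atTop (𝓝 p) := by simpa using hps.neg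
  have hYs' : Tendsto (fun n => -Ys n) atTop (𝓝 Y) := by simpa using hYs.neg
  have hysU : ∀ᶠ n in atTop, ys n ∈ U := hys.eventually (hU.mem_nhds hy)
  have hysK : ∀ᶠ n in atTop, ∀ᶠ z in 𝓝 (ys n), z ∈ K :=
    hys.eventually (eventually_eventually_nhds.2 hyK)
  have hysM : ∀ᶠ n in atTop, V (ys n) < M := hVs.eventually_lt_const hyM
  have hlim := hF.tendsto hys hVs hps' hYs' (hUO hy)
    (isSymm_of_tendsto hYs' fun n => (hjs n).1.neg) (hysU.mono fun n hn => hUO hn)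
    (Eventually.of_forall fun n => (hjs n).1.neg)
  -- Near y the truncation lies below kφ, with equality at the jet points. Subjets of the truncation
  -- are therefore subjets of kφ there, and homogeneity gives the factor k^α.
  refine ge_of_tendsto hlim ?_
  filter_upwards [hysU, hysK, hysM] with n hnU hnK hnM
  have hval : V (ys n) = k * φ (ys n) := (mem_of_trunc_lt hnM).2
  have hj1 : SuperJet (fun z => -(k * φ z)) (ys n) (-(-ps n)) (-(-Ys n)) := by
    rw [neg_neg, neg_neg]
    refine (hjs n).mono ?_ ?_
    · filter_upwards [hnK] with z hz
      rw [neg_le_neg_iff, hV, trunc_of_mem hz]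
      exact min_le_left _ _
    · rw [hval]
  have h1 := hφ.le_of_subJet hF hUO hnU (hj1.inv_smul hk)
  have hs : (k⁻¹ • (-Ys n)).IsSymm := (hjs n).1.neg.smul _
  have h2 := h_hom (ys n) (hUO hnU) (φ (ys n)) (k⁻¹ • (-ps n)) (k⁻¹ • (-Ys n)) hs k hk.le
  rw [smul_inv_smul₀ hk.ne', smul_inv_smul₀ hk.ne', ← hval] at h2
  rw [h2]
  exact mul_le_mul_of_nonneg_left h1 (Real.rpow_nonneg hk.le α)

/-! ### Doubling of variables and comparison in the interior. -/

/-- Existence of a global maximum point after doubling the variables. -/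
theorem exists_doubling_max {U V : Eu N → ℝ} (hU : UpperSemicontinuous U)
    (hV : LowerSemicontinuous V) {A B : Set (Eu N)} (hA : IsCompact A) (hB : IsCompact B)
    {a b e : Eu N} (ha : a ∈ A) (hb : b ∈ B) {σ : ℝ}
    (hout : ∀ x y, x ∉ A ∨ y ∉ B → U x - V y - σ / 2 * ‖x - y + e‖ ^ 2
      ≤ U a - V b - σ / 2 * ‖a - b + e‖ ^ 2) :
    ∃ x ∈ A, ∃ y ∈ B, ∀ x' y', U x' - V y' - σ / 2 * ‖x' - y' + e‖ ^ 2
      ≤ U x - V y - σ / 2 * ‖x - y + e‖ ^ 2 := by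
  have h1 : UpperSemicontinuous fun z : Eu N × Eu N => U z.1 := hU.comp continuous_fst
  have h2 : UpperSemicontinuous fun z : Eu N × Eu N => -V z.2 := by
    have : UpperSemicontinuous fun y => -V y := fun x c hc => by
      filter_upwards [hV x (-c) (by linarith)] with y hy
      linarith
    exact this.comp continuous_snd
  have h3 : Continuous fun z : Eu N × Eu N => -(σ / 2 * ‖z.1 - z.2 + e‖ ^ 2) := by fun_prop
  have h4 : UpperSemicontinuous fun z : Eu N × Eu N =>
      U z.1 - V z.2 - σ / 2 * ‖z.1 - z.2 + e‖ ^ 2 := by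
    simpa [sub_eq_add_neg] using (h1.add h2).add h3.upperSemicontinuous
  have hne : (A ×ˢ B).Nonempty := ⟨(a, b), ha, hb⟩
  obtain ⟨z, hz, hmax⟩ := (h4.upperSemicontinuousOn (A ×ˢ B)).exists_isMaxOn hne
    (hA.prod hB)
  refine ⟨z.1, hz.1, z.2, hz.2, fun x' y' => ?_⟩
  by_cases h : x' ∈ A ∧ y' ∈ B
  · exact hmax (show (x', y') ∈ A ×ˢ B from h)
  · exact (hout x' y' (by tauto)).trans (hmax (show (a, b) ∈ A ×ˢ B from ⟨ha, hb⟩))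

/-- The supersolution touches a multiple of `U` from above at a maximum point of the quotient. -/
theorem exists_max_ratio {Ω : Set (Eu N)} {U φ : Eu N → ℝ} (hU : UpperSemicontinuous U)
    (hφ : LowerSemicontinuousOn φ Ω) {c : ℝ} (hc : 0 < c) (hcφ : ∀ x ∈ Ω, c ≤ φ x)
    (hcomp : ∀ s > 0, IsCompact {x | s ≤ U x}) (hsub : ∀ x, 0 < U x → x ∈ Ω) {x₀ : Eu N}
    (hx₀ : 0 < U x₀) :
    ∃ k > 0, (∀ x ∈ Ω, U x ≤ k * φ x) ∧ ∃ z ∈ Ω, U z = k * φ z := by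
  have hφpos : ∀ x ∈ Ω, 0 < φ x := fun x hx => hc.trans_le (hcφ x hx)
  have hx₀Ω := hsub x₀ hx₀
  -- Where U < s the quotient U/φ is below U x₀/φ x₀, since φ ≥ c; so the maximum over the compact
  -- set {s ≤ U} is global.
  set s := min (U x₀) (c * (U x₀ / φ x₀)) with hs
  have hspos : 0 < s := by
    have := hφpos x₀ hx₀Ω
    positivity
  have hKsub : {x | s ≤ U x} ⊆ Ω := fun x hx => hsub x (hspos.trans_le hx)
  have husc : UpperSemicontinuousOn (fun x => U x / φ x) {x | s ≤ U x} := by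
    intro x hx a ha
    have hxs : s ≤ U x := hx
    have ha : U x / φ x < a := ha
    have hφx := hφpos x (hKsub hx)
    have ha0 : 0 < a := (div_pos (hspos.trans_le hx) hφx).trans ha
    rw [div_lt_iff₀ hφx] at ha
    have hη : 0 < (a * φ x - U x) / 2 := by linarith
    have h1 : ∀ᶠ y in 𝓝[{x | s ≤ U x}] x, U y < U x + (a * φ x - U x) / 2 :=
      (hU x _ (show U x < _ by linarith)).filter_mono nhdsWithin_le_nhds
    have h2 : ∀ᶠ y in 𝓝[{x | s ≤ U x}] x, φ x - (a * φ x - U x) / 2 / a < φ y :=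
      (hφ x (hKsub hx) _ (show _ < φ x by
        have := div_pos hη ha0
        linarith)).filter_mono (nhdsWithin_mono x hKsub)
    filter_upwards [h1, h2, self_mem_nhdsWithin] with y hy1 hy2 hy3
    rw [div_lt_iff₀ (hφpos y (hKsub hy3))]
    have h3 := mul_lt_mul_of_pos_left hy2 ha0
    have e : a * (φ x - (a * φ x - U x) / 2 / a) = a * φ x - (a * φ x - U x) / 2 := by
      field_simp
    rw [e] at h3
    linarith
  have hx₀K : x₀ ∈ {x | s ≤ U x} :=
    show s ≤ U x₀ from min_le_left _ _
  obtain ⟨z, hz, hmax⟩ := husc.exists_isMaxOn ⟨x₀, hx₀K⟩ (hcomp s hspos)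
  have hzΩ := hKsub hz
  have hφz := hφpos z hzΩ
  have hkpos : 0 < U z / φ z := div_pos (hspos.trans_le hz) hφz
  refine ⟨U z / φ z, hkpos, fun x hx => ?_, z, hzΩ, (div_mul_cancel₀ _ hφz.ne').symm⟩
  by_cases hxK : s ≤ U x
  · have h1 : U x / φ x ≤ U z / φ z := hmax hxK
    rwa [div_le_iff₀ (hφpos x hx)] at h1
  · have h1 : U x₀ / φ x₀ ≤ U z / φ z := hmax hx₀K
    have h2 : s ≤ c * (U x₀ / φ x₀) := min_le_right _ _
    have h3 : c * (U x₀ / φ x₀) ≤ φ x * (U z / φ z) :=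
      mul_le_mul (hcφ x hx) h1 (by have := hφpos x₀ hx₀Ω; positivity) (hφpos x hx).le
    linarith

/-- Comparison with a positive strict supersolution for subsolutions vanishing on the boundary. -/
theorem posExt_nonpos_of_frontier {F : Operator N} {O Ω : Set (Eu N)} {α l : ℝ} (hl : 0 < l)
    (hα : 0 < α) (hΩo : IsOpen Ω) (hΩ : Bornology.IsBounded Ω) (hΩO : closure Ω ⊆ O)
    (hF : IsContinuousOperator F O) (h_hom : IsHomogeneous F O α)
    (h_val : IsUniformlyContinuousInValue F O) (h_struct : StructureCondition F O)
    {φ : Eu N → ℝ} (hφ : LowerSemicontinuousOn φ Ω) {c : ℝ} (hc : 0 < c) (hcφ : ∀ x ∈ Ω, c ≤ φ x)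
    (hsuper : IsViscositySupersolution (shifted F α l) Ω φ) {u : Eu N → ℝ}
    (hu : UpperSemicontinuousOn u (closure Ω)) (hsub : IsDirichletSubsolution F Ω u)
    (hfr : ∀ ξ ∈ frontier Ω, u ξ ≤ 0) (x : Eu N) : posExt Ω u x ≤ 0 := by
  by_contra! hx₀
  set U := posExt Ω u with hUdef
  have hUsc : UpperSemicontinuous U := upperSemicontinuous_posExt hu
  obtain ⟨M, hM, hUM⟩ := exists_posExt_le hΩ hu
  have hΩ' : Ω ⊆ O := subset_closure.trans hΩO
  have hposΩ : ∀ x, 0 < U x → x ∈ Ω := by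
    intro x hx
    by_contra hxΩ
    have h1 : x ∈ frontier Ω :=
      ⟨mem_closure_of_posExt_pos hx, fun h => hxΩ (interior_subset h)⟩
    have h2 := hfr x h1
    rw [← posExt_eq_of_pos hx] at h2
    exact absurd h2 (not_le.2 hx)
  have hcomp : ∀ s > 0, IsCompact {x | s ≤ U x} := fun s hs =>
    hΩ.isCompact_closure.of_isClosed_subset (hUsc.isClosed_preimage s) fun x hx =>
      mem_closure_of_posExt_pos (u := u) (hs.trans_le hx)
  -- kφ is the least multiple above U and it touches U at z. The contact is what makes up for the
  -- absence of monotonicity in r.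
  obtain ⟨k, hk, hle, z, hz, hzk⟩ := exists_max_ratio hUsc hφ hc hcφ hcomp hposΩ hx₀
  have hkc : 0 < k * c := by positivity
  have hkcM : k * c ≤ M := by
    have := mul_le_mul_of_nonneg_left (hcφ z hz) hk.le
    linarith [hUM z]
  -- Doubling will give U x ≥ V y ≥ kc, which confines x to K₀; the thickening K inside Ω leaves
  -- room for y.
  set K₀ := {x | k * c ≤ U x} with hK₀
  have hK₀c : IsCompact K₀ := hcomp _ hkc
  obtain ⟨r, hr, hrΩ⟩ := hK₀c.exists_cthickening_subset_open hΩo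
    (fun x hx => hposΩ x (hkc.trans_le hx))
  set K := Metric.cthickening r K₀ with hK
  have hKc : IsCompact K := hK₀c.cthickening
  set V := trunc K (fun y => k * φ y) (M + 1) with hV
  have hVsc : LowerSemicontinuous V := by
    refine lowerSemicontinuous_trunc hKc.isClosed fun x hx a ha => ?_
    have ha : a < k * φ x := ha
    have h1 := hφ x (hrΩ hx) (a / k) (show a / k < φ x by rw [div_lt_iff₀ hk]; linarith)
    filter_upwards [h1.filter_mono (nhdsWithin_mono x hrΩ)] with y hy
    have hy : a / k < φ y := hy
    rw [div_lt_iff₀ hk] at hy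
    change a < k * φ y
    linarith
  have hVlow : ∀ y, k * c ≤ V y := le_trunc (by linarith) fun y hy =>
    mul_le_mul_of_nonneg_left (hcφ y (hrΩ hy)) hk.le
  have hUV : ∀ x, U x ≤ V x := by
    intro x
    by_cases hx : x ∈ K
    · rw [hV, trunc_of_mem hx]
      exact le_min (hle x (hrΩ hx)) (by linarith [hUM x])
    · rw [hV, trunc_of_notMem hx]
      linarith [hUM x]
  have hzK₀ : z ∈ K₀ := by
    change k * c ≤ U z
    rw [hzk]
    exact mul_le_mul_of_nonneg_left (hcφ z hz) hk.le
  have hzK : z ∈ K := Metric.self_subset_cthickening K₀ hzK₀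
  have hVz : V z = U z := by
    rw [hV, trunc_of_mem hzK, ← hzk]
    exact min_eq_left (by linarith [hUM z])
  have hzero : ∀ n : ℕ, U z - V z - ((n : ℝ) + 1) / 2 * ‖z - z + 0‖ ^ 2 = 0 := fun n => by
    simp [hVz]
  have hdoub : ∀ n : ℕ, ∃ x ∈ closure Ω, ∃ y ∈ K, ∀ x' y',
      U x' - V y' - ((n : ℝ) + 1) / 2 * ‖x' - y' + 0‖ ^ 2
        ≤ U x - V y - ((n : ℝ) + 1) / 2 * ‖x - y + 0‖ ^ 2 := fun n =>
    exists_doubling_max hUsc hVsc hΩ.isCompact_closure hKc (subset_closure hz) hzK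
      fun x y hxy => by
        have h0 : 0 ≤ ((n : ℝ) + 1) / 2 * ‖x - y + 0‖ ^ 2 := by positivity
        rw [hzero]
        rcases hxy with hx | hy
        · have : U x = 0 := Set.indicator_of_notMem hx _
          linarith [hVlow y]
        · have : V y = M + 1 := trunc_of_notMem hy
          linarith [hUM x]
  choose xs hxs ys hys hmax using hdoub
  have hd : ∀ n : ℕ, ((n : ℝ) + 1) / 2 * ‖xs n - ys n‖ ^ 2 ≤ U (xs n) - V (ys n) := by
    intro n
    have h1 := hmax n z z
    rw [hzero, add_zero] at h1
    linarith
  have hVU : ∀ n, V (ys n) ≤ U (xs n) := fun n => by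
    have : 0 ≤ ((n : ℝ) + 1) / 2 * ‖xs n - ys n‖ ^ 2 := by positivity
    linarith [hd n]
  have hxK₀ : ∀ n, xs n ∈ K₀ := fun n => (hVlow (ys n)).trans (hVU n)
  obtain ⟨xb, -, θ, hθ, hxlim⟩ := hK₀c.tendsto_subseq hxK₀
  have hn : Tendsto (fun n => (θ n : ℝ) + 1) atTop atTop :=
    tendsto_atTop_add_const_right _ _ (tendsto_natCast_atTop_atTop.comp hθ.tendsto_atTop)
  have hdist : Tendsto (fun n => ‖xs (θ n) - ys (θ n)‖) atTop (𝓝 0) := by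
    have h1 : Tendsto (fun n => 2 * M / ((θ n : ℝ) + 1)) atTop (𝓝 0) := hn.const_div_atTop _
    have h2 : Tendsto (fun n => ‖xs (θ n) - ys (θ n)‖ ^ 2) atTop (𝓝 0) := by
      refine squeeze_zero (fun n => by positivity) (fun n => ?_) h1
      rw [le_div_iff₀ (by positivity)]
      linarith [hd (θ n), hUM (xs (θ n)), hVlow (ys (θ n))]
    have h3 := h2.sqrt
    simpa using h3
  have hylim : Tendsto (fun n => ys (θ n)) atTop (𝓝 xb) := by
    have h1 := tendsto_zero_iff_norm_tendsto_zero.2 hdist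
    have h2 := (show Tendsto (fun n => xs (θ n)) atTop (𝓝 xb) from hxlim).sub h1
    simpa using h2
  -- Semicontinuity and U ≤ V bound the liminf of V y and the limsup of U x by U xb on either side;
  -- with V y ≤ U x both converge to U xb, so the penalty tends to 0.
  have hUlow : ∀ a < U xb, ∀ᶠ n in atTop, a < V (ys (θ n)) := fun a ha =>
    hylim.eventually (hVsc xb a (ha.trans_le (hUV xb)))
  have hUup : ∀ a, U xb < a → ∀ᶠ n in atTop, U (xs (θ n)) < a := fun a ha =>
    hxlim.eventually (hUsc xb a ha)
  have hUlim : Tendsto (fun n => U (xs (θ n))) atTop (𝓝 (U xb)) := tendsto_order.2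
    ⟨fun a ha => (hUlow a ha).mono fun n hn => hn.trans_le (hVU _), hUup⟩
  have hVlim : Tendsto (fun n => V (ys (θ n))) atTop (𝓝 (U xb)) := tendsto_order.2
    ⟨hUlow, fun a ha => (hUup a ha).mono fun n hn => (hVU _).trans_lt hn⟩
  obtain ⟨m, hmc, hm0, hm⟩ := h_struct M hM
  have hpen : Tendsto (fun n => ((θ n : ℝ) + 1) * ‖xs (θ n) - ys (θ n)‖ ^ 2
      + ‖xs (θ n) - ys (θ n)‖) atTop (𝓝 0) := by
    have h1 : Tendsto (fun n => 2 * (U (xs (θ n)) - V (ys (θ n)))) atTop (𝓝 0) := by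
      simpa using (hUlim.sub hVlim).const_mul 2
    have h2 : Tendsto (fun n => ((θ n : ℝ) + 1) * ‖xs (θ n) - ys (θ n)‖ ^ 2) atTop (𝓝 0) :=
      squeeze_zero (fun n => by positivity) (fun n => by linarith [hd (θ n)]) h1
    simpa using h2.add hdist
  have hmlim : Tendsto (fun n => m (((θ n : ℝ) + 1) * ‖xs (θ n) - ys (θ n)‖ ^ 2
      + ‖xs (θ n) - ys (θ n)‖)) atTop (𝓝 0) := by
    have h1 := (hmc 0 (Set.mem_Ici.2 le_rfl)).tendsto
    rw [hm0] at h1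
    exact h1.comp (tendsto_nhdsWithin_iff.2 ⟨hpen, Eventually.of_forall fun n =>
      Set.mem_Ici.2 (by positivity)⟩)
  have hβ : 0 < k ^ α * (l * c ^ α) := by positivity
  set η := k ^ α * (l * c ^ α) with hη
  -- Error budget: η/4 for each replacement of U x and V y by their common limit, and η/2 for the
  -- structure condition.
  obtain ⟨δ, hδ, hmod⟩ := h_val (U xb) (η / 4) (by positivity)
  -- The lower bound φ ≥ c replaces lφ^α by a constant, which stays away from 0 in the limit.
  have hsuper' : IsViscositySupersolution (fun x r p X => F x r p X - l * c ^ α) Ω φ := by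
    intro x hx ψ hψ hmin
    have h1 := hsuper x hx ψ hψ hmin
    have h2 : l * c ^ α ≤ l * φ x ^ α := by
      gcongr
      exact hcφ x hx
    simp only [shifted] at h1
    linarith
  obtain ⟨n, hn1, hn2, hn3, hn4⟩ := ((hdist.eventually_lt_const hr).and
    ((hmlim.eventually_lt_const (show 0 < η / 2 by positivity)).and
    ((Metric.tendsto_nhds.1 hUlim δ hδ).and (Metric.tendsto_nhds.1 hVlim δ hδ)))).exists
  rw [Real.dist_eq] at hn3 hn4
  set x := xs (θ n) with hx
  set y := ys (θ n) with hy
  set σ : ℝ := (θ n : ℝ) + 1 with hσ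
  have hσpos : 0 < σ := by positivity
  obtain ⟨X, Y, hX, hY, hblock, hjX, hjY⟩ := theorem_on_sums hUsc hVsc (M := M) hσpos hUM
    (fun y => by linarith [hVlow y]) (hmax (θ n))
  rw [add_zero] at hjX hjY
  have hxpos : 0 < U x := hkc.trans_le (hxK₀ (θ n))
  have hyK : K ∈ 𝓝 y := by
    refine Filter.mem_of_superset (Metric.isOpen_thickening.mem_nhds ?_)
      (Metric.thickening_subset_cthickening r K₀)
    refine Metric.mem_thickening_iff.2 ⟨x, hxK₀ (θ n), ?_⟩
    rwa [dist_comm, dist_eq_norm]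
  have hyΩ : y ∈ Ω := hrΩ (mem_of_mem_nhds hyK)
  have h1 : F x (U x) (σ • (x - y)) X ≤ 0 :=
    hsub.le_of_closedSuperJet hF hΩO hΩ hu hxpos hjX
  have h2 : η ≤ F y (V y) (σ • (x - y)) Y :=
    hsuper'.le_of_closedSubJet hF h_hom hΩo hΩ' hk hyΩ hyK
      (by linarith [hVU (θ n), hUM x]) hjY
  have h3 := (abs_lt.1 (hmod (U x) hn3 x (hΩ' (hposΩ x hxpos)) (σ • (x - y)) X hX)).1
  have h4 := (abs_lt.1 (hmod (V y) hn4 y (hΩ' hyΩ) (σ • (x - y)) Y hY)).2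
  have h5 := hm X Y hX hY σ hσpos hblock x (hΩ' (hposΩ x hxpos)) y (hΩ' hyΩ) (U xb)
    (by rw [abs_of_nonneg (posExt_nonneg Ω u xb)]; exact hUM xb)
  linarith

/-! ### Inward directions and boundary values in the presence of a barrier. -/

theorem nonneg_of_mem_closure {Ω W : Set (Eu N)} {g : Eu N → ℝ} (hW : IsOpen W)
    (hg : ContinuousOn g W) (hΩW : Ω ∩ W = {x ∈ W | 0 < g x}) {x : Eu N} (hx : x ∈ closure Ω)
    (hxW : x ∈ W) : 0 ≤ g x := by
  by_contra! hlt
  have h1 : ∀ᶠ y in 𝓝 x, g y < 0 ∧ y ∈ W :=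
    ((hg.continuousAt (hW.mem_nhds hxW)).eventually_lt_const hlt).and (hW.mem_nhds hxW)
  obtain ⟨y, hy, hyΩ⟩ := mem_closure_iff_nhds.1 hx _ h1
  have h2 : y ∈ {x ∈ W | 0 < g x} := hΩW ▸ ⟨hyΩ, hy.2⟩
  exact lt_asymm hy.1 h2.2

/-- At each point of its closure, a set with smooth boundary has a uniform inward direction. -/
theorem exists_inward_direction {Ω : Set (Eu N)} (hΩ : IsOpen Ω) (hs : HasSmoothBoundary Ω)
    {z : Eu N} (hz : z ∈ closure Ω) :
    ∃ n : Eu N, ‖n‖ ≤ 1 ∧ ∃ ρ > 0, ∀ x ∈ closure Ω, ‖x - z‖ < ρ → ∀ v, ‖v - n‖ < ρ →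
      ∀ ε, 0 < ε → ε < ρ → x + ε • v ∈ Ω := by
  by_cases hzΩ : z ∈ Ω
  · obtain ⟨s, hs, hball⟩ := Metric.isOpen_iff.1 hΩ z hzΩ
    -- In the interior any small displacement is admissible, so n = 0 serves.
    refine ⟨0, by simp, min 1 (s / 2), by positivity, fun x _ hx v hv ε hε hερ => hball ?_⟩
    rw [sub_zero] at hv
    rw [mem_ball_iff_norm]
    have e : x + ε • v - z = (x - z) + ε • v := by abel
    have h1 : ‖ε • v‖ ≤ ‖v‖ := by
      rw [norm_smul, Real.norm_of_nonneg hε.le]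
      exact mul_le_of_le_one_left (norm_nonneg v) (hερ.le.trans (min_le_left _ _))
    have h2 := min_le_right 1 (s / 2)
    rw [e]
    linarith [norm_add_le (x - z) (ε • v)]
  · have hfr : z ∈ frontier Ω := ⟨hz, fun h => hzΩ (interior_subset h)⟩
    obtain ⟨W, hW, hzW, g, hg, hdg, hΩW⟩ := hs z hfr
    have hgz : ContDiffAt ℝ 1 g z :=
      ((hg z hzW).contDiffAt (hW.mem_nhds hzW)).of_le (by exact_mod_cast le_top)
    have hstrict := hgz.hasStrictFDerivAt (by simp)
    set L := fderiv ℝ g z with hL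
    obtain ⟨n, hn, hLn⟩ : ∃ n : Eu N, ‖n‖ ≤ 1 ∧ 0 < L n := by
      obtain ⟨v, hv⟩ : ∃ v, L v ≠ 0 := by
        by_contra! h
        exact hdg z hzW (ContinuousLinearMap.ext h)
      obtain ⟨w, hw⟩ : ∃ w, 0 < L w := by
        rcases hv.lt_or_gt with h | h
        · exact ⟨-v, by rw [map_neg]; linarith⟩
        · exact ⟨v, h⟩
      have hw0 : w ≠ 0 := fun h => by rw [h, map_zero] at hw; exact lt_irrefl _ hw
      have hwn : 0 < ‖w‖ := norm_pos_iff.2 hw0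
      refine ⟨‖w‖⁻¹ • w, ?_, ?_⟩
      · rw [norm_smul, norm_inv, norm_norm, inv_mul_cancel₀ hwn.ne']
      · rw [map_smul, smul_eq_mul]
        positivity
    set a := L n with ha
    -- Strict differentiability makes the linearization of g uniform in the base point, so it
    -- applies at every x near z and not only at z.
    have hev : ∀ᶠ p : Eu N × Eu N in 𝓝 (z, z),
        ‖g p.1 - g p.2 - L (p.1 - p.2)‖ ≤ a / 4 * ‖p.1 - p.2‖ ∧ p.1 ∈ W ∧ p.2 ∈ W := by
      have h1 := hstrict.isLittleO.def (show 0 < a / 4 by positivity)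
      have h2 : ∀ᶠ p : Eu N × Eu N in 𝓝 (z, z), p.1 ∈ W :=
        (continuous_fst.tendsto (z, z)).eventually (hW.mem_nhds hzW)
      have h3 : ∀ᶠ p : Eu N × Eu N in 𝓝 (z, z), p.2 ∈ W :=
        (continuous_snd.tendsto (z, z)).eventually (hW.mem_nhds hzW)
      exact h1.and (h2.and h3)
    obtain ⟨s, hs, hball⟩ := Metric.eventually_nhds_iff_ball.1 hev
    have hLpos : 0 < 4 * (‖L‖ + 1) := by positivity
    refine ⟨n, hn, min (min 1 (s / 3)) (a / (4 * (‖L‖ + 1))), by positivity,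
      fun x hx hxz v hv ε hε hερ => ?_⟩
    set ρ := min (min 1 (s / 3)) (a / (4 * (‖L‖ + 1))) with hρ
    have hρ1 : ρ ≤ 1 := (min_le_left _ _).trans (min_le_left _ _)
    have hρs : ρ ≤ s / 3 := (min_le_left _ _).trans (min_le_right _ _)
    have hρa : ρ * (4 * (‖L‖ + 1)) ≤ a := by
      rw [← le_div_iff₀ hLpos]; exact min_le_right _ _
    have hv2 : ‖v‖ ≤ 2 := by
      have := norm_add_le (v - n) n
      rw [sub_add_cancel] at this
      linarith
    have hεv : ‖ε • v‖ ≤ 2 * ε := by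
      rw [norm_smul, Real.norm_of_nonneg hε.le]
      nlinarith
    have hmem : (x + ε • v, x) ∈ Metric.ball (z, z) s := by
      rw [mem_ball_iff_norm, Prod.mk_sub_mk]
      refine max_lt ?_ (by linarith)
      have e : x + ε • v - z = (x - z) + ε • v := by abel
      rw [e]
      linarith [norm_add_le (x - z) (ε • v)]
    obtain ⟨h1, h2, h3⟩ := hball _ hmem
    simp only [add_sub_cancel_left, Real.norm_eq_abs] at h1 h2 h3
    have hgx := nonneg_of_mem_closure hW hg.continuousOn hΩW hx h3
    have hLv : a - ‖L‖ * ρ ≤ L v := by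
      have h4 := (L.le_opNorm (n - v))
      rw [norm_sub_rev] at h4
      have h5 : L (n - v) ≤ ‖L‖ * ρ := by
        refine (le_abs_self _).trans (h4.trans ?_)
        gcongr
      rw [map_sub] at h5
      linarith
    have h6 := (abs_le.1 h1).1
    rw [map_smul, smul_eq_mul] at h6
    -- Of the gain εa from L n, the remainder takes εa/2 and the deviation of v from n takes εa/4;
    -- with g x ≥ 0, at least εa/4 is left.
    have h7 : a / 4 * ‖ε • v‖ ≤ ε * (a / 2) := by nlinarith
    have h8 : ε * (a - ‖L‖ * ρ) ≤ ε * L v := mul_le_mul_of_nonneg_left hLv hε.le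
    have hρpos : 0 < ρ := hε.trans hερ
    have h9 : ‖L‖ * ρ ≤ a / 4 := by nlinarith [norm_nonneg L]
    have h10 : ε * (a / 4) ≤ ε * (a / 2 - ‖L‖ * ρ) := mul_le_mul_of_nonneg_left (by linarith) hε.le
    have h11 : 0 < ε * (a / 4) := by positivity
    have hgpos : 0 < g (x + ε • v) := by linarith
    have : x + ε • v ∈ Ω ∩ W := hΩW ▸ ⟨h2, hgpos⟩
    exact this.1

/-- Uniform continuity bounds the oscillation of the operator under bounded perturbations. -/
theorem IsUniformlyContinuousNear.exists_bound {F : Operator N} {A : Set (Eu N)}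
    (h : IsUniformlyContinuousNear F A) {R : ℝ} (hR : 0 < R) {D : ℝ} (hD : 0 < D) :
    ∃ B ≥ 0, ∀ x ∈ A, ∀ r ∈ Set.Icc (0 : ℝ) R, ∀ s ∈ Set.Icc (0 : ℝ) R, ∀ p q : Eu N,
      ∀ X Y : Mat N, X.IsSymm → Y.IsSymm → ‖p - q‖ ≤ D → (∀ i j, |X i j - Y i j| ≤ D) →
        |F x r p X - F x s q Y| ≤ B := by
  obtain ⟨δ, hδ, hmod⟩ := h R hR 1 one_pos
  -- The segment joining the two arguments is cut into n pieces shorter than δ, each changing F by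
  -- less than 1.
  obtain ⟨n, hn⟩ := exists_nat_gt (max D R / δ)
  have hn0 : (0 : ℝ) < n := lt_trans (by positivity) hn
  have hn' : max D R < n * δ := by rwa [div_lt_iff₀ hδ] at hn
  refine ⟨n, hn0.le, fun x hx r hr s hs p q X Y hX hY hpq hXY => ?_⟩
  let f : ℕ → ℝ := fun i => F x (r + (i / n : ℝ) * (s - r)) (p + (i / n : ℝ) • (q - p))
    (X + (i / n : ℝ) • (Y - X))
  have hsm : ∀ b : ℝ, |b| ≤ max D R → |(1 / n : ℝ) * b| < δ := fun b hb => by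
    rw [abs_mul, abs_of_pos (by positivity), one_div, inv_mul_lt_iff₀ hn0]
    exact hb.trans_lt hn'
  have hrs : |s - r| ≤ max D R := by
    refine le_trans ?_ (le_max_right _ _)
    rw [abs_le]
    constructor <;> linarith [hr.1, hr.2, hs.1, hs.2]
  have hmemI : ∀ i : ℕ, i ≤ n → r + (i / n : ℝ) * (s - r) ∈ Set.Icc (0 : ℝ) R := by
    intro i hi
    have h1 : (0 : ℝ) ≤ i / n := by positivity
    have h2 : (i / n : ℝ) ≤ 1 := by
      rw [div_le_one hn0]; exact_mod_cast hi
    have e : r + (i / n : ℝ) * (s - r) = (1 - (i / n : ℝ)) * r + (i / n : ℝ) * s := by ring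
    rw [e]
    constructor
    · exact add_nonneg (mul_nonneg (by linarith) hr.1) (mul_nonneg h1 hs.1)
    · nlinarith [hr.2, hs.2]
  have hstep : ∀ i : ℕ, i < n → |f i - f (i + 1)| < 1 := by
    intro i hi
    have ei : (((i + 1 : ℕ) : ℝ) / n) = i / n + 1 / n := by push_cast; ring
    refine hmod x hx _ (hmemI i hi.le) _ (hmemI (i + 1) hi) _ _ _ _
      (hX.add ((hY.sub hX).smul _)) (hX.add ((hY.sub hX).smul _)) ?_ ?_ ?_
    · rw [ei, abs_sub_comm]
      convert hsm (s - r) hrs using 2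
      ring
    · rw [ei, norm_sub_rev]
      have e : p + (i / n + 1 / n : ℝ) • (q - p) - (p + (i / n : ℝ) • (q - p))
          = (1 / n : ℝ) • (q - p) := by module
      rw [e, norm_smul, Real.norm_of_nonneg (by positivity)]
      have := hsm ‖q - p‖ (by
        rw [abs_of_nonneg (norm_nonneg _), norm_sub_rev]; exact hpq.trans (le_max_left _ _))
      rwa [abs_of_nonneg (by positivity)] at this
    · intro a b
      rw [ei, abs_sub_comm]
      have := hsm (Y a b - X a b) (by rw [abs_sub_comm]; exact (hXY a b).trans (le_max_left _ _))
      convert this using 2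
      simp only [Matrix.add_apply, Matrix.smul_apply, Matrix.sub_apply, smul_eq_mul]
      ring
  have hind : ∀ i : ℕ, i ≤ n → |f 0 - f i| ≤ i := by
    intro i
    induction i with
    | zero => intro _; simp
    | succ i ih =>
      intro hi
      have h1 := ih (by omega)
      have h2 := hstep i (by omega)
      have h3 := abs_sub_le (f 0) (f i) (f (i + 1))
      push_cast
      linarith
  have h0 : f 0 = F x r p X := by simp [f]
  have h1 : f n = F x s q Y := by simp [f, div_self hn0.ne']
  rw [← h0, ← h1]
  exact hind n le_rfl

theorem SuperJet.add_sq {u : Eu N → ℝ} {a : ℝ} {ξ x p : Eu N} {X : Mat N}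
    (h : SuperJet (fun z => u z - a * ‖z - ξ‖ ^ 2) x p X) :
    SuperJet u x (p + (2 * a) • (x - ξ)) (X + (2 * a) • 1) := by
  refine ⟨h.1.add (Matrix.isSymm_one.smul _), fun ε hε => ?_⟩
  filter_upwards [h.2 ε hε] with k hk
  have e : x + k - ξ = (x - ξ) + k := by abel
  rw [e, norm_add_sq_real] at hk
  rw [inner_add_left, inner_smul_left, conj_trivial, qf_add, qf_smul, qf_one]
  linarith

theorem ClosedSuperJet.add_sq {u : Eu N → ℝ} {a : ℝ} {ξ x p : Eu N} {X : Mat N}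
    (h : ClosedSuperJet (fun z => u z - a * ‖z - ξ‖ ^ 2) x p X) :
    ClosedSuperJet u x (p + (2 * a) • (x - ξ)) (X + (2 * a) • 1) := by
  obtain ⟨xs, ps, Xs, hj, hx, hu, hp, hX⟩ := h
  refine ⟨xs, fun n => ps n + (2 * a) • (xs n - ξ), fun n => Xs n + (2 * a) • 1,
    fun n => (hj n).add_sq, hx, ?_, hp.add ((hx.sub_const ξ).const_smul _), hX.add_const _⟩
  have hc : Continuous fun z : Eu N => a * ‖z - ξ‖ ^ 2 := by fun_prop
  have := hu.add ((hc.tendsto x).comp hx)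
  simpa using this

/-- The doubling of variables near a boundary point, shifted along an inward direction: the second
maximum point falls inside the domain. -/
theorem exists_shifted_doubling {Ω : Set (Eu N)} (hΩo : IsOpen Ω) (hΩ : Bornology.IsBounded Ω)
    (hs : HasSmoothBoundary Ω) {U w : Eu N → ℝ} (hU : UpperSemicontinuous U) {M : ℝ} (hM : 0 < M)
    (hUM : ∀ x, U x ≤ M) (hU0 : ∀ x, x ∉ closure Ω → U x = 0)
    {ξ : Eu N} (hξ : ξ ∈ closure Ω) (hUξ : 0 < U ξ) {ρ : ℝ} (hρ : 0 < ρ)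
    (hw : ContinuousOn w (closure Ω ∩ Metric.closedBall ξ (3 * ρ / 4)))
    (hw0 : ∀ x ∈ closure Ω ∩ Metric.closedBall ξ (3 * ρ / 4), 0 ≤ w x) (hwξ : w ξ = 0)
    {C s k : ℝ} (hC : C * (ρ / 2) ^ 2 = M + 1) (hs0 : 0 ≤ s) (hs2 : s ^ 2 = 2 * M) (hk : 0 < k) :
    ∃ z ∈ closure Ω, ‖z - ξ‖ < ρ / 2 ∧ ∃ n : Eu N, ‖n‖ ≤ 1 ∧ ∃ ε > 0, ∃ x ∈ closure Ω, ∃ y ∈ Ω,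
      (∀ x' y', U x' - C * ‖x' - ξ‖ ^ 2 - 1 * ‖x' - z‖ ^ 2
          - trunc (closure Ω ∩ Metric.closedBall ξ (3 * ρ / 4)) (fun y => k * w y) (M + 1) y'
          - 1 / ε ^ 2 / 2 * ‖x' - y' + ε • n‖ ^ 2
        ≤ U x - C * ‖x - ξ‖ ^ 2 - 1 * ‖x - z‖ ^ 2
          - trunc (closure Ω ∩ Metric.closedBall ξ (3 * ρ / 4)) (fun y => k * w y) (M + 1) y
          - 1 / ε ^ 2 / 2 * ‖x - y + ε • n‖ ^ 2) ∧
      trunc (closure Ω ∩ Metric.closedBall ξ (3 * ρ / 4)) (fun y => k * w y) (M + 1) y < U x ∧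
      ‖x - ξ‖ < ρ / 2 ∧ ‖y - ξ‖ < 3 * ρ / 4 ∧ ‖x - y‖ ≤ ε * (s + 1) ∧
      ‖x - y + ε • n‖ ≤ ε * s := by
  have hCpos : 0 < C := by
    by_contra! h
    nlinarith [mul_nonneg (neg_nonneg.2 h) (sq_nonneg (ρ / 2))]
  set D₀ := closure Ω ∩ Metric.closedBall ξ (3 * ρ / 4) with hD₀
  set D₁ := closure Ω ∩ Metric.closedBall ξ (ρ / 2) with hD₁
  have hD₀c : IsCompact D₀ := hΩ.isCompact_closure.inter_right Metric.isClosed_closedBall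
  have hD₁c : IsCompact D₁ := hΩ.isCompact_closure.inter_right Metric.isClosed_closedBall
  have hD₁₀ : D₁ ⊆ D₀ := Set.inter_subset_inter_right _
    (Metric.closedBall_subset_closedBall (by linarith))
  set V := trunc D₀ (fun y => k * w y) (M + 1) with hV
  have hVsc : LowerSemicontinuous V := lowerSemicontinuous_trunc hD₀c.isClosed
    (continuousOn_const.mul hw).lowerSemicontinuousOn
  have hV0 : ∀ y, 0 ≤ V y := le_trunc (by linarith) fun y hy => mul_nonneg hk.le (hw0 y hy)
  have hfsc : UpperSemicontinuousOn (fun x => U x + (-(k * w x) - C * ‖x - ξ‖ ^ 2)) D₁ := by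
    refine (hU.upperSemicontinuousOn D₁).add (ContinuousOn.upperSemicontinuousOn ?_)
    exact ((continuousOn_const.mul (hw.mono hD₁₀)).neg).sub (Continuous.continuousOn (by fun_prop))
  have hξD₁ : ξ ∈ D₁ := ⟨hξ, Metric.mem_closedBall_self (by positivity)⟩
  -- The undoubled problem. Its maximum m is at least U ξ > 0 because w ξ = 0, and C (ρ/2)² > M
  -- keeps z in the open ball.
  obtain ⟨z, hz, hzmax⟩ := hfsc.exists_isMaxOn ⟨ξ, hξD₁⟩ hD₁c
  set m := U z + (-(k * w z) - C * ‖z - ξ‖ ^ 2) with hm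
  have hmpos : 0 < m := by
    have h1 : U ξ + (-(k * w ξ) - C * ‖ξ - ξ‖ ^ 2) ≤ m := hzmax hξD₁
    rw [hwξ, sub_self, norm_zero] at h1
    linarith
  have hclose : ∀ x, C * ‖x - ξ‖ ^ 2 < M → ‖x - ξ‖ < ρ / 2 := by
    intro x hx
    have h1 : C * ‖x - ξ‖ ^ 2 < C * (ρ / 2) ^ 2 := by linarith
    exact lt_of_pow_lt_pow_left₀ 2 (by positivity) (lt_of_mul_lt_mul_left h1 hCpos.le)
  have hzξ : ‖z - ξ‖ < ρ / 2 := hclose z (by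
    have := mul_nonneg hk.le (hw0 z (hD₁₀ hz))
    linarith [hUM z])
  obtain ⟨n, hn, ρ₂, hρ₂, hin⟩ := exists_inward_direction hΩo hs hz.1
  -- κ is the oscillation allowed for w: it is used twice against ρ₂²/2 to localize, and once
  -- against m to keep the doubled maximum positive.
  obtain ⟨κ, hκ, hκ1, hκ2⟩ : ∃ κ > 0, 2 * (k * κ) < ρ₂ ^ 2 / 2 ∧ k * κ < m := by
    refine ⟨min (ρ₂ ^ 2 / (8 * k)) (m / (2 * k)), by positivity, ?_, ?_⟩
    · have h1 : k * min (ρ₂ ^ 2 / (8 * k)) (m / (2 * k)) ≤ k * (ρ₂ ^ 2 / (8 * k)) := by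
        gcongr; exact min_le_left _ _
      have e : k * (ρ₂ ^ 2 / (8 * k)) = ρ₂ ^ 2 / 8 := by field_simp
      have : 0 < ρ₂ ^ 2 := by positivity
      linarith
    · have h1 : k * min (ρ₂ ^ 2 / (8 * k)) (m / (2 * k)) ≤ k * (m / (2 * k)) := by
        gcongr; exact min_le_right _ _
      have e : k * (m / (2 * k)) = m / 2 := by field_simp
      linarith
  obtain ⟨τ, hτ, hmod⟩ := Metric.uniformContinuousOn_iff.1
    (hD₀c.uniformContinuousOn_of_continuous hw) κ hκ
  have hs1 : 0 < s + 1 := by linarith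
  obtain ⟨ε, hε, hε1, hε2, hε3⟩ : ∃ ε > 0, ε < ρ₂ ∧ ε * (s + 1) < τ ∧ ε * (s + 1) < ρ / 4 := by
    refine ⟨min (ρ₂ / 2) (min (τ / (2 * (s + 1))) (ρ / (8 * (s + 1)))), by positivity, ?_, ?_, ?_⟩
    · linarith [min_le_left (ρ₂ / 2) (min (τ / (2 * (s + 1))) (ρ / (8 * (s + 1))))]
    · have h1 : min (ρ₂ / 2) (min (τ / (2 * (s + 1))) (ρ / (8 * (s + 1)))) ≤ τ / (2 * (s + 1)) :=
        (min_le_right _ _).trans (min_le_left _ _)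
      rw [le_div_iff₀ (by positivity)] at h1
      linarith
    · have h1 : min (ρ₂ / 2) (min (τ / (2 * (s + 1))) (ρ / (8 * (s + 1)))) ≤ ρ / (8 * (s + 1)) :=
        (min_le_right _ _).trans (min_le_right _ _)
      rw [le_div_iff₀ (by positivity)] at h1
      linarith
  have hεs : 0 ≤ ε * s := by positivity
  have hεn : ‖ε • n‖ ≤ ε := by
    rw [norm_smul, Real.norm_of_nonneg hε.le]
    exact mul_le_of_le_one_right hε.le hn
  -- The competitor (z, b) makes the shifted penalty vanish exactly, and b lies in Ω.
  set b := z + ε • n with hb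
  have hbz : ‖b - z‖ ≤ ε := by rw [hb, add_sub_cancel_left]; exact hεn
  have hbΩ : b ∈ Ω := hin z hz.1 (by simpa using hρ₂) n (by simpa using hρ₂) ε hε hε1
  have hbD₀ : b ∈ D₀ := by
    refine ⟨subset_closure hbΩ, ?_⟩
    rw [mem_closedBall_iff_norm]
    have e : b - ξ = (b - z) + (z - ξ) := by abel
    rw [e]
    linarith [norm_add_le (b - z) (z - ξ)]
  have hVb : V b ≤ k * w b := by
    rw [hV, trunc_of_mem hbD₀]; exact min_le_left _ _
  have hwb : k * w b ≤ k * w z + k * κ := by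
    have h1 := hmod b hbD₀ z (hD₁₀ hz) (by rw [dist_eq_norm]; linarith)
    rw [Real.dist_eq] at h1
    rw [← mul_add]
    exact mul_le_mul_of_nonneg_left (by linarith [(abs_lt.1 h1).2]) hk.le
  have hUt : UpperSemicontinuous fun x => U x - C * ‖x - ξ‖ ^ 2 - 1 * ‖x - z‖ ^ 2 := by
    have h1 : Continuous fun x : Eu N => -(C * ‖x - ξ‖ ^ 2) - 1 * ‖x - z‖ ^ 2 := by fun_prop
    have h2 := hU.add h1.upperSemicontinuous
    refine fun x c hc => ?_
    have := h2 x c (by change U x + _ < c; change U x - _ - _ < c at hc; linarith)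
    filter_upwards [this] with y hy
    linarith
  have hval : m - k * κ ≤ U z - C * ‖z - ξ‖ ^ 2 - 1 * ‖z - z‖ ^ 2 - V b
      - 1 / ε ^ 2 / 2 * ‖z - b + ε • n‖ ^ 2 := by
    have e : z - b + ε • n = 0 := by rw [hb]; abel
    rw [e, sub_self, norm_zero]
    simp only [ne_eq, OfNat.ofNat_ne_zero, not_false_eq_true, zero_pow, mul_zero, sub_zero]
    linarith
  obtain ⟨x, hx, y, hy, hmax⟩ := exists_doubling_max (e := ε • n) (σ := 1 / ε ^ 2) hUt hVsc
    hΩ.isCompact_closure hD₀c hz.1 hbD₀ fun x y hxy => by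
      refine le_trans ?_ ((show (0 : ℝ) ≤ m - k * κ by linarith).trans hval)
      have h0 : 0 ≤ 1 / ε ^ 2 / 2 * ‖x - y + ε • n‖ ^ 2 := by positivity
      have h1 : 0 ≤ C * ‖x - ξ‖ ^ 2 := by positivity
      have h2 : 0 ≤ 1 * ‖x - z‖ ^ 2 := by positivity
      rcases hxy with hx | hy
      · rw [hU0 x hx]
        linarith [hV0 y]
      · have : V y = M + 1 := trunc_of_notMem hy
        linarith [hUM x]
  have hge := hval.trans (hmax z b)
  have hp0 : 0 ≤ 1 / ε ^ 2 / 2 * ‖x - y + ε • n‖ ^ 2 := by positivity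
  have hp1 : 0 ≤ C * ‖x - ξ‖ ^ 2 := by positivity
  have hp2 : 0 ≤ 1 * ‖x - z‖ ^ 2 := by positivity
  have hxξ : ‖x - ξ‖ < ρ / 2 := hclose x (by linarith [hUM x, hV0 y])
  have hpen : ‖x - y + ε • n‖ ≤ ε * s := by
    have h1 : 1 / ε ^ 2 / 2 * ‖x - y + ε • n‖ ^ 2 ≤ M := by linarith [hUM x, hV0 y]
    have e : 1 / ε ^ 2 / 2 * ‖x - y + ε • n‖ ^ 2 = ‖x - y + ε • n‖ ^ 2 / (2 * ε ^ 2) := by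
      field_simp
    rw [e, div_le_iff₀ (by positivity)] at h1
    have h2 : ‖x - y + ε • n‖ ^ 2 ≤ (ε * s) ^ 2 := by rw [mul_pow, hs2]; linarith
    exact le_of_sq_le_sq h2 hεs
  have hxy : ‖x - y‖ ≤ ε * (s + 1) := by
    have e : x - y = (x - y + ε • n) - ε • n := by abel
    rw [e]
    linarith [norm_sub_le (x - y + ε • n) (ε • n)]
  have hVy : V y < U x := by linarith
  have hVyk : V y = k * w y := (mem_of_trunc_lt (show V y < M + 1 by linarith [hUM x])).2
  have hxD₁ : x ∈ D₁ := ⟨hx, by rw [mem_closedBall_iff_norm]; exact hxξ.le⟩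
  have hyξ : ‖y - ξ‖ < 3 * ρ / 4 := by
    have e : y - ξ = (x - ξ) - (x - y) := by abel
    rw [e]
    linarith [norm_sub_le (x - ξ) (x - y)]
  have hfx : U x + (-(k * w x) - C * ‖x - ξ‖ ^ 2) ≤ m := hzmax hxD₁
  have hwxy : k * w x ≤ k * w y + k * κ := by
    have h1 := hmod x (hD₁₀ hxD₁) y hy (by rw [dist_eq_norm]; linarith)
    rw [Real.dist_eq] at h1
    rw [← mul_add]
    exact mul_le_mul_of_nonneg_left (by linarith [(abs_lt.1 h1).2]) hk.le
  -- Comparison with (z, b), maximality of m at x, and the two oscillation bounds for w.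
  have hsum : ‖x - z‖ ^ 2 + 1 / ε ^ 2 / 2 * ‖x - y + ε • n‖ ^ 2 < ρ₂ ^ 2 / 2 := by linarith
  have hxz : ‖x - z‖ < ρ₂ := by
    refine lt_of_pow_lt_pow_left₀ 2 hρ₂.le ?_
    have : 0 < ρ₂ ^ 2 := by positivity
    linarith
  -- With weight 1/ε² the penalty is half the squared distance from (y − x)/ε to n, so y is reached
  -- from x by an inward displacement.
  have hvn : ‖ε⁻¹ • (y - x) - n‖ < ρ₂ := by
    refine lt_of_pow_lt_pow_left₀ 2 hρ₂.le ?_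
    have e : ε⁻¹ • (y - x) - n = (-ε⁻¹) • (x - y + ε • n) := by
      rw [smul_add, smul_smul, neg_mul, inv_mul_cancel₀ hε.ne']
      module
    have e2 : 1 / ε ^ 2 / 2 * ‖x - y + ε • n‖ ^ 2 = ‖ε⁻¹ • (y - x) - n‖ ^ 2 / 2 := by
      rw [e, norm_smul, norm_neg, mul_pow, Real.norm_eq_abs, sq_abs]
      field_simp
    have : 0 ≤ ‖x - z‖ ^ 2 := by positivity
    linarith
  have hyΩ : y ∈ Ω := by
    have h1 := hin x hx hxz _ hvn ε hε hε1
    rwa [smul_inv_smul₀ hε.ne', add_sub_cancel] at h1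
  exact ⟨z, hz.1, hzξ, n, hn, ε, hε, x, hx, y, hyΩ, hmax, hVy, hxξ, hyξ, hxy, hpen⟩

/-- In the presence of a barrier, subsolutions take the boundary value in the classical sense. -/
theorem IsDirichletSubsolution.nonpos_of_barrier {F : Operator N} {O Ω A : Set (Eu N)} {α : ℝ}
    (hα : 0 < α) (hΩo : IsOpen Ω) (hΩ : Bornology.IsBounded Ω) (hs : HasSmoothBoundary Ω)
    (hΩO : closure Ω ⊆ O) (hA : IsOpen A) (hF : IsContinuousOperator F O)
    (h_hom : IsHomogeneous F O α) (h_unif : IsUniformlyContinuousNear F (closure Ω ∩ A))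
    (h_bdry : BoundaryStructureCondition F (closure Ω ∩ A)) {u : Eu N → ℝ}
    (hu : UpperSemicontinuousOn u (closure Ω)) (hsub : IsDirichletSubsolution F Ω u) {ξ : Eu N}
    (hξ : ξ ∈ frontier Ω) (hξA : ξ ∈ A) {ρ₀ β : ℝ} (hρ₀ : 0 < ρ₀) (hβ : 0 < β) {w : Eu N → ℝ}
    (hw : ContinuousOn w (closure (Ω ∩ Metric.ball ξ ρ₀)))
    (hw0 : ∀ x ∈ closure (Ω ∩ Metric.ball ξ ρ₀), 0 ≤ w x) (hwξ : w ξ = 0)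
    (hsuper : IsViscositySupersolution (fun x r p X => F x r p X - β)
      (Ω ∩ Metric.ball ξ ρ₀) w) : u ξ ≤ 0 := by
  by_contra! hpos
  have hξc : ξ ∈ closure Ω := hξ.1
  set U := posExt Ω u with hUdef
  have hUξ : 0 < U ξ := by
    rw [hUdef, posExt_of_mem hξc]
    exact lt_max_of_lt_left hpos
  have hUsc : UpperSemicontinuous U := upperSemicontinuous_posExt hu
  obtain ⟨M, hM, hUM⟩ := exists_posExt_le hΩ hu
  obtain ⟨ρ₁, hρ₁, hballA⟩ := Metric.isOpen_iff.1 hA ξ hξA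
  obtain ⟨ρ, hρ, hρ0, hρ1⟩ : ∃ ρ > 0, ρ ≤ ρ₀ ∧ ρ ≤ ρ₁ :=
    ⟨min ρ₀ ρ₁, by positivity, min_le_left _ _, min_le_right _ _⟩
  have hD : closure Ω ∩ Metric.closedBall ξ (3 * ρ / 4) ⊆ closure (Ω ∩ Metric.ball ξ ρ₀) := by
    rintro x ⟨hx, hxb⟩
    have hxb' : x ∈ Metric.ball ξ ρ₀ := Metric.closedBall_subset_ball (by linarith) hxb
    rw [Set.inter_comm]
    exact Metric.isOpen_ball.inter_closure ⟨hxb', hx⟩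
  obtain ⟨K, hK, hKb⟩ := h_bdry M hM
  set C := (M + 1) / (ρ / 2) ^ 2 with hCdef
  have hC : C * (ρ / 2) ^ 2 = M + 1 := div_mul_cancel₀ _ (by positivity)
  have hCpos : 0 < C := by positivity
  obtain ⟨B, hB, hBb⟩ := h_unif.exists_bound hM (show 0 < (2 * C + 2) * (ρ + 1) by positivity)
  set s := Real.sqrt (2 * M) with hsdef
  have hs0 : 0 ≤ s := Real.sqrt_nonneg _
  have hs2 : s ^ 2 = 2 * M := Real.sq_sqrt (by positivity)
  -- T bounds the gap between the operator values at the two doubled points, independently of ε and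
  -- k. Then k is chosen with k^α β > T, before ε.
  set T := 2 * B + K * (1 + (s + 1) * s + 3 * (s + 1) ^ 2) with hT
  have hTpos : 0 < T := by positivity
  obtain ⟨k, hk, hkT⟩ : ∃ k : ℝ, 0 < k ∧ T < k ^ α * β := by
    refine ⟨((T + 1) / β) ^ (1 / α), by positivity, ?_⟩
    rw [← Real.rpow_mul (by positivity), one_div, inv_mul_cancel₀ hα.ne', Real.rpow_one,
      div_mul_cancel₀ _ hβ.ne']
    linarith
  obtain ⟨z, hz, hzξ, n, hn, ε, hε, x, hx, y, hy, hmax, hVU, hxξ, hyξ, hxy, hpen⟩ :=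
    exists_shifted_doubling hΩo hΩ hs hUsc hM hUM (fun x hx => Set.indicator_of_notMem hx _) hξc hUξ
      hρ (hw.mono hD) (fun x hx => hw0 x (hD hx)) hwξ hC hs0 hs2 hk
  set D₀ := closure Ω ∩ Metric.closedBall ξ (3 * ρ / 4) with hD₀
  have hD₀c : IsClosed D₀ := isClosed_closure.inter Metric.isClosed_closedBall
  set V := trunc D₀ (fun y => k * w y) (M + 1) with hV
  have hVsc : LowerSemicontinuous V := lowerSemicontinuous_trunc hD₀c
    (continuousOn_const.mul (hw.mono hD)).lowerSemicontinuousOn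
  have hV0 : ∀ y, 0 ≤ V y := le_trunc (by linarith) fun y hy => mul_nonneg hk.le (hw0 y (hD hy))
  have hUt : UpperSemicontinuous fun x => U x - C * ‖x - ξ‖ ^ 2 - 1 * ‖x - z‖ ^ 2 := by
    have h1 : Continuous fun x : Eu N => -(C * ‖x - ξ‖ ^ 2) - 1 * ‖x - z‖ ^ 2 := by fun_prop
    have h2 := hUsc.add h1.upperSemicontinuous
    refine fun x c hc => ?_
    have := h2 x c (by change U x + _ < c; change U x - _ - _ < c at hc; linarith)
    filter_upwards [this] with y hy
    linarith
  have hσ : 0 < 1 / ε ^ 2 := by positivity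
  obtain ⟨X, Y, hX, hY, hblock, hjX, hjY⟩ := theorem_on_sums hUt hVsc (M := M) hσ
    (fun x => by
      have h1 : 0 ≤ C * ‖x - ξ‖ ^ 2 := by positivity
      have h2 : 0 ≤ 1 * ‖x - z‖ ^ 2 := by positivity
      linarith [hUM x]) (fun y => by linarith [hV0 y]) hmax
  set p := (1 / ε ^ 2) • (x - y + ε • n) with hp
  -- The two localizing squares are restored, giving a jet of U itself; their derivatives are
  -- bounded independently of ε and cost at most B.
  have hjX' := hjX.add_sq.add_sq
  have hUx : 0 < U x := (hV0 y).trans_lt hVU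
  have hxA : x ∈ closure Ω ∩ A := ⟨hx, hballA (by rw [mem_ball_iff_norm]; linarith)⟩
  have hyA : y ∈ closure Ω ∩ A :=
    ⟨subset_closure hy, hballA (by rw [mem_ball_iff_norm]; linarith)⟩
  have h1 : F x (U x) (p + (2 * 1 : ℝ) • (x - z) + (2 * C) • (x - ξ))
      (X + (2 * 1 : ℝ) • 1 + (2 * C) • 1) ≤ 0 :=
    hsub.le_of_closedSuperJet hF hΩO hΩ hu hUx hjX'
  have hyD₀ : D₀ ∈ 𝓝 y := by
    filter_upwards [hΩo.mem_nhds hy, Metric.isOpen_ball.mem_nhds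
      (show y ∈ Metric.ball ξ (3 * ρ / 4) by rwa [mem_ball_iff_norm])] with y' h1 h2
    exact ⟨subset_closure h1, Metric.ball_subset_closedBall h2⟩
  have h2 : k ^ α * β ≤ F y (V y) p Y :=
    hsuper.le_of_closedSubJet hF h_hom (hΩo.inter Metric.isOpen_ball)
      (Set.inter_subset_left.trans (subset_closure.trans hΩO)) hk
      ⟨hy, by rw [mem_ball_iff_norm]; linarith⟩ hyD₀ (by linarith [hUM x]) hjY
  have hUxI : U x ∈ Set.Icc 0 M := ⟨hUx.le, hUM x⟩
  have hVyI : V y ∈ Set.Icc 0 M := ⟨hV0 y, by linarith [hUM x]⟩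
  have hDpos : 0 ≤ (2 * C + 2) * (ρ + 1) := by positivity
  have h3 := hBb x hxA (U x) hUxI (U x) hUxI _ p (X + (2 * 1 : ℝ) • 1 + (2 * C) • 1) X
    ((hX.add (Matrix.isSymm_one.smul (2 * 1 : ℝ))).add (Matrix.isSymm_one.smul (2 * C))) hX
    (show ‖p + (2 * 1 : ℝ) • (x - z) + (2 * C) • (x - ξ) - p‖ ≤ _ by
      have e : p + (2 * 1 : ℝ) • (x - z) + (2 * C) • (x - ξ) - p
          = (2 : ℝ) • (x - z) + (2 * C) • (x - ξ) := by rw [mul_one]; abel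
      have hxz : ‖x - z‖ ≤ ρ := by
        have e : x - z = (x - ξ) - (z - ξ) := by abel
        rw [e]
        linarith [norm_sub_le (x - ξ) (z - ξ)]
      rw [e]
      refine (norm_add_le _ _).trans ?_
      rw [norm_smul, norm_smul, Real.norm_of_nonneg zero_le_two,
        Real.norm_of_nonneg (by positivity)]
      nlinarith [mul_le_mul_of_nonneg_left hxξ.le hCpos.le])
    (fun i j => by
      simp only [Matrix.add_apply, Matrix.smul_apply, smul_eq_mul]
      have e : X i j + 2 * 1 * (1 : Mat N) i j + 2 * C * (1 : Mat N) i j - X i j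
          = (2 * C + 2) * (1 : Mat N) i j := by ring
      rw [e, abs_mul, abs_of_pos (by positivity)]
      have h1 : |(1 : Mat N) i j| ≤ ρ + 1 := by
        by_cases hij : i = j
        · subst hij; rw [Matrix.one_apply_eq, abs_one]; linarith
        · rw [Matrix.one_apply_ne hij, abs_zero]; linarith
      gcongr)
  have h4 := hBb y hyA (V y) hVyI (U x) hUxI p p Y Y hY hY
    (by rwa [sub_self, norm_zero]) (fun i j => by rwa [sub_self, abs_zero])
  have h5 := hKb X Y hX hY (3 * (1 / ε ^ 2)) (by positivity) hblock x hxA y hyA (U x)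
    (by rw [abs_of_pos hUx]; exact hUM x) p
  -- The powers of ε cancel: ‖x − y‖ = O(ε) and ‖p‖ = O(1/ε).
  have h6 : ‖x - y‖ * ‖p‖ ≤ (s + 1) * s := by
    have e : ‖p‖ = 1 / ε ^ 2 * ‖x - y + ε • n‖ := by
      rw [hp, norm_smul, Real.norm_of_nonneg hσ.le]
    have h7 : ‖x - y‖ * ‖x - y + ε • n‖ ≤ (ε * (s + 1)) * (ε * s) := by gcongr
    have h8 := mul_le_mul_of_nonneg_left h7 hσ.le
    have e2 : 1 / ε ^ 2 * ((ε * (s + 1)) * (ε * s)) = (s + 1) * s := by field_simp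
    rw [e2] at h8
    rw [e]
    linarith
  have h7 : 3 * (1 / ε ^ 2) * ‖x - y‖ ^ 2 ≤ 3 * (s + 1) ^ 2 := by
    have h8 : ‖x - y‖ ^ 2 ≤ (ε * (s + 1)) ^ 2 := by gcongr
    have h9 := mul_le_mul_of_nonneg_left h8 (show 0 ≤ 3 * (1 / ε ^ 2) by positivity)
    have e2 : 3 * (1 / ε ^ 2) * (ε * (s + 1)) ^ 2 = 3 * (s + 1) ^ 2 := by field_simp
    rwa [e2] at h9
  have h8 : K * (1 + ‖x - y‖ * ‖p‖ + 3 * (1 / ε ^ 2) * ‖x - y‖ ^ 2)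
      ≤ K * (1 + (s + 1) * s + 3 * (s + 1) ^ 2) := by gcongr
  have h9 := (abs_le.1 h3).1
  have h10 := (abs_le.1 h4).2
  linarith

/-! ### Half-relaxed limits of families of subsolutions. -/

theorem continuous_testFun (x p : Eu N) (X : Mat N) (K : ℝ) : Continuous (testFun x p X K) :=
  (contDiff_testFun x p X K).continuous

theorem continuous_toEuclideanLin (X : Mat N) : Continuous X.toEuclideanLin :=
  LinearMap.continuous_of_finiteDimensional _

/-- The jets of a quadratic function. -/
theorem hasJet_quadratic (x y p : Eu N) {X : Mat N} (hX : X.IsSymm) (c : ℝ) :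
    HasJet (fun z => c + testFun x p X 0 z) y (p + X.toEuclideanLin (y - x)) X := by
  refine ⟨hX, fun ε hε => Eventually.of_forall fun h => ?_⟩
  have e : y + h - x = (y - x) + h := by abel
  have e2 : c + testFun x p X 0 (y + h) - (c + testFun x p X 0 y)
      - ⟪p + X.toEuclideanLin (y - x), h⟫ - qf X h / 2 = 0 := by
    simp only [testFun, e, qf_add_vec hX, inner_add_left, inner_add_right]
    ring
  rw [e2, abs_zero]
  positivity

/-- `F[v] ≤ ε` in the viscosity sense where `v > 0`. -/
def IsPositivePartSubsolution (F : Operator N) (ε : ℝ) (v : Eu N → ℝ) : Prop :=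
  ∀ x, 0 < v x → ∀ p X, SuperJet v x p X → F x (v x) p X ≤ ε

/-- Stability of subsolutions under half-relaxed limits. -/
theorem le_of_superJet_of_limit {F : Operator N} {O : Set (Eu N)} (hO : IsOpen O)
    (hF : IsContinuousOperator F O) {v : ℕ → Eu N → ℝ} {ε : ℕ → ℝ} {ε₀ : ℝ}
    (hv : ∀ m, UpperSemicontinuous (v m)) (hsub : ∀ m, IsPositivePartSubsolution F (ε m) (v m))
    (hε : Tendsto ε atTop (𝓝 ε₀)) {u : Eu N → ℝ}
    (hlim : ∀ y c, u y < c → ∀ᶠ q : ℕ × Eu N in atTop ×ˢ 𝓝 y, v q.1 q.2 < c)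
    {x : Eu N} (hxO : x ∈ O) {z : ℕ → Eu N} (hz : Tendsto z atTop (𝓝 x))
    (hvz : Tendsto (fun m => v m (z m)) atTop (𝓝 (u x))) (hux : 0 < u x) {p : Eu N} {X : Mat N}
    (hj : SuperJet u x p X) : F x (u x) p X ≤ ε₀ := by
  -- Raising the Hessian by η makes x a strict maximum of u − Q, with gap η/4 ‖y − x‖².
  have key : ∀ η : ℝ, 0 < η → F x (u x) p (X + η • 1) ≤ ε₀ := by
    intro η hη
    set Y := X + η • (1 : Mat N) with hY
    have hYs : Y.IsSymm := hj.1.add (Matrix.isSymm_one.smul _)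
    set Q := testFun x p Y 0 with hQ
    have hQc : Continuous Q := continuous_testFun _ _ _ _
    have hQx : Q x = 0 := testFun_self _ _ _ _
    obtain ⟨r₀, hr₀, hball⟩ :=
      Metric.eventually_nhds_iff_ball.1 (hj.2 (η / 4) (by positivity))
    set r := r₀ / 2 with hr
    have hr0 : 0 < r := by positivity
    have huQ : ∀ y, ‖y - x‖ ≤ r → u y - Q y ≤ u x - η / 4 * ‖y - x‖ ^ 2 := by
      intro y hy
      have h1 := hball (y - x) (by rw [mem_ball_zero_iff]; linarith)
      rw [add_sub_cancel] at h1
      simp only [hQ, hY, testFun, qf_add, qf_smul, qf_one]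
      linarith
    have hmaxex : ∀ m, ∃ y ∈ Metric.closedBall x r,
        ∀ y' ∈ Metric.closedBall x r, v m y' - Q y' ≤ v m y - Q y := by
      intro m
      have h1 : UpperSemicontinuousOn (fun y => v m y + -Q y) (Metric.closedBall x r) :=
        ((hv m).add hQc.neg.upperSemicontinuous).upperSemicontinuousOn _
      obtain ⟨y, hy, hmax⟩ := h1.exists_isMaxOn ⟨x, Metric.mem_closedBall_self hr0.le⟩
        (isCompact_closedBall x r)
      refine ⟨y, hy, fun y' hy' => ?_⟩
      have : v m y' + -Q y' ≤ v m y + -Q y := hmax hy'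
      linarith
    choose y hyb hymax using hmaxex
    have hbase : Tendsto (fun m => v m (z m) - Q (z m)) atTop (𝓝 (u x)) := by
      have := hvz.sub ((hQc.tendsto x).comp hz)
      rwa [hQx, sub_zero] at this
    have hzb : ∀ᶠ m in atTop, z m ∈ Metric.closedBall x r :=
      hz.eventually (Metric.closedBall_mem_nhds x hr0)
    -- On the compact annulus the strict gap and the half-relaxed bounds give a uniform inequality
    -- against the value at z m, so the maximum points enter every ball about x.
    have hyx : Tendsto y atTop (𝓝 x) := by
      rw [Metric.tendsto_nhds]
      intro δ hδ
      set A := Metric.closedBall x r \ Metric.ball x δ with hA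
      have hAc : IsCompact A := (isCompact_closedBall x r).diff Metric.isOpen_ball
      have h1 : ∀ y' ∈ A, {q : ℕ × Eu N | v q.1 q.2 - Q q.2 < v q.1 (z q.1) - Q (z q.1)}
          ∈ atTop ×ˢ 𝓝 y' := by
        intro y' hy'
        have hd : δ ≤ ‖y' - x‖ := by
          have := hy'.2
          rw [mem_ball_iff_norm, not_lt] at this
          exact this
        have h2 := huQ y' (by have := hy'.1; rwa [mem_closedBall_iff_norm] at this)
        have h3 : 0 < η / 4 * ‖y' - x‖ ^ 2 := by
          have : 0 < ‖y' - x‖ := hδ.trans_le hd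
          positivity
        set d := η / 4 * ‖y' - x‖ ^ 2 with hd
        have a1 := hlim y' (u y' + d / 3) (by linarith)
        have a2 : ∀ᶠ q : ℕ × Eu N in atTop ×ˢ 𝓝 y', Q y' - d / 3 < Q q.2 :=
          tendsto_snd.eventually ((hQc.tendsto y').eventually_const_lt (by linarith))
        have a3 : ∀ᶠ q : ℕ × Eu N in atTop ×ˢ 𝓝 y', u x - d / 3 < v q.1 (z q.1) - Q (z q.1) :=
          tendsto_fst.eventually (hbase.eventually_const_lt (by linarith))
        filter_upwards [a1, a2, a3] with q b1 b2 b3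
        show v q.1 q.2 - Q q.2 < v q.1 (z q.1) - Q (z q.1)
        linarith
      have h2 := hAc.mem_prod_nhdsSet_of_forall h1
      have h3 : ∀ᶠ m in atTop, ∀ y' ∈ A, v m y' - Q y' < v m (z m) - Q (z m) := by
        obtain ⟨s, hs, t, ht, hst⟩ := mem_prod_iff.1 h2
        filter_upwards [hs] with m hm y' hy'
        exact hst (Set.mk_mem_prod hm (subset_of_mem_nhdsSet ht hy'))
      filter_upwards [h3, hzb] with m hm hzm
      by_contra hlt
      have h4 := hm (y m) ⟨hyb m, hlt⟩
      linarith [hymax m (z m) hzm]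
    have hvy : Tendsto (fun m => v m (y m)) atTop (𝓝 (u x)) := by
      have hlow : Tendsto (fun m => v m (z m) - Q (z m) + Q (y m)) atTop (𝓝 (u x)) := by
        have := hbase.add ((hQc.tendsto x).comp hyx)
        rwa [hQx, add_zero] at this
      rw [tendsto_order]
      refine ⟨fun a ha => ?_, fun a ha => ?_⟩
      · filter_upwards [hlow.eventually_const_lt ha, hzb] with m h1 h2
        linarith [hymax m (z m) h2]
      · exact (tendsto_id.prodMk hyx).eventually (hlim x a ha)
    have hyr : ∀ᶠ m in atTop, y m ∈ Metric.ball x r :=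
      hyx.eventually (Metric.ball_mem_nhds x hr0)
    have hps : Tendsto (fun m => p + Y.toEuclideanLin (y m - x)) atTop (𝓝 p) := by
      have hc : Continuous fun w => p + Y.toEuclideanLin (w - x) :=
        continuous_const.add ((continuous_toEuclideanLin Y).comp (continuous_id.sub continuous_const))
      have h1 := (hc.tendsto x).comp hyx
      rwa [sub_self, map_zero, add_zero] at h1
    have hl := hF.tendsto hyx hvy hps tendsto_const_nhds hxO hYs
      (hyx.eventually (hO.mem_nhds hxO)) (Eventually.of_forall fun _ => hYs)
    refine le_of_tendsto_of_tendsto hl hε ?_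
    filter_upwards [hyr, hvy.eventually_const_lt hux] with m h1 h2
    refine hsub m (y m) h2 _ _ (SuperJet.of_touch (hasJet_quadratic x (y m) p hYs 0) ?_)
    filter_upwards [Metric.isOpen_ball.mem_nhds h1] with y' hy'
    rw [zero_add, zero_add]
    exact hymax m y' (Metric.ball_subset_closedBall hy')
  have hlim : Tendsto (fun ε : ℝ => F x (u x) p (X + ε • 1)) (𝓝[>] 0) (𝓝 (F x (u x) p X)) :=
    (hF.tendsto_add_smul_one hxO _ p hj.1).mono_left nhdsWithin_le_nhds
  exact le_of_tendsto hlim (by filter_upwards [self_mem_nhdsWithin] with ε hε using key ε hε)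

/-- The upper half-relaxed limit of a sequence of families of functions. -/
def relaxedLimit (𝓕 : ℕ → Set (Eu N → ℝ)) (x : Eu N) : ℝ :=
  sInf {c | ∀ᶠ q : ℕ × Eu N in atTop ×ˢ 𝓝 x, ∀ v ∈ 𝓕 q.1, v q.2 ≤ c}

theorem nonneg_of_eventually_le {𝓕 : ℕ → Set (Eu N → ℝ)} (h0 : ∀ n, (fun _ => 0) ∈ 𝓕 n) {x : Eu N}
    {c : ℝ} (hc : ∀ᶠ q : ℕ × Eu N in atTop ×ˢ 𝓝 x, ∀ v ∈ 𝓕 q.1, v q.2 ≤ c) : 0 ≤ c := by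
  obtain ⟨q, hq⟩ := hc.exists
  exact hq _ (h0 q.1)

theorem relaxedLimit_nonneg {𝓕 : ℕ → Set (Eu N → ℝ)} (h0 : ∀ n, (fun _ => 0) ∈ 𝓕 n) (x : Eu N) :
    0 ≤ relaxedLimit 𝓕 x :=
  Real.sInf_nonneg fun _ hc => nonneg_of_eventually_le h0 hc

theorem relaxedLimit_le {𝓕 : ℕ → Set (Eu N → ℝ)} (h0 : ∀ n, (fun _ => 0) ∈ 𝓕 n) {x : Eu N}
    {c : ℝ} (hc : ∀ᶠ q : ℕ × Eu N in atTop ×ˢ 𝓝 x, ∀ v ∈ 𝓕 q.1, v q.2 ≤ c) :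
    relaxedLimit 𝓕 x ≤ c :=
  csInf_le ⟨0, fun _ hc => nonneg_of_eventually_le h0 hc⟩ hc

theorem eventually_lt_of_relaxedLimit_lt {𝓕 : ℕ → Set (Eu N → ℝ)}
    (h1 : ∀ n, ∀ v ∈ 𝓕 n, ∀ x, v x ≤ 1) {x : Eu N} {c : ℝ} (hc : relaxedLimit 𝓕 x < c) :
    ∀ᶠ q : ℕ × Eu N in atTop ×ˢ 𝓝 x, ∀ v ∈ 𝓕 q.1, v q.2 < c := by
  have hne : {c | ∀ᶠ q : ℕ × Eu N in atTop ×ˢ 𝓝 x, ∀ v ∈ 𝓕 q.1, v q.2 ≤ c}.Nonempty :=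
    ⟨1, show ∀ᶠ q : ℕ × Eu N in atTop ×ˢ 𝓝 x, ∀ v ∈ 𝓕 q.1, v q.2 ≤ 1 from
      Eventually.of_forall fun q v hv => h1 q.1 v hv q.2⟩
  obtain ⟨c', hc', hlt⟩ := exists_lt_of_csInf_lt hne hc
  filter_upwards [show ∀ᶠ q : ℕ × Eu N in atTop ×ˢ 𝓝 x, ∀ v ∈ 𝓕 q.1, v q.2 ≤ c' from hc']
    with q hq v hv
  exact (hq v hv).trans_lt hlt

theorem upperSemicontinuous_relaxedLimit {𝓕 : ℕ → Set (Eu N → ℝ)}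
    (h0 : ∀ n, (fun _ => 0) ∈ 𝓕 n) (h1 : ∀ n, ∀ v ∈ 𝓕 n, ∀ x, v x ≤ 1) :
    UpperSemicontinuous (relaxedLimit 𝓕) := by
  intro x c hc
  obtain ⟨c', hlt, hc'⟩ := exists_between (show relaxedLimit 𝓕 x < c from hc)
  obtain ⟨s, hs, t, ht, hst⟩ := mem_prod_iff.1 (eventually_lt_of_relaxedLimit_lt h1 hlt)
  change ∀ᶠ y in 𝓝 x, relaxedLimit 𝓕 y < c
  filter_upwards [eventually_mem_nhds_iff.2 ht] with y hy
  refine (relaxedLimit_le h0 ?_).trans_lt hc'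
  filter_upwards [prod_mem_prod hs hy] with q hq v hv
  exact (show ∀ v ∈ 𝓕 q.1, v q.2 < c' from hst hq) v hv |>.le

/-- If no member of the m-th family nearly reached the limit in the ball of radius 1/(m + 1),
neither would any later, smaller family, and the limit would be lower. -/
theorem exists_tendsto_relaxedLimit {𝓕 : ℕ → Set (Eu N → ℝ)} (hanti : Antitone 𝓕)
    (h0 : ∀ n, (fun _ => 0) ∈ 𝓕 n) (h1 : ∀ n, ∀ v ∈ 𝓕 n, ∀ x, v x ≤ 1) (x : Eu N) :
    ∃ (v : ℕ → Eu N → ℝ) (z : ℕ → Eu N), (∀ m, v m ∈ 𝓕 m) ∧ Tendsto z atTop (𝓝 x) ∧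
      Tendsto (fun m => v m (z m)) atTop (𝓝 (relaxedLimit 𝓕 x)) := by
  have hex : ∀ m : ℕ, ∃ v ∈ 𝓕 m, ∃ z ∈ Metric.ball x (1 / ((m : ℝ) + 1)),
      relaxedLimit 𝓕 x - 1 / ((m : ℝ) + 1) < v z := by
    intro m
    by_contra! hcon
    have hpos : (0 : ℝ) < 1 / ((m : ℝ) + 1) := by positivity
    have := relaxedLimit_le (c := relaxedLimit 𝓕 x - 1 / ((m : ℝ) + 1)) h0 (x := x) (by
      filter_upwards [prod_mem_prod (Ici_mem_atTop m) (Metric.ball_mem_nhds x hpos)] with q hq v hv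
      exact hcon v (hanti hq.1 hv) q.2 hq.2)
    linarith
  choose v hv z hz hvz using hex
  have hz' : Tendsto z atTop (𝓝 x) := by
    rw [tendsto_iff_dist_tendsto_zero]
    exact squeeze_zero (fun _ => dist_nonneg) (fun m => (hz m).le)
      tendsto_one_div_add_atTop_nhds_zero_nat
  refine ⟨v, z, hv, hz', ?_⟩
  rw [tendsto_order]
  refine ⟨fun a ha => ?_, fun a ha => ?_⟩
  · have hl : Tendsto (fun m : ℕ => relaxedLimit 𝓕 x - 1 / ((m : ℝ) + 1)) atTop
        (𝓝 (relaxedLimit 𝓕 x)) := by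
      simpa using (tendsto_const_nhds (x := relaxedLimit 𝓕 x)).sub
        tendsto_one_div_add_atTop_nhds_zero_nat
    filter_upwards [hl.eventually_const_lt ha] with m hm
    exact hm.trans (hvz m)
  · filter_upwards [(tendsto_id.prodMk hz').eventually (eventually_lt_of_relaxedLimit_lt h1 ha)]
      with m hm
    exact hm _ (hv m)

/-- The positive part subsolutions with values in `[0, 1]` vanishing outside `K`. -/
def subFamily (F : Operator N) (K : Set (Eu N)) (ε : ℝ) : Set (Eu N → ℝ) :=
  {v | UpperSemicontinuous v ∧ (∀ x, 0 ≤ v x) ∧ (∀ x, v x ≤ 1) ∧ (∀ x ∉ K, v x = 0) ∧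
    IsPositivePartSubsolution F ε v}

theorem zero_mem_subFamily (F : Operator N) (K : Set (Eu N)) (ε : ℝ) :
    (fun _ => 0) ∈ subFamily F K ε :=
  ⟨upperSemicontinuous_const, fun _ => le_rfl, fun _ => zero_le_one, fun _ _ => rfl,
    fun _ h => absurd h (lt_irrefl _)⟩

theorem subFamily_mono {F : Operator N} {K K' : Set (Eu N)} {ε ε' : ℝ} (hK : K ⊆ K')
    (hε : ε ≤ ε') : subFamily F K ε ⊆ subFamily F K' ε' := fun _ hv =>
  ⟨hv.1, hv.2.1, hv.2.2.1, fun x hx => hv.2.2.2.1 x fun h => hx (hK h),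
    fun x hx p X hj => (hv.2.2.2.2 x hx p X hj).trans hε⟩

/-- The half-relaxed limit of a decreasing sequence of families of subsolutions is a
subsolution. -/
theorem relaxedLimit_mem_subFamily {F : Operator N} {O : Set (Eu N)} (hO : IsOpen O)
    (hF : IsContinuousOperator F O) {K : ℕ → Set (Eu N)} {ε : ℕ → ℝ} {ε₀ : ℝ} (hK : Antitone K)
    (hε : Antitone ε) (hKc : ∀ n, IsClosed (K n)) (hKO : K 0 ⊆ O)
    (hlim : Tendsto ε atTop (𝓝 ε₀)) :
    relaxedLimit (fun n => subFamily F (K n) (ε n)) ∈ subFamily F (⋂ n, K n) ε₀ := by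
  set 𝓕 := fun n => subFamily F (K n) (ε n) with h𝓕
  have hanti : Antitone 𝓕 := fun m n hmn => subFamily_mono (hK hmn) (hε hmn)
  have h0 : ∀ n, (fun _ => 0) ∈ 𝓕 n := fun n => zero_mem_subFamily _ _ _
  have h1 : ∀ n, ∀ v ∈ 𝓕 n, ∀ x, v x ≤ 1 := fun n v hv => hv.2.2.1
  have hoff : ∀ x ∉ ⋂ n, K n, relaxedLimit 𝓕 x = 0 := by
    intro x hx
    rw [Set.mem_iInter, not_forall] at hx
    obtain ⟨n, hn⟩ := hx
    refine le_antisymm (relaxedLimit_le h0 ?_) (relaxedLimit_nonneg h0 x)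
    filter_upwards [prod_mem_prod (Ici_mem_atTop n) ((hKc n).isOpen_compl.mem_nhds hn)] with q hq v hv
    exact (hv.2.2.2.1 q.2 fun h => hq.2 (hK hq.1 h)).le
  refine ⟨upperSemicontinuous_relaxedLimit h0 h1, relaxedLimit_nonneg h0, fun x =>
    relaxedLimit_le h0 (Eventually.of_forall fun q v hv => h1 _ v hv _), hoff,
    fun x hx p X hj => ?_⟩
  have hxO : x ∈ O := by
    by_contra hxO
    rw [hoff x fun h => hxO (hKO (Set.mem_iInter.1 h 0))] at hx
    exact lt_irrefl _ hx
  obtain ⟨v, z, hv, hz, hvz⟩ := exists_tendsto_relaxedLimit hanti h0 h1 x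
  refine le_of_superJet_of_limit hO hF (fun m => (hv m).1) (fun m => (hv m).2.2.2.2) hlim
    (fun y c hc => ?_) hxO hz hvz hx hj
  filter_upwards [eventually_lt_of_relaxedLimit_lt h1 hc] with q hq
  exact hq _ (hv q.1)

/-- The family of subsolutions has a greatest element. -/
theorem exists_greatest_subFamily {F : Operator N} {O : Set (Eu N)} (hO : IsOpen O)
    (hF : IsContinuousOperator F O) {K : Set (Eu N)} (hK : IsClosed K) (hKO : K ⊆ O) (ε : ℝ) :
    ∃ u ∈ subFamily F K ε, ∀ v ∈ subFamily F K ε, ∀ x, v x ≤ u x := by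
  -- For a constant sequence of families the relaxed limit dominates every member and belongs to the
  -- family itself.
  have h := relaxedLimit_mem_subFamily hO hF (K := fun _ => K) (ε := fun _ => ε)
    (fun _ _ _ => le_rfl) (fun _ _ _ => le_rfl) (fun _ => hK) hKO tendsto_const_nhds
  rw [Set.iInter_const] at h
  refine ⟨_, h, fun v hv x => le_csInf ⟨1, ?_⟩ ?_⟩
  · change ∀ᶠ q : ℕ × Eu N in atTop ×ˢ 𝓝 x, ∀ v ∈ subFamily F K ε, v q.2 ≤ 1
    exact Eventually.of_forall fun q w hw => hw.2.2.1 q.2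
  intro c hc
  obtain ⟨s, hs, t, ht, hst⟩ := mem_prod_iff.1 hc
  obtain ⟨n, hn⟩ := nonempty_of_mem hs
  exact (show ∀ v ∈ subFamily F K ε, v x ≤ c from hst (Set.mk_mem_prod hn (mem_of_mem_nhds ht))) v hv

/-! ### Perron's method. -/

theorem IsDegenerateElliptic.le_of_qf_le {F : Operator N} {O : Set (Eu N)}
    (h : IsDegenerateElliptic F O) {x : Eu N} (hx : x ∈ O) (r : ℝ) (p : Eu N) {X Y : Mat N}
    (hX : X.IsSymm) (hY : Y.IsSymm) (hle : ∀ v, qf X v ≤ qf Y v) : F x r p Y ≤ F x r p X := by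
  have h1 := h x hx r p X (Y - X) hX (hY.sub hX)
    (posSemidef_of_qf (hY.sub hX) fun v => by rw [qf_sub]; linarith [hle v])
  rw [add_sub_cancel] at h1
  linarith

theorem IsHomogeneous.apply_zero {F : Operator N} {O : Set (Eu N)} {α : ℝ}
    (h : IsHomogeneous F O α) (hα : 0 < α) {x : Eu N} (hx : x ∈ O) : F x 0 0 0 = 0 := by
  have h1 := h x hx 0 0 0 Matrix.isSymm_zero 0 le_rfl
  rwa [Real.zero_rpow hα.ne', zero_mul, zero_smul, zero_smul, zero_mul] at h1

theorem hasJet_const (c : ℝ) (x : Eu N) : HasJet (fun _ => c) x 0 0 := by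
  refine ⟨Matrix.isSymm_zero, fun ε hε => Eventually.of_forall fun h => ?_⟩
  have h0 : qf (0 : Mat N) h = 0 := by simp [qf]
  simp only [sub_self, inner_zero_left, h0, zero_div, abs_zero]
  positivity

theorem gradient_const_zero (c : ℝ) (x : Eu N) : gradient (fun _ : Eu N => c) x = 0 :=
  ((hasJet_const c x).gradient_hess_eq contDiffAt_const).1

theorem hess_const_zero (c : ℝ) (x : Eu N) : hess (fun _ : Eu N => c) x = 0 :=
  ((hasJet_const c x).gradient_hess_eq contDiffAt_const).2

/-- The lower semicontinuous envelope. -/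
def lscEnvelope (u : Eu N → ℝ) (x : Eu N) : ℝ :=
  sSup {c | ∀ᶠ y in 𝓝 x, c ≤ u y}

theorem le_lscEnvelope (u : Eu N → ℝ) {x : Eu N} {c : ℝ} (hc : ∀ᶠ y in 𝓝 x, c ≤ u y) :
    c ≤ lscEnvelope u x :=
  le_csSup ⟨u x, fun c h => Eventually.self_of_nhds (p := fun y => c ≤ u y) h⟩ hc

theorem lscEnvelope_le {u : Eu N → ℝ} (h0 : ∀ x, 0 ≤ u x) (x : Eu N) : lscEnvelope u x ≤ u x :=
  csSup_le ⟨0, Eventually.of_forall h0⟩ fun c h =>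
    Eventually.self_of_nhds (p := fun y => c ≤ u y) h

theorem lowerSemicontinuous_lscEnvelope {u : Eu N → ℝ} (h0 : ∀ x, 0 ≤ u x) :
    LowerSemicontinuous (lscEnvelope u) := by
  intro x c hc
  have hne : {c | ∀ᶠ y in 𝓝 x, c ≤ u y}.Nonempty := ⟨0, Eventually.of_forall h0⟩
  obtain ⟨c', hc', hlt⟩ := exists_lt_of_lt_csSup hne (show c < lscEnvelope u x from hc)
  change ∀ᶠ y in 𝓝 x, c < lscEnvelope u y
  filter_upwards [eventually_eventually_nhds.2 (show ∀ᶠ y in 𝓝 x, c' ≤ u y from hc')] with y hy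
  exact hlt.trans_le (le_lscEnvelope u hy)

open scoped Classical in
/-- Raising a subsolution by a smooth strict subsolution near a point. -/
theorem bump_mem_subFamily {F : Operator N} {O K : Set (Eu N)} (h_ell : IsDegenerateElliptic F O)
    (hKO : K ⊆ O) {ε : ℝ} {u : Eu N → ℝ} (hu : u ∈ subFamily F K ε) {x p : Eu N} {Y : Mat N}
    (hY : Y.IsSymm) {r b₀ : ℝ} (hr : 0 < r) (hball : Metric.ball x r ⊆ K)
    (hF : ∀ y ∈ Metric.ball x r, F y (b₀ + testFun x p Y 0 y)
      (p + Y.toEuclideanLin (y - x)) Y ≤ ε)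
    (hle : ∀ y ∈ Metric.ball x r, b₀ + testFun x p Y 0 y ≤ 1)
    (hann : ∀ y ∈ Metric.ball x r, r / 2 ≤ ‖y - x‖ → b₀ + testFun x p Y 0 y ≤ u y) :
    (Metric.ball x r).piecewise (fun y => max (u y) (b₀ + testFun x p Y 0 y)) u
      ∈ subFamily F K ε := by
  set b := fun y => b₀ + testFun x p Y 0 y with hb
  set w := (Metric.ball x r).piecewise (fun y => max (u y) (b y)) u with hw
  have hbc : Continuous b := continuous_const.add (continuous_testFun _ _ _ _)
  have hwin : ∀ y ∈ Metric.ball x r, w y = max (u y) (b y) := fun y hy =>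
    Set.piecewise_eq_of_mem _ _ _ hy
  have hwout : ∀ y ∉ Metric.ball x r, w y = u y := fun y hy =>
    Set.piecewise_eq_of_notMem _ _ _ hy
  have huw : ∀ y, u y ≤ w y := fun y => by
    by_cases hy : y ∈ Metric.ball x r
    · rw [hwin y hy]; exact le_max_left _ _
    · rw [hwout y hy]
  have hfar : ∀ y, r / 2 ≤ ‖y - x‖ → w y = u y := fun y hy => by
    by_cases hyb : y ∈ Metric.ball x r
    · rw [hwin y hyb, max_eq_left (hann y hyb hy)]
    · exact hwout y hyb
  refine ⟨fun y c hc => ?_, fun y => (hu.2.1 y).trans (huw y), fun y => ?_, fun y hy => ?_,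
    fun y hy q Z hj => ?_⟩
  · have hc : w y < c := hc
    change ∀ᶠ z in 𝓝 y, w z < c
    by_cases hy : ‖y - x‖ < r
    · have hyb : y ∈ Metric.ball x r := by rwa [mem_ball_iff_norm]
      rw [hwin y hyb, max_lt_iff] at hc
      have h1 : ∀ᶠ z in 𝓝 y, u z < c := hu.1 y c hc.1
      filter_upwards [h1, (hbc.tendsto y).eventually_lt_const hc.2,
        Metric.isOpen_ball.mem_nhds hyb] with z a1 a2 a3
      rw [hwin z a3]
      exact max_lt a1 a2
    · rw [hwout y (by rwa [mem_ball_iff_norm])] at hc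
      have h1 : ∀ᶠ z in 𝓝 y, u z < c := hu.1 y c hc
      have hcont : Continuous fun z : Eu N => ‖z - x‖ := by fun_prop
      filter_upwards [h1, (hcont.tendsto y).eventually_const_lt
        (show r / 2 < ‖y - x‖ by linarith)] with z a1 a2
      rwa [hfar z a2.le]
  · by_cases hyb : y ∈ Metric.ball x r
    · rw [hwin y hyb]; exact max_le (hu.2.2.1 y) (hle y hyb)
    · rw [hwout y hyb]; exact hu.2.2.1 y
  · rw [hwout y fun h => hy (hball h)]
    exact hu.2.2.2.1 y hy
  · by_cases heq : w y = u y
    · rw [heq] at hy ⊢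
      exact hu.2.2.2.2 y hy q Z (hj.mono (Eventually.of_forall huw) heq.symm)
    · have hyb : y ∈ Metric.ball x r := by
        by_contra h
        exact heq (hwout y h)
      have hwb : w y = b y := by
        rw [hwin y hyb] at heq ⊢
        exact (max_choice _ _).resolve_left heq
      -- Where w differs from u it equals the quadratic b. A superjet of w there has the slope of b
      -- and a larger matrix, and ellipticity concludes.
      obtain ⟨h1, h2⟩ := hj.compare (hasJet_quadratic x y p hY b₀) (by
        filter_upwards [Metric.isOpen_ball.mem_nhds hyb] with z hz
        rw [hwin z hz]
        exact le_max_right _ _) hwb.symm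
      rw [← h1, hwb]
      exact (h_ell.le_of_qf_le (hKO (hball hyb)) _ _ hY hj.1 h2).trans (hF y hyb)

/-- The lower semicontinuous envelope of the greatest subsolution is a supersolution where the
upper bound is not attained. -/
theorem lscEnvelope_isViscositySupersolution {F : Operator N} {O K : Set (Eu N)}
    (hF : IsContinuousOperator F O) (h_ell : IsDegenerateElliptic F O) (hO : IsOpen O)
    (hKO : K ⊆ O) {ε : ℝ} {u : Eu N → ℝ} (hu : u ∈ subFamily F K ε)
    (hmax : ∀ v ∈ subFamily F K ε, ∀ x, v x ≤ u x) (hlt : ∀ x, u x ≤ 1 / 2) :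
    IsViscositySupersolution (fun x r p X => F x r p X - ε) (interior K) (lscEnvelope u) := by
  intro x hx ψ hψ hmin
  by_contra! hneg
  have hxO : x ∈ O := hKO (interior_subset hx)
  set φ := lscEnvelope u with hφ
  have hφu : ∀ y, φ y ≤ u y := lscEnvelope_le hu.2.1
  have hφ0 : 0 ≤ φ x := le_lscEnvelope u (Eventually.of_forall hu.2.1)
  have hjet := hasJet_of_contDiffAt hψ
  set p := gradient ψ x with hp
  set X := hess ψ x with hX
  -- Lowering the Hessian by γ preserves the strict inequality and leaves a gap of order γ‖y − x‖²
  -- below φ, which is room for a bump.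
  obtain ⟨γ, hγ, hγF⟩ : ∃ γ : ℝ, γ > 0 ∧ F x (φ x) p (X + (-γ) • 1) < ε := by
    have h0 : Tendsto (fun γ : ℝ => -γ) (𝓝[>] 0) (𝓝 0) := by
      have : Continuous fun γ : ℝ => -γ := by fun_prop
      simpa using (this.tendsto 0).mono_left nhdsWithin_le_nhds
    have h1 := (hF.tendsto_add_smul_one hxO (φ x) p hjet.1).comp h0
    obtain ⟨γ, h2, h3⟩ := ((h1.eventually_lt_const (show F x (φ x) p X < ε by linarith)).and
      self_mem_nhdsWithin).exists
    exact ⟨γ, h3, h2⟩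
  set Y := X + (-γ) • (1 : Mat N) with hYdef
  have hY : Y.IsSymm := hjet.1.add (Matrix.isSymm_one.smul _)
  set q := testFun x p Y 0 with hq
  have hqc : Continuous q := continuous_testFun _ _ _ _
  have hqx : q x = 0 := testFun_self _ _ _ _
  have hnear : ∀ᶠ y in 𝓝 x, φ x + q y + γ / 4 * ‖y - x‖ ^ 2 ≤ φ y := by
    have ht : Tendsto (fun y : Eu N => y - x) (𝓝 x) (𝓝 0) := by
      have : Continuous fun y : Eu N => y - x := by fun_prop
      simpa using this.tendsto x
    have hm : ∀ᶠ y in 𝓝 x, φ x - ψ x ≤ φ y - ψ y := by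
      have h := hmin
      rw [IsLocalMinOn, IsMinFilter, isOpen_interior.nhdsWithin_eq hx] at h
      exact h
    filter_upwards [ht.eventually (hjet.2 (γ / 4) (by positivity)), hm] with y h1 h2
    rw [add_sub_cancel] at h1
    have h3 := (abs_le.1 h1).1
    simp only [hq, hYdef, testFun, qf_add, qf_smul, qf_one]
    linarith
  have hFnear : ∀ᶠ y' : Eu N × ℝ in 𝓝 (x, 0),
      F y'.1 (φ x + y'.2 + q y'.1) (p + Y.toEuclideanLin (y'.1 - x)) Y < ε := by
    have hc1 : Continuous fun y' : Eu N × ℝ => φ x + y'.2 + q y'.1 := by fun_prop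
    have hc2 : Continuous fun y' : Eu N × ℝ => p + Y.toEuclideanLin (y'.1 - x) :=
      continuous_const.add ((continuous_toEuclideanLin Y).comp (continuous_fst.sub continuous_const))
    have h1 := hc1.tendsto (x, 0)
    have h2 := hc2.tendsto (x, 0)
    simp only [hqx, add_zero, sub_self, map_zero] at h1 h2
    have := hF.tendsto (continuous_fst.tendsto (x, (0 : ℝ))) h1 h2 tendsto_const_nhds hxO hY
      ((continuous_fst.tendsto (x, (0 : ℝ))).eventually (hO.mem_nhds hxO))
      (Eventually.of_forall fun _ => hY)
    exact this.eventually_lt_const hγF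
  rw [nhds_prod_eq] at hFnear
  obtain ⟨s, hs, t, ht, hst⟩ := mem_prod_iff.1 hFnear
  obtain ⟨δ₁, hδ₁, ht'⟩ := Metric.mem_nhds_iff.1 ht
  have hq8 : ∀ᶠ y in 𝓝 x, q y < 1 / 8 := (hqc.tendsto x).eventually_lt_const (by rw [hqx]; norm_num)
  obtain ⟨r, hr, hball⟩ := Metric.eventually_nhds_iff_ball.1
    (((hnear.and hq8).and (isOpen_interior.mem_nhds hx)).and hs)
  -- The raised quadratic must remain a strict subsolution, stay below 1 (at most 1/2 + 1/8 + 1/8),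
  -- and lie below u on the annulus ‖y − x‖ ≥ r/2.
  set δ := min (δ₁ / 2) (min (1 / 8) (γ / 4 * (r / 2) ^ 2)) with hδ
  have hδ0 : 0 < δ := by positivity
  have hδ1 : δ < δ₁ := (min_le_left _ _).trans_lt (by linarith)
  have hδ8 : δ ≤ 1 / 8 := (min_le_right _ _).trans (min_le_left _ _)
  have hδr : δ ≤ γ / 4 * (r / 2) ^ 2 := (min_le_right _ _).trans (min_le_right _ _)
  classical
  have hw := bump_mem_subFamily h_ell hKO hu hY (p := p) (b₀ := φ x + δ) hr
    (fun y hy => interior_subset (hball y hy).1.2)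
    (fun y hy => by
      have h1 : (y, δ) ∈ s ×ˢ t := Set.mk_mem_prod (hball y hy).2
        (ht' (by rw [mem_ball_zero_iff, Real.norm_of_nonneg hδ0.le]; exact hδ1))
      exact (show F y (φ x + δ + q y) (p + Y.toEuclideanLin (y - x)) Y < ε from hst h1).le)
    (fun y hy => by
      have h1 := (hball y hy).1.1.2
      change φ x + δ + q y ≤ 1
      linarith [hφu x, hlt x])
    (fun y hy hfar => by
      have h1 := (hball y hy).1.1.1
      have h2 : γ / 4 * (r / 2) ^ 2 ≤ γ / 4 * ‖y - x‖ ^ 2 := by gcongr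
      change φ x + δ + q y ≤ u y
      linarith [hφu y])
  have hle := hmax _ hw
  -- The bump belongs to the family, so the greatest element u lies above it near x; the envelope at
  -- x would then exceed itself.
  have h1 : φ x + δ / 2 ≤ φ x := by
    refine le_lscEnvelope u ?_
    filter_upwards [Metric.ball_mem_nhds x hr, (hqc.tendsto x).eventually_const_lt
      (show -(δ / 2) < q x by rw [hqx]; linarith)] with y hy hy2
    have h2 := hle y
    rw [Set.piecewise_eq_of_mem _ _ _ hy] at h2
    have h3 : φ x + δ + q y ≤ u y := (le_max_right _ _).trans h2
    linarith
  linarith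

/-- Bounded subsolutions vanishing outside the closure of `Ω` are subsolutions of the Dirichlet
problem. -/
theorem isDirichletSubsolution_of_mem_subFamily {F : Operator N} {O Ω : Set (Eu N)} {α : ℝ}
    (hα : 0 < α) (h_ell : IsDegenerateElliptic F O) (h_hom : IsHomogeneous F O α)
    (hΩo : IsOpen Ω) (hΩO : closure Ω ⊆ O) {u : Eu N → ℝ} (hu : u ∈ subFamily F (closure Ω) 0) :
    IsDirichletSubsolution F Ω u := by
  intro ψ hψ ξ hξ hmax
  have hjet := hasJet_of_contDiffAt (hψ.contDiffAt (x := ξ))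
  rcases (hu.2.1 ξ).lt_or_eq with hpos | hzero
  · have h1 : F ξ (u ξ) (gradient ψ ξ) (hess ψ ξ) ≤ 0 := by
      refine hu.2.2.2.2 ξ hpos _ _ (SuperJet.of_touch hjet ?_)
      filter_upwards [(hψ.continuous.tendsto ξ).eventually_const_lt
        (show ψ ξ - u ξ < ψ ξ by linarith)] with y hy
      by_cases hyΩ : y ∈ closure Ω
      · exact hmax hyΩ
      · rw [hu.2.2.2.1 y hyΩ]
        linarith
    exact ⟨fun _ => h1, fun _ => (min_le_right _ _).trans h1⟩
  · refine ⟨fun hξΩ => ?_, fun _ => (min_le_left _ _).trans hzero.ge⟩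
    -- At an interior zero ψ touches the zero function from above: its gradient vanishes, its
    -- Hessian is nonnegative, and ellipticity compares with F(ξ, 0, 0, 0) = 0.
    have hj : SuperJet (fun _ : Eu N => (0 : ℝ)) ξ (gradient ψ ξ) (hess ψ ξ) := by
      refine SuperJet.of_touch hjet ?_
      filter_upwards [hΩo.mem_nhds hξΩ] with y hy
      have h1 : u y - ψ y ≤ u ξ - ψ ξ := hmax (subset_closure hy)
      linarith [hu.2.1 y]
    obtain ⟨h1, h2⟩ := hj.compare (hasJet_const 0 ξ) (Eventually.of_forall fun _ => le_rfl) rfl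
    have h3 := h_ell.le_of_qf_le (hΩO hξ) 0 0 Matrix.isSymm_zero hjet.1 h2
    rw [h_hom.apply_zero hα (hΩO hξ)] at h3
    rwa [← hzero, ← h1]

/-! ### From the Maximum Principle to a supersolution beyond the closure. -/

/-- Under the maximum principle there is a positive strict supersolution in a neighbourhood of the
closure of `Ω`. -/
theorem exists_supersolution_of_maximumPrinciple {F : Operator N} {O Ω : Set (Eu N)} {α : ℝ}
    (hα : 0 < α) (hΩo : IsOpen Ω) (hΩ : Bornology.IsBounded Ω) (hO : IsOpen O)
    (hΩO : closure Ω ⊆ O) (hF : IsContinuousOperator F O) (h_ell : IsDegenerateElliptic F O)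
    (h_hom : IsHomogeneous F O α) (hMP : MaximumPrinciple F Ω) :
    ∃ ε > 0, ∃ Ω' : Set (Eu N), IsOpen Ω' ∧ closure Ω ⊆ Ω' ∧ Ω' ⊆ O ∧ ∃ φ : Eu N → ℝ,
      LowerSemicontinuousOn φ Ω' ∧ (∀ x ∈ Ω', 0 < φ x) ∧
      IsViscositySupersolution (shifted F α ε) Ω' φ := by
  obtain ⟨r₀, hr₀, hr₀O⟩ := hΩ.isCompact_closure.exists_cthickening_subset_open hO hΩO
  set ε : ℕ → ℝ := fun n => 1 / ((n : ℝ) + 1) with hε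
  have hεpos : ∀ n, 0 < ε n := fun n => by positivity
  have hεanti : Antitone ε := fun m n hmn =>
    one_div_le_one_div_of_le (by positivity) (by gcongr)
  have hεlim : Tendsto ε atTop (𝓝 0) := tendsto_one_div_add_atTop_nhds_zero_nat
  set K : ℕ → Set (Eu N) := fun n => Metric.cthickening (r₀ * ε n) (closure Ω) with hK
  have hKanti : Antitone K := fun m n hmn =>
    Metric.cthickening_mono (mul_le_mul_of_nonneg_left (hεanti hmn) hr₀.le) _
  have hK0 : K 0 ⊆ O := by
    have : r₀ * ε 0 = r₀ := by simp [hε]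
    simp only [hK, this]
    exact hr₀O
  have hKO : ∀ n, K n ⊆ O := fun n => (hKanti (Nat.zero_le n)).trans hK0
  have hKcl : ∀ n, IsClosed (K n) := fun n => Metric.isClosed_cthickening
  have hKint : ⋂ n, K n = closure Ω := by
    refine Set.Subset.antisymm (fun x hx => ?_) (Set.subset_iInter fun n =>
      Metric.self_subset_cthickening _)
    rw [← closure_closure, Metric.closure_eq_iInter_cthickening]
    simp only [Set.mem_iInter] at hx ⊢
    intro δ hδ
    have h1 : Tendsto (fun n => r₀ * ε n) atTop (𝓝 0) := by simpa using hεlim.const_mul r₀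
    obtain ⟨n, hn⟩ := (h1.eventually_lt_const hδ).exists
    exact Metric.cthickening_mono hn.le _ (hx n)
  have hlim := relaxedLimit_mem_subFamily hO hF hKanti hεanti hKcl hK0 hεlim
  rw [hKint] at hlim
  set u := relaxedLimit fun n => subFamily F (K n) (ε n) with hu
  have hu0 : ∀ x, u x ≤ 0 := fun x => by
    by_cases hx : x ∈ closure Ω
    · exact hMP u (hlim.1.upperSemicontinuousOn _)
        (isDirichletSubsolution_of_mem_subFamily hα h_ell h_hom hΩo hΩO hlim) x hx
    · exact (hlim.2.2.2.1 x hx).le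
  have hKc : IsCompact (K 0) := hΩ.isCompact_closure.cthickening
  -- The relaxed limit is at most 0, and compactness of K 0 makes the bound 1/2 uniform over a whole
  -- family.
  obtain ⟨m, hm⟩ : ∃ m, ∀ v ∈ subFamily F (K m) (ε m), ∀ x, v x ≤ 1 / 2 := by
    have h1 := hKc.mem_prod_nhdsSet_of_forall (l := atTop)
      (s := {q : ℕ × Eu N | ∀ v ∈ subFamily F (K q.1) (ε q.1), v q.2 < 1 / 2}) fun y _ =>
      eventually_lt_of_relaxedLimit_lt (fun n v hv => hv.2.2.1)
        ((hu0 y).trans_lt (by norm_num))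
    obtain ⟨s, hs, t, ht, hst⟩ := mem_prod_iff.1 h1
    obtain ⟨m, hm⟩ := nonempty_of_mem hs
    refine ⟨m, fun v hv x => ?_⟩
    by_cases hx : x ∈ K 0
    · have h2 : (m, x) ∈ s ×ˢ t := Set.mk_mem_prod hm (subset_of_mem_nhdsSet ht hx)
      exact (hst h2 v hv).le
    · rw [hv.2.2.2.1 x fun h => hx (hKanti (Nat.zero_le m) h)]
      norm_num
  obtain ⟨v, hv, hvmax⟩ := exists_greatest_subFamily hO hF (hKcl m) (hKO m) (ε m)
  have hsup := lscEnvelope_isViscositySupersolution hF h_ell hO (hKO m) hv hvmax (hm v hv)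
  have hsubO : interior (K m) ⊆ O := interior_subset.trans (hKO m)
  have hnn : ∀ x, 0 ≤ lscEnvelope v x := fun x => le_lscEnvelope v (Eventually.of_forall hv.2.1)
  refine ⟨ε m, hεpos m, interior (K m), isOpen_interior, ?_, hsubO, lscEnvelope v,
    (lowerSemicontinuous_lscEnvelope hv.2.1).lowerSemicontinuousOn _, fun x hx => ?_,
    fun x hx ψ hψ hmin => ?_⟩
  · exact (Metric.self_subset_thickening (mul_pos hr₀ (hεpos m)) _).trans
      (interior_maximal (Metric.thickening_subset_cthickening _ _) Metric.isOpen_thickening)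
  -- At a zero the constant 0 would touch from below and give F(x, 0, 0, 0) ≥ ε m, against F(x, 0,
  -- 0, 0) = 0.
  · refine (hnn x).lt_of_ne fun h0 => ?_
    have h1 := hsup x hx (fun _ => 0) contDiffAt_const (by
      refine Eventually.of_forall fun y => ?_
      change lscEnvelope v x - 0 ≤ lscEnvelope v y - 0
      rw [← h0]
      linarith [hnn y])
    rw [gradient_const_zero, hess_const_zero, ← h0] at h1
    have h2 : 0 ≤ F x 0 0 0 - ε m := h1
    rw [h_hom.apply_zero hα (hsubO hx)] at h2
    linarith [hεpos m]
  · have h1 := hsup x hx ψ hψ hmin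
    -- Since the envelope is at most 1, F ≥ ε is stronger than F ≥ ε φ^α.
    have h2 : lscEnvelope v x ^ α ≤ 1 := Real.rpow_le_one (hnn x)
      ((lscEnvelope_le hv.2.1 x).trans (hv.2.2.1 x)) hα.le
    have h3 := mul_le_mul_of_nonneg_left h2 (hεpos m).le
    rw [shifted]
    linarith

/-! ### Zero order shifts of the operator and the conclusion. -/

theorem IsViscositySupersolution.mono {G : Operator N} {U U' : Set (Eu N)} {φ : Eu N → ℝ}
    (h : IsViscositySupersolution G U φ) (hU' : IsOpen U') (hsub : U' ⊆ U) :
    IsViscositySupersolution G U' φ := fun x hx ψ hψ hmin => by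
  refine h x (hsub hx) ψ hψ (IsLocalMin.on ?_ U)
  rwa [IsLocalMinOn, IsMinFilter, hU'.nhdsWithin_eq hx] at hmin

theorem IsViscositySupersolution.congr {G G' : Operator N} {U : Set (Eu N)} {φ : Eu N → ℝ}
    (h : IsViscositySupersolution G U φ)
    (hle : ∀ x ∈ U, ∀ p X, G x (φ x) p X ≤ G' x (φ x) p X) :
    IsViscositySupersolution G' U φ := fun x hx ψ hψ hmin =>
  (h x hx ψ hψ hmin).trans (hle x hx _ _)

/-- A barrier at `ξ` with right-hand side `β`. -/
def HasBarrier (F : Operator N) (Ω : Set (Eu N)) (β : ℝ) (ξ : Eu N) : Prop :=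
  ∃ ρ > 0, ∃ w : Eu N → ℝ,
    ContinuousOn w (closure (Ω ∩ Metric.ball ξ ρ)) ∧
    (∀ x ∈ closure (Ω ∩ Metric.ball ξ ρ), 0 ≤ w x) ∧ w ξ = 0 ∧
    IsViscositySupersolution (fun x r p X => F x r p X - β) (Ω ∩ Metric.ball ξ ρ) w

/-- A strict supersolution with positive infimum and barriers yield the maximum principle. -/
theorem maximumPrinciple_of_supersolution {Ω O V : Set (Eu N)} (hΩo : IsOpen Ω)
    (hΩ : Bornology.IsBounded Ω) (hs : HasSmoothBoundary Ω) (hΩO : closure Ω ⊆ O) (hV : IsOpen V)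
    (hVΩ : frontier Ω ⊆ V) {F : Operator N} {α : ℝ} (hα : 0 < α) (hF : IsContinuousOperator F O)
    (h_hom : IsHomogeneous F O α) (h_val : IsUniformlyContinuousInValue F O)
    (h_struct : StructureCondition F O) (h_unif : IsUniformlyContinuousNear F (closure Ω ∩ V))
    (h_bdry : BoundaryStructureCondition F (closure Ω ∩ V)) {β : ℝ} (hβ : 0 < β)
    (h_barrier : ∀ ξ ∈ frontier Ω, HasBarrier F Ω β ξ) {l : ℝ} (hl : 0 < l) {φ : Eu N → ℝ}
    (hφ : LowerSemicontinuousOn φ Ω) {c : ℝ} (hc : 0 < c) (hcφ : ∀ x ∈ Ω, c ≤ φ x)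
    (hsuper : IsViscositySupersolution (shifted F α l) Ω φ) : MaximumPrinciple F Ω := by
  intro u hu hsub x hx
  have hfr : ∀ ξ ∈ frontier Ω, u ξ ≤ 0 := fun ξ hξ => by
    obtain ⟨ρ, hρ, w, hw, hw0, hwξ, hws⟩ := h_barrier ξ hξ
    exact hsub.nonpos_of_barrier hα hΩo hΩ hs hΩO hV hF h_hom h_unif h_bdry hu hξ (hVΩ hξ) hρ hβ
      hw hw0 hwξ hws
  have h1 := posExt_nonpos_of_frontier hl hα hΩo hΩ hΩO hF h_hom h_val h_struct hφ hc hcφ hsuper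
    hu hsub hfr x
  rw [posExt_of_mem hx] at h1
  exact (le_max_left _ _).trans h1

/-- The operator `F[u] - l |u|^α`. -/
def absShifted (F : Operator N) (α l : ℝ) : Operator N :=
  fun x r p X => F x r p X - l * |r| ^ α

theorem continuous_mul_abs_rpow {α : ℝ} (hα : 0 < α) (l : ℝ) : Continuous fun r : ℝ => l * |r| ^ α :=
  continuous_const.mul (continuous_abs.rpow_const fun _ => Or.inr hα.le)

theorem IsContinuousOperator.absShifted {F : Operator N} {O : Set (Eu N)} {α : ℝ} (hα : 0 < α)
    (h : IsContinuousOperator F O) (l : ℝ) : IsContinuousOperator (absShifted F α l) O :=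
  ContinuousOn.sub h ((continuous_mul_abs_rpow hα l).comp
    (continuous_fst.comp continuous_snd)).continuousOn

theorem IsDegenerateElliptic.absShifted {F : Operator N} {O : Set (Eu N)} (α l : ℝ)
    (h : IsDegenerateElliptic F O) : IsDegenerateElliptic (absShifted F α l) O :=
  fun x hx r p X Y hX hY hYp => by
    have := h x hx r p X Y hX hY hYp
    simp only [DegElliptic.absShifted]
    linarith

theorem IsHomogeneous.absShifted {F : Operator N} {O : Set (Eu N)} {α : ℝ} (l : ℝ)
    (h : IsHomogeneous F O α) : IsHomogeneous (absShifted F α l) O α :=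
  fun x hx r p X hX τ hτ => by
    simp only [DegElliptic.absShifted]
    rw [h x hx r p X hX τ hτ, abs_mul, abs_of_nonneg hτ, Real.mul_rpow hτ (abs_nonneg r)]
    ring

theorem IsUniformlyContinuousInValue.absShifted {F : Operator N} {O : Set (Eu N)} {α : ℝ}
    (hα : 0 < α) (l : ℝ) (h : IsUniformlyContinuousInValue F O) :
    IsUniformlyContinuousInValue (absShifted F α l) O := by
  intro r ε hε
  obtain ⟨δ₁, hδ₁, h1⟩ := h r (ε / 2) (by positivity)
  obtain ⟨δ₂, hδ₂, h2⟩ := Metric.continuous_iff.1 (continuous_mul_abs_rpow hα l) r (ε / 2)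
    (by positivity)
  refine ⟨min δ₁ δ₂, by positivity, fun s hs x hx p X hX => ?_⟩
  have h3 := h1 s (hs.trans_le (min_le_left _ _)) x hx p X hX
  have h4 := h2 s (hs.trans_le (min_le_right _ _))
  rw [Real.dist_eq] at h4
  rw [abs_lt] at h3 h4 ⊢
  simp only [DegElliptic.absShifted]
  constructor <;> linarith

/-- Both operator values are taken at the same r, so the added terms cancel. -/
theorem StructureCondition.absShifted {F : Operator N} {O : Set (Eu N)} (α l : ℝ)
    (h : StructureCondition F O) : StructureCondition (absShifted F α l) O := by
  intro R hR
  obtain ⟨m, hm, hm0, hmF⟩ := h R hR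
  refine ⟨m, hm, hm0, fun X Y hX hY σ hσ hb x hx y hy r hr => ?_⟩
  have := hmF X Y hX hY σ hσ hb x hx y hy r hr
  simp only [DegElliptic.absShifted]
  linarith

theorem BoundaryStructureCondition.absShifted {F : Operator N} {A : Set (Eu N)} (α l : ℝ)
    (h : BoundaryStructureCondition F A) : BoundaryStructureCondition (absShifted F α l) A := by
  intro R hR
  obtain ⟨K, hK, hKF⟩ := h R hR
  refine ⟨K, hK, fun X Y hX hY σ hσ hb x hx y hy r hr p => ?_⟩
  have := hKF X Y hX hY σ hσ hb x hx y hy r hr p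
  simp only [DegElliptic.absShifted]
  linarith

theorem IsUniformlyContinuousNear.absShifted {F : Operator N} {A : Set (Eu N)} {α : ℝ}
    (hα : 0 < α) (l : ℝ) (h : IsUniformlyContinuousNear F A) :
    IsUniformlyContinuousNear (absShifted F α l) A := by
  intro R hR ε hε
  obtain ⟨δ₁, hδ₁, h1⟩ := h R hR (ε / 2) (by positivity)
  obtain ⟨δ₂, hδ₂, h2⟩ := Metric.uniformContinuousOn_iff.1
    ((isCompact_Icc (a := (0 : ℝ)) (b := R)).uniformContinuousOn_of_continuous
      (continuous_mul_abs_rpow hα l).continuousOn) (ε / 2) (by positivity)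
  refine ⟨min δ₁ δ₂, by positivity, fun x hx r hr s hs p q X Y hX hY hrs hpq hXY => ?_⟩
  have h3 := h1 x hx r hr s hs p q X Y hX hY (hrs.trans_le (min_le_left _ _))
    (hpq.trans_le (min_le_left _ _)) fun i j => (hXY i j).trans_le (min_le_left _ _)
  have h4 := h2 r hr s hs (hrs.trans_le (min_le_right _ _))
  rw [Real.dist_eq] at h4
  rw [abs_lt] at h3 h4 ⊢
  simp only [DegElliptic.absShifted]
  constructor <;> linarith

/-- As w is continuous and vanishes at ξ, the term l |w|^α is below 1/2 on a smaller ball; hence the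
right-hand side 1/2. -/
theorem AdmitsBarrier.absShifted {F : Operator N} {Ω : Set (Eu N)} {α : ℝ} (hα : 0 < α) (l : ℝ)
    (hΩ : IsOpen Ω) {ξ : Eu N} (hξ : ξ ∈ frontier Ω) (h : AdmitsBarrier F Ω ξ) :
    HasBarrier (absShifted F α l) Ω (1 / 2) ξ := by
  obtain ⟨ρ, hρ, w, hw, hw0, hwξ, hws⟩ := h
  have hξc : ξ ∈ closure (Ω ∩ Metric.ball ξ ρ) := by
    rw [Set.inter_comm]
    exact Metric.isOpen_ball.inter_closure ⟨Metric.mem_ball_self hρ, hξ.1⟩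
  have h1 : Tendsto (fun x => l * |w x| ^ α) (𝓝[closure (Ω ∩ Metric.ball ξ ρ)] ξ) (𝓝 0) := by
    have := ((continuous_mul_abs_rpow hα l).tendsto (w ξ)).comp (hw ξ hξc)
    rwa [hwξ, abs_zero, Real.zero_rpow hα.ne', mul_zero] at this
  have h2 := h1.eventually_lt_const (show (0 : ℝ) < 1 / 2 by norm_num)
  obtain ⟨ρ', hρ', hsmall⟩ := Metric.eventually_nhds_iff_ball.1 (eventually_nhdsWithin_iff.1 h2)
  have hsub : Ω ∩ Metric.ball ξ (min ρ ρ') ⊆ Ω ∩ Metric.ball ξ ρ :=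
    Set.inter_subset_inter_right _ (Metric.ball_subset_ball (min_le_left _ _))
  refine ⟨min ρ ρ', by positivity, w, hw.mono (closure_mono hsub),
    fun x hx => hw0 x (closure_mono hsub hx), hwξ,
    (hws.mono (hΩ.inter Metric.isOpen_ball) hsub).congr fun x hx p X => ?_⟩
  have := hsmall x (Metric.ball_subset_ball (min_le_right _ _) hx.2) (subset_closure (hsub hx))
  simp only [DegElliptic.absShifted]
  linarith

/-- A positive lower semicontinuous function attains a positive minimum on the compact closure of Ω.
-/
theorem mu_le_lambdaBar {F : Operator N} {α : ℝ} {O Ω : Set (Eu N)} (hΩo : IsOpen Ω)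
    (hΩ : Bornology.IsBounded Ω) : mu F α O Ω ≤ lambdaBar F α Ω := by
  refine sSup_le_sSup (Set.image_mono ?_)
  rintro l ⟨Ω', -, hΩΩ', -, φ, hφ, hpos, hsuper⟩
  have hsub : Ω ⊆ Ω' := subset_closure.trans hΩΩ'
  refine ⟨φ, hφ.mono hsub, ?_, hsuper.mono hΩo hsub⟩
  rcases (closure Ω).eq_empty_or_nonempty with he | hne
  · exact ⟨1, one_pos, fun x hx => by
      have := subset_closure hx
      rw [he] at this
      exact this.elim⟩
  · obtain ⟨z, hz, hmin⟩ := (hφ.mono hΩΩ').exists_isMinOn hne hΩ.isCompact_closure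
    exact ⟨φ z, hpos z (hΩΩ' hz), fun x hx => hmin (subset_closure hx)⟩

end DegElliptic

end

open DegElliptic in
theorem theorem4p2 {N : ℕ} (Ω O V : Set (DegElliptic.Eu N))
    (hΩ_open : IsOpen Ω) (hΩ_conn : IsConnected Ω) (hΩ_bdd : Bornology.IsBounded Ω)
    (hΩ_smooth : DegElliptic.HasSmoothBoundary Ω)
    (hO : IsOpen O) (hΩO : closure Ω ⊆ O)
    (hV : IsOpen V) (hVΩ : frontier Ω ⊆ V)
    (F : DegElliptic.Operator N) (α : ℝ) (hα : 0 < α)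
    (hF : DegElliptic.IsContinuousOperator F O)
    (h_ell : DegElliptic.IsDegenerateElliptic F O)
    (h_hom : DegElliptic.IsHomogeneous F O α)
    (h_val : DegElliptic.IsUniformlyContinuousInValue F O)
    (h_struct : DegElliptic.StructureCondition F O)
    (h_unif : DegElliptic.IsUniformlyContinuousNear F (closure Ω ∩ V))
    (h_bdry : DegElliptic.BoundaryStructureCondition F (closure Ω ∩ V))
    (h_barrier : ∀ ξ ∈ frontier Ω, DegElliptic.AdmitsBarrier F Ω ξ) :
    DegElliptic.mu F α O Ω = DegElliptic.lambdaBar F α Ω ∧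
      (DegElliptic.MaximumPrinciple F Ω ↔ 0 < DegElliptic.lambdaBar F α Ω) := by
  have hle : mu F α O Ω ≤ lambdaBar F α Ω := mu_le_lambdaBar hΩ_open hΩ_bdd
  have hge : lambdaBar F α Ω ≤ mu F α O Ω := by
    refine sSup_le ?_
    rintro _ ⟨l, ⟨φ, hφ, ⟨c, hc, hcφ⟩, hsuper⟩, rfl⟩
    by_contra! hlt
    obtain ⟨l', hl', hl'l⟩ := EReal.lt_iff_exists_real_btwn.1 hlt
    have hll : 0 < l - l' := sub_pos.2 (EReal.coe_lt_coe_iff.1 hl'l)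
    -- Since φ > 0, the inequality at level l for F is one at level l − l' > 0 for F − l'|r|^α.
    have hMP : MaximumPrinciple (absShifted F α l') Ω :=
      maximumPrinciple_of_supersolution hΩ_open hΩ_bdd hΩ_smooth hΩO hV hVΩ hα
        (hF.absShifted hα l') (h_hom.absShifted l') (h_val.absShifted hα l')
        (h_struct.absShifted α l') (h_unif.absShifted hα l') (h_bdry.absShifted α l')
        one_half_pos (fun ξ hξ => (h_barrier ξ hξ).absShifted hα l' hΩ_open hξ) hll hφ hc hcφ
        (hsuper.congr fun x hx p X => by
          simp only [shifted, absShifted]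
          rw [abs_of_pos (hc.trans_le (hcφ x hx))]
          linarith)
    obtain ⟨ε, hε, Ω', hΩ', h1, h2, χ, hχ, hpos, hsup⟩ :=
      exists_supersolution_of_maximumPrinciple hα hΩ_open hΩ_bdd hO hΩO (hF.absShifted hα l')
        (h_ell.absShifted α l') (h_hom.absShifted l') hMP
    -- Undoing the shift on the positive function χ makes l' + ε admissible for μ₁, contrary to μ₁ <
    -- l'.
    refine absurd hl' (not_lt.2 (le_sSup_of_le ⟨l' + ε, ⟨Ω', hΩ', h1, h2, χ, hχ, hpos,
      hsup.congr fun x hx p X => ?_⟩, rfl⟩ (EReal.coe_le_coe_iff.2 (by linarith))))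
    simp only [shifted, absShifted]
    rw [abs_of_pos (hpos x hx)]
    linarith
  refine ⟨le_antisymm hle hge, fun hMP => ?_, fun hpos => ?_⟩
  · obtain ⟨ε, hε, hmem⟩ :=
      exists_supersolution_of_maximumPrinciple hα hΩ_open hΩ_bdd hO hΩO hF h_ell h_hom hMP
    have h1 : (ε : EReal) ≤ mu F α O Ω := le_sSup ⟨ε, hmem, rfl⟩
    exact (EReal.coe_pos.2 hε).trans_le (h1.trans hle)
  · obtain ⟨_, ⟨l, ⟨φ, hφ, ⟨c, hc, hcφ⟩, hsuper⟩, rfl⟩, hl⟩ := lt_sSup_iff.1 hpos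
    exact maximumPrinciple_of_supersolution hΩ_open hΩ_bdd hΩ_smooth hΩO hV hVΩ hα hF h_hom h_val
      h_struct h_unif h_bdry one_pos h_barrier (EReal.coe_pos.1 hl) hφ hc hcφ hsuper
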